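/- **Soundness of algorithmic typechecking (BiRelCost to RelCostCore).** *Index terms and constraints.* Sorts are $S::=\mathbb N\mid\mathbb R$. Index terms $I,k,t,n,\alpha$ are built from index variables, the cost constants $c_{app},c_{proj},c_{case},c_{caseL},c_{let},c_{unpack}$, $0$, $\infty$, $I+1$, $+,-,/,\cdot$, $\lceil\cdot\rceil,\lfloor\cdot\rfloor,\log,\,I^{J},\min,\max$ and $\sum_{i=I_1}^{I_2}I$. They denote extended reals ($\mathbb N$ denotes the natural numbers, $\mathbb R$ all extended reals, and $\mathbb N$ is a subsort of $\mathbb R$); the cost constants denote fixed nonnegative reals. Universal index variables are declared in an environment $\Delta$, existential ones in an environment $\psi$; $\Delta;\psi\vdash I::S$ is sorting ($0::\mathbb N$; $\infty$ and the cost constants $::\mathbb R$; $-,/,\log$ are operations on $\mathbb R$; $\lceil\cdot\rceil,\lfloor\cdot\rfloor:\mathbb R\to\mathbb N$; $+1,+,\cdot$, powers, $\min,\max$ are operations on each sort; a sum has limits of sort $\mathbb N$). Constraints are $C::=I=J\mid I<J\mid\neg C$, with $I\le J:=\neg(J<I)$ and $\bot:=0<0$; $\Phi_a$ is a finite conjunction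 of constraints. $\Delta;\psi;\Phi_a\models C$ means that every valuation of the variables that respects the sorts in $\Delta,\psi$ and satisfies $\Phi_a$ satisfies $C$. Generated constraints are $\Phi::=\top\mid C\mid\Phi\wedge\Phi\mid C\to\Phi\mid\forall i{::}S.\Phi\mid\exists a{::}S.\Phi$. $\Delta;\Phi_a\models\Phi$ *is provable* if it is derivable by: $\top$ always; $C$ if $\Delta;\Phi_a\models C$; conjunctions componentwise; $C\to\Phi$ from $\Delta;\Phi_a\wedge C\models\Phi$; $\forall i{::}S.\Phi$ from $i{::}S,\Delta;\Phi_a\models\Phi$; $\exists a{::}S.\Phi$ from $\Delta;\Phi_a\models\Phi[I/a]$ for some index term with $\Delta\vdash I::S$. $\Delta\vdash\theta:\psi$ means $\Delta\vdash\theta(a)::S$ for every $a{::}S$ in $\psi$. *Types and contexts.* Unary types: $A::=\mathrm{unit}\mid\mathrm{int}\mid A\times A\mid A+A\mid A\xrightarrow{exec(k,t)}A\mid list[n]\,A\mid\forall^{exec(k,t)}i{::}S.A\mid\exists i{::}S.A\mid C\mathbin{\&}A\mid C\supset A$. Relational types: $\tau::=\mathrm{unit}\mid\mathrm{int}\mid\tau\times\tau\mid\tau+\tau\mid\tau\xrightarrow{diff(t)}\tau\mid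 list[n]^\alpha\tau\mid\forall^{diff(t)}i{::}S.\tau\mid\exists i{::}S.\tau\mid U(A,A)\mid\Box\tau\mid C\mathbin{\&}\tau\mid C\supset\tau$. Well-formedness requires $n,\alpha::\mathbb N$ and costs (and both sides of a constraint) of sort $\mathbb R$. $|\tau|_1,|\tau|_2$ are the unary projections ($|U(A_1,A_2)|_i=A_i$, $|\Box\tau|_i=|\tau|_i$, $|list[n]^\alpha\tau|_i=list[n]|\tau|_i$, relational arrows and universal types get cost $exec(0,\infty)$, all else homomorphically). $\Omega$, $\Gamma$ are unary and relational typing contexts (finite maps). $\Upsilon$ assigns to primitives $\zeta$ unary types $A_1\xrightarrow{exec(k,t)}A_2$ and/or relational types $\tau_1\xrightarrow{diff(t)}\tau_2$ without free index variables. Expressions of RelCostCore are $x$, integers, $()$, $\mathrm{fix}\,f(x).e$, $\mathrm{fix}_{NC}f(x).e$, $e\,e$, $\zeta\,e$, $\langle e,e\rangle$, $\pi_1e,\pi_2e$, $\mathrm{inl}\,e,\mathrm{inr}\,e$, $\mathrm{case}(e,x.e,y.e)$, $\mathrm{nil}$, $\mathrm{cons}_{NC}(e,e)$, $\mathrm{cons}_C(e,e)$,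 list case with branches for nil, $h::_{NC}tl$ and $h::_Ctl$, $\Lambda i.e$, $e[I]$, $\mathrm{pack}\,e\,\mathrm{with}\,I$, $\mathrm{unpack}\,e\,\mathrm{as}\,(x,i)\,\mathrm{in}\,e$, $\mathrm{let}$, $\mathrm{clet}\,e\,\mathrm{as}\,x\,\mathrm{in}\,e$, $\mathrm{celim}\,e$, $\mathrm{der}\,e$, $\mathrm{switch}\,e$, $NC\,e$, $\mathrm{split}(e,e)\,\mathrm{with}\,C$, $\mathrm{contra}\,e$. BiRelCost adds the annotations $(e:A,k,t)$ and $(e:\tau,t)$; $|e|$ denotes $e$ with all annotations erased. *RelCostCore.* Unary subtyping $A\sqsubseteq A'$ is reflexive, transitive, structural, contravariant in arrow domains; it lets $exec(k,t)$ become $exec(k',t')$ when $k'\le k$, $t\le t'$ are entailed, needs $n=n'$ for lists, $C'\models C$ for $C\supset A\sqsubseteq C'\supset A'$ and $C\models C'$ for $C\mathbin{\&}A\sqsubseteq C'\mathbin{\&}A'$ (under $\Phi_a$). Relational equivalence $\tau\equiv\tau'$ is structural with entailed equality of all index terms, mutual entailment of constraints, and mutual subtyping of the components of $U$. The typing judgments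 are $\Delta;\Phi_a;\Omega\vdash_k^te:A$ (minimum and maximum cost) and $\Delta;\Phi_a;\Gamma\vdash e_1\ominus e_2\lesssim t:\tau$ (relative cost). Values and variables cost $0$ (a pair, sum injection or cons costs the sum of its parts). The unary elimination forms add to the costs of their parts (and the latent cost of an arrow or universal type) the constants $c_{app}$ (application and primitive application), $c_{proj}$, $c_{case}$, $c_{caseL}$, $c_{let}$, $c_{unpack}$; relational synchronous rules add no constant. A unary list case types its nil branch under $n=0$ and its $NC$ branch under $n=i+1$; a relational one types nil under $n=0$, the $NC$ branch under $n=i+1$ with $h:\Box\tau$, $tl:list[i]^\alpha\tau$, and the $C$ branch under $n=i+1$, $\alpha=\beta+1$ with $h:\tau$, $tl:list[i]^\beta\tau$. $\mathrm{cons}_C:list[n+1]^{\alpha+1}\tau$ from a head of type $\tau$, $\mathrm{cons}_{NC}:list[n+1]^{\alpha}\tau$ from a head of type $\Box\tau$. $C\mathbin{\&}A$ is introduced when $C$ is entailed (typing the expression under $C$) and eliminated by $\mathrm{clet}$ (body typed under $C$); $C\supset A$ is introduced under $C$ and eliminated by $\mathrm{celim}$ when $C$ is entailed; $\mathrm{split}$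 types its parts under $C$ and $\neg C$; $\mathrm{contra}\,e$ has any type and cost when $\Phi_a\models\bot$ and the context is well-formed; $\mathrm{inl}$, $\mathrm{inr}$ and $\mathrm{nil}$ require the type they do not determine to be well-formed. Further relational rules: $\mathrm{switch}\,e_1\ominus\mathrm{switch}\,e_2\lesssim t_1-k_2:U(A_1,A_2)$ from unary typings of $e_i$ in $|\Gamma|_i$; $NC\,e\ominus NC\,e\lesssim0:\Box\tau$ in $\Box\Gamma,\Gamma'$ if $e\ominus e\lesssim t:\tau$ in $\Box\Gamma$, and likewise $\mathrm{fix}_{NC}$ at type $\Box(\tau_1\to\tau_2)$; $\mathrm{der}$ from $\Box\tau$ to $\tau$; and the asynchronous rules (one-sided $e_1$ or $e_1'$ typed unarily in $|\Gamma|_1$ resp. $|\Gamma|_2$ with cost $[k_1,t_1]$, the remainder with relative cost $t_2$, bound variables of type $U(A,A)$): let/$e$ at $t_1+t_2+c_{let}$, $e$/let at $t_2-k_1-c_{let}$, app/$e$ at $t_1+t_2+t+c_{app}$, $e$/app at $t_2-k_1-k-c_{app}$, case/$e$ at $t_1+t_2+c_{case}$, $e$/case at $t_2-k_1-c_{case}$.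 Subsumption: unary by $\sqsubseteq$ with $k'\le k$, $t\le t'$; relational by $\equiv$ with $t\le t'$. *Algorithmic system.* There are four judgments, with $\Delta$, $\psi_a$ (existential variables in scope), $\Phi_a$ and a context as inputs: unary checking $\Delta;\psi_a;\Phi_a;\Omega\vdash e\downarrow A,k,t\Rightarrow\Phi$; unary inference $\Delta;\psi_a;\Phi_a;\Omega\vdash e\uparrow A\Rightarrow[\psi],k,t,\Phi$, where $\psi$ lists the newly generated existential variables; and relational checking $\Delta;\psi_a;\Phi_a;\Gamma\vdash e\ominus e'\downarrow\tau,t\Rightarrow\Phi$ and inference $\Delta;\psi_a;\Phi_a;\Gamma\vdash e\ominus e'\uparrow\tau\Rightarrow[\psi],t,\Phi$. Constants, variables, projections, applications, primitive applications, $e[I]$, $\mathrm{celim}$, $\mathrm{der}$, $\mathrm{switch}$ and annotated expressions infer; the other forms, and also $\mathrm{switch}$, check. Each rule is the corresponding RelCostCore rule in which: the unknown costs, list lengths and difference counts of checked subexpressions are fresh existential variables, distinct and not in scope; these, and the $\psi$ of inferred subexpressions, are existentially quantified in the $\Phi$ of a checking judgment and returned in $\psi$ by an inference judgment; $\Phi$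 conjoins the $\Phi$'s of the premises with the equations between index terms that the rule prescribes, and a side condition $C$ of the rule becomes a conjunct; premises with an extra universal variable or assumption contribute $\forall i{::}S.\Phi'$ or $C\to\Phi'$. (In the $e$/app rule the prescribed equation is $t_2-k_1-k+c_{app}=t$. The rules app/$e$ and $e$/app allow, in addition, algorithmic subtyping of the result type. Equations on total costs are never placed under $C\to$.) Subsumption is replaced by the rule that checks $e$ against $A,k,t$ when $e$ infers $A',[\psi],k',t',\Phi_1$ and $A'\sqsubseteq A\Rightarrow\Phi_2$, with $\exists\psi.\,(\Phi_1\wedge\Phi_2)\wedge(t'\le t\wedge k\le k')$, relationally with $\equiv$ and $\exists\psi.\,(\Phi_1\wedge\Phi_2)\wedge t'\le t$; algorithmic $\sqsubseteq$ (reflexive and structural) and $\equiv$ (structural) emit the constraints that the declarative rules require to be entailed. An annotated expression $(e:A,k,t)$ infers $A,k,t$, with $\psi$ empty, when $e$ checks against them, $A$ is well-formed over $\Delta$ and $A,k,t$ contain only variables of $\Delta$; likewise $(e:\tau,t)$. The expression $\mathrm{contra}\,e$ checks, with $\Phi=\top$, when $\Delta;\psi_a;\Phi_a\models\bot$ and the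 context is well-formed. A constraint or index term written in an expression is well-sorted over $\Delta$. **Theorem.** Write $X[\theta]$ for substitution and $FIV(X)$ for free index variables. 1. Suppose $\Delta;\psi_a;\Phi_a;\Omega\vdash e\downarrow A,k,t\Rightarrow\Phi$ and $FIV(\Phi_a,\Omega,A,k,t)\subseteq dom(\Delta,\psi_a)$. For every $\theta_a$ with $\Delta\vdash\theta_a:\psi_a$ such that $\Delta;\Phi_a[\theta_a]\models\Phi[\theta_a]$ is provable, $\Delta;\Phi_a[\theta_a];\Omega[\theta_a]\vdash_{k[\theta_a]}^{t[\theta_a]}|e|:A[\theta_a]$ in RelCostCore. 2. Suppose $\Delta;\psi_a;\Phi_a;\Omega\vdash e\uparrow A\Rightarrow[\psi],k,t,\Phi$ and $FIV(\Phi_a,\Omega)\subseteq dom(\Delta,\psi_a)$. For all $\theta,\theta_a$ with $\Delta\vdash\theta:\psi$ and $\Delta\vdash\theta_a:\psi_a$ such that $\Delta;\Phi_a[\theta_a]\models\Phi[\theta\,\theta_a]$ is provable, $\Delta;\Phi_a[\theta_a];\Omega[\theta_a]\vdash_{k[\theta\,\theta_a]}^{t[\theta\,\theta_a]}|e|:A[\theta\,\theta_a]$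 in RelCostCore. 3. Suppose $\Delta;\psi_a;\Phi_a;\Gamma\vdash e\ominus e'\downarrow\tau,t\Rightarrow\Phi$ and $FIV(\Phi_a,\Gamma,\tau,t)\subseteq dom(\Delta,\psi_a)$. For every $\theta_a$ with $\Delta\vdash\theta_a:\psi_a$ such that $\Delta;\Phi_a[\theta_a]\models\Phi[\theta_a]$ is provable, $\Delta;\Phi_a[\theta_a];\Gamma[\theta_a]\vdash|e|\ominus|e'|\lesssim t[\theta_a]:\tau[\theta_a]$ in RelCostCore. 4. Suppose $\Delta;\psi_a;\Phi_a;\Gamma\vdash e\ominus e'\uparrow\tau\Rightarrow[\psi],t,\Phi$ and $FIV(\Phi_a,\Gamma)\subseteq dom(\Delta,\psi_a)$. For all $\theta,\theta_a$ with $\Delta\vdash\theta:\psi$ and $\Delta\vdash\theta_a:\psi_a$ such that $\Delta;\Phi_a[\theta_a]\models\Phi[\theta\,\theta_a]$ is provable, $\Delta;\Phi_a[\theta_a];\Gamma[\theta_a]\vdash|e|\ominus|e'|\lesssim t[\theta\,\theta_a]:\tau[\theta\,\theta_a]$ in RelCostCore. -/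

import Mathlib

open scoped NNReal

namespace BiRelCost

/-! Sorts, index terms and constraints.

Universally quantified index variables (those of a sort environment `Δ`) are de Bruijn indices;
existential index variables (those of an environment `ψ`) are named by natural numbers. -/

inductive ISort where
  | nat
  | real

/-- The cost constants of the elimination forms. -/
inductive CostConst where
  | app
  | proj
  | case
  | caseL
  | letC
  | unpack

/-- A cost model assigns a nonnegative real to every cost constant. -/
abbrev CostModel := CostConst → ℝ≥0

/-- Index terms. `sum I₁ I₂ I` is `∑_{i = I₁}^{I₂} I` and binds index `0` in `I`. -/
inductive Idx where
  | var (n : ℕ)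
  | evar (a : ℕ)
  | cst (c : CostConst)
  | zero
  | infty
  | succ (I : Idx)
  | add (I J : Idx)
  | sub (I J : Idx)
  | div (I J : Idx)
  | mul (I J : Idx)
  | ceil (I : Idx)
  | floor (I : Idx)
  | log (I : Idx)
  | pow (I J : Idx)
  | min (I J : Idx)
  | max (I J : Idx)
  | sum (lo hi body : Idx)

/-- Sort environments for universal variables; the most recent binding comes first. -/
abbrev UEnv := List ISort

/-- Sort environments for existential variables. -/
abbrev EEnv := List (ℕ × ISort)

/-- The names bound by an existential environment. -/
def EEnv.dom (ψ : EEnv) : List ℕ := ψ.map Prod.fst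

/-- Lifting of a renaming under one binder. -/
def liftRen (f : ℕ → ℕ) : ℕ → ℕ
  | 0 => 0
  | n + 1 => f n + 1

def Idx.rename : Idx → (ℕ → ℕ) → Idx
  | .var n, f => .var (f n)
  | .evar a, _ => .evar a
  | .cst c, _ => .cst c
  | .zero, _ => .zero
  | .infty, _ => .infty
  | .succ I, f => .succ (I.rename f)
  | .add I J, f => .add (I.rename f) (J.rename f)
  | .sub I J, f => .sub (I.rename f) (J.rename f)
  | .div I J, f => .div (I.rename f) (J.rename f)
  | .mul I J, f => .mul (I.rename f) (J.rename f)
  | .ceil I, f => .ceil (I.rename f)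
  | .floor I, f => .floor (I.rename f)
  | .log I, f => .log (I.rename f)
  | .pow I J, f => .pow (I.rename f) (J.rename f)
  | .min I J, f => .min (I.rename f) (J.rename f)
  | .max I J, f => .max (I.rename f) (J.rename f)
  | .sum I J K, f => .sum (I.rename f) (J.rename f) (K.rename (liftRen f))

/-- A simultaneous substitution for universal (`u`) and existential (`e`) index variables. -/
structure ISubst where
  u : ℕ → Idx
  e : ℕ → Idx

namespace ISubst

/-- Lifting of a substitution under one index binder. -/
def lift (s : ISubst) : ISubst where
  u := fun n => match n with
    | 0 => .var 0
    | n + 1 => (s.u n).rename Nat.succ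
  e := fun a => (s.e a).rename Nat.succ

/-- Weakening by one universal variable. -/
def shift : ISubst := ⟨fun n => .var (n + 1), .evar⟩

/-- `[I / i]` where `i` is the innermost universal variable. -/
def inst (I : Idx) : ISubst where
  u := fun n => match n with
    | 0 => I
    | n + 1 => .var n
  e := .evar

/-- A substitution of existential variables only. -/
def ofE (θ : ℕ → Idx) : ISubst := ⟨.var, θ⟩

/-- `[a ↦ I]` for one existential variable `a`. -/
def single (a : ℕ) (I : Idx) : ISubst := ofE (Function.update Idx.evar a I)

/-- The restriction of a substitution that leaves the existential variable `a` alone. -/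
def keep (s : ISubst) (a : ℕ) : ISubst := ⟨s.u, Function.update s.e a (.evar a)⟩

end ISubst

def Idx.subst : Idx → ISubst → Idx
  | .var n, s => s.u n
  | .evar a, s => s.e a
  | .cst c, _ => .cst c
  | .zero, _ => .zero
  | .infty, _ => .infty
  | .succ I, s => .succ (I.subst s)
  | .add I J, s => .add (I.subst s) (J.subst s)
  | .sub I J, s => .sub (I.subst s) (J.subst s)
  | .div I J, s => .div (I.subst s) (J.subst s)
  | .mul I J, s => .mul (I.subst s) (J.subst s)
  | .ceil I, s => .ceil (I.subst s)
  | .floor I, s => .floor (I.subst s)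
  | .log I, s => .log (I.subst s)
  | .pow I J, s => .pow (I.subst s) (J.subst s)
  | .min I J, s => .min (I.subst s) (J.subst s)
  | .max I J, s => .max (I.subst s) (J.subst s)
  | .sum I J K, s => .sum (I.subst s) (J.subst s) (K.subst s.lift)

/-- All free variables are among the first `d` universal variables and the names in `E`. -/
def Idx.Scoped : Idx → ℕ → List ℕ → Prop
  | .var n, d, _ => n < d
  | .evar a, _, E => a ∈ E
  | .cst _, _, _ => True
  | .zero, _, _ => True
  | .infty, _, _ => True
  | .succ I, d, E => I.Scoped d E
  | .add I J, d, E => I.Scoped d E ∧ J.Scoped d E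
  | .sub I J, d, E => I.Scoped d E ∧ J.Scoped d E
  | .div I J, d, E => I.Scoped d E ∧ J.Scoped d E
  | .mul I J, d, E => I.Scoped d E ∧ J.Scoped d E
  | .ceil I, d, E => I.Scoped d E
  | .floor I, d, E => I.Scoped d E
  | .log I, d, E => I.Scoped d E
  | .pow I J, d, E => I.Scoped d E ∧ J.Scoped d E
  | .min I J, d, E => I.Scoped d E ∧ J.Scoped d E
  | .max I J, d, E => I.Scoped d E ∧ J.Scoped d E
  | .sum I J K, d, E => I.Scoped d E ∧ J.Scoped d E ∧ K.Scoped (d + 1) E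

/-- Sorting of index terms, `Δ; ψ ⊢ I :: S`; the sort `ℕ` is a subsort of `ℝ`. -/
inductive HasSort : UEnv → EEnv → Idx → ISort → Prop
  | var {Δ ψ n S} : Δ[n]? = some S → HasSort Δ ψ (.var n) S
  | evar {Δ ψ a S} : (a, S) ∈ ψ → HasSort Δ ψ (.evar a) S
  | cst {Δ ψ c} : HasSort Δ ψ (.cst c) .real
  | zero {Δ ψ} : HasSort Δ ψ .zero .nat
  | infty {Δ ψ} : HasSort Δ ψ .infty .real
  | succ {Δ ψ I S} : HasSort Δ ψ I S → HasSort Δ ψ (.succ I) S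
  | add {Δ ψ I J S} : HasSort Δ ψ I S → HasSort Δ ψ J S → HasSort Δ ψ (.add I J) S
  | sub {Δ ψ I J} :
      HasSort Δ ψ I .real → HasSort Δ ψ J .real → HasSort Δ ψ (.sub I J) .real
  | div {Δ ψ I J} :
      HasSort Δ ψ I .real → HasSort Δ ψ J .real → HasSort Δ ψ (.div I J) .real
  | mul {Δ ψ I J S} : HasSort Δ ψ I S → HasSort Δ ψ J S → HasSort Δ ψ (.mul I J) S
  | ceil {Δ ψ I} : HasSort Δ ψ I .real → HasSort Δ ψ (.ceil I) .nat
  | floor {Δ ψ I} : HasSort Δ ψ I .real → HasSort Δ ψ (.floor I) .nat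
  | log {Δ ψ I} : HasSort Δ ψ I .real → HasSort Δ ψ (.log I) .real
  | pow {Δ ψ I J S} : HasSort Δ ψ I S → HasSort Δ ψ J S → HasSort Δ ψ (.pow I J) S
  | min {Δ ψ I J S} : HasSort Δ ψ I S → HasSort Δ ψ J S → HasSort Δ ψ (.min I J) S
  | max {Δ ψ I J S} : HasSort Δ ψ I S → HasSort Δ ψ J S → HasSort Δ ψ (.max I J) S
  | sum {Δ ψ I J K S} :
      HasSort Δ ψ I .nat → HasSort Δ ψ J .nat → HasSort (.nat :: Δ) ψ K S →
      HasSort Δ ψ (.sum I J K) S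
  | subsort {Δ ψ I} : HasSort Δ ψ I .nat → HasSort Δ ψ I .real

/-! Interpretation of index terms in the extended reals. -/

/-- The carrier of a sort: the natural numbers, respectively all extended reals. -/
def ISort.carrier : ISort → Set EReal
  | .nat => Set.range (fun n : ℕ => (n : EReal))
  | .real => Set.univ

open scoped Classical in
/-- Logarithm to base 2 on the extended reals. -/
noncomputable def elog (x : EReal) : EReal :=
  if x = ⊤ then ⊤ else if x ≤ 0 then ⊥ else ((Real.logb 2 x.toReal : ℝ) : EReal)

open scoped Classical in
/-- Powers on the extended reals, extending the real power function. -/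
noncomputable def epow (x y : EReal) : EReal :=
  if y = 0 then 1
  else if x = ⊤ then (if 0 < y then ⊤ else 0)
  else if y = ⊤ then (if 1 < x then ⊤ else if x = 1 then 1 else 0)
  else if y = ⊥ then (if 1 < x then 0 else if x = 1 then 1 else ⊤)
  else if x = ⊥ then (if 0 < y then ⊥ else 0)
  else ((x.toReal ^ y.toReal : ℝ) : EReal)

/-- Extension of a valuation of the universal variables by a value for a new innermost one. -/
def consVal (x : EReal) (ρ : ℕ → EReal) : ℕ → EReal
  | 0 => x
  | n + 1 => ρ n

/-- The value of an index term. Ceiling and floor take values in the natural numbers. -/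
noncomputable def Idx.eval (c : CostModel) : Idx → (ℕ → EReal) → (ℕ → EReal) → EReal
  | .var n, ρ, _ => ρ n
  | .evar a, _, η => η a
  | .cst k, _, _ => (((c k : ℝ≥0) : ℝ) : EReal)
  | .zero, _, _ => 0
  | .infty, _, _ => ⊤
  | .succ I, ρ, η => I.eval c ρ η + 1
  | .add I J, ρ, η => I.eval c ρ η + J.eval c ρ η
  | .sub I J, ρ, η => I.eval c ρ η - J.eval c ρ η
  | .div I J, ρ, η => I.eval c ρ η / J.eval c ρ η
  | .mul I J, ρ, η => I.eval c ρ η * J.eval c ρ η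
  | .ceil I, ρ, η => ((⌈(I.eval c ρ η).toReal⌉₊ : ℕ) : EReal)
  | .floor I, ρ, η => ((⌊(I.eval c ρ η).toReal⌋₊ : ℕ) : EReal)
  | .log I, ρ, η => elog (I.eval c ρ η)
  | .pow I J, ρ, η => epow (I.eval c ρ η) (J.eval c ρ η)
  | .min I J, ρ, η => Min.min (I.eval c ρ η) (J.eval c ρ η)
  | .max I J, ρ, η => Max.max (I.eval c ρ η) (J.eval c ρ η)
  | .sum I J K, ρ, η =>
      ∑ j ∈ Finset.Icc ⌈(I.eval c ρ η).toReal⌉₊ ⌊(J.eval c ρ η).toReal⌋₊,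
        K.eval c (consVal (j : EReal) ρ) η

/-! Constraints. -/

inductive Constr where
  | eq (I J : Idx)
  | lt (I J : Idx)
  | neg (C : Constr)

namespace Constr

/-- `I ≤ J`, that is `¬ (J < I)`. -/
def le (I J : Idx) : Constr := .neg (.lt J I)

/-- Absurdity, as the constraint `0 < 0`. -/
def bot : Constr := .lt .zero .zero

def subst : Constr → ISubst → Constr
  | .eq I J, s => .eq (I.subst s) (J.subst s)
  | .lt I J, s => .lt (I.subst s) (J.subst s)
  | .neg C, s => .neg (C.subst s)

def Scoped : Constr → ℕ → List ℕ → Prop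
  | .eq I J, d, E => I.Scoped d E ∧ J.Scoped d E
  | .lt I J, d, E => I.Scoped d E ∧ J.Scoped d E
  | .neg C, d, E => C.Scoped d E

/-- Well-formedness of constraints. -/
def Wf (Δ : UEnv) (ψ : EEnv) : Constr → Prop
  | .eq I J => HasSort Δ ψ I .real ∧ HasSort Δ ψ J .real
  | .lt I J => HasSort Δ ψ I .real ∧ HasSort Δ ψ J .real
  | .neg C => C.Wf Δ ψ

def Holds (c : CostModel) (ρ η : ℕ → EReal) : Constr → Prop
  | .eq I J => I.eval c ρ η = J.eval c ρ η
  | .lt I J => I.eval c ρ η < J.eval c ρ η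
  | .neg C => ¬ C.Holds c ρ η

end Constr

/-- Constraint environments `Φ_a`, read as conjunctions. -/
abbrev CEnv := List Constr

def CEnv.subst (Φa : CEnv) (s : ISubst) : CEnv := Φa.map (fun C => C.subst s)

def CEnv.Scoped (Φa : CEnv) (d : ℕ) (E : List ℕ) : Prop := ∀ C ∈ Φa, C.Scoped d E

/-- `Δ; ψ; Φ_a ⊨ C`: every well-sorted valuation that satisfies `Φ_a` satisfies `C`. -/
def Entails (c : CostModel) (Δ : UEnv) (ψ : EEnv) (Φa : CEnv) (C : Constr) : Prop :=
  ∀ ρ η : ℕ → EReal,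
    (∀ n S, Δ[n]? = some S → ρ n ∈ S.carrier) →
    (∀ a S, (a, S) ∈ ψ → η a ∈ S.carrier) →
    (∀ D ∈ Φa, D.Holds c ρ η) → C.Holds c ρ η

/-- The constraints generated by algorithmic judgments. -/
inductive CForm where
  | top
  | atom (C : Constr)
  | and (Φ Ψ : CForm)
  | imp (C : Constr) (Φ : CForm)
  | all (S : ISort) (Φ : CForm)
  | ex (a : ℕ) (S : ISort) (Φ : CForm)

namespace CForm

def subst : CForm → ISubst → CForm
  | .top, _ => .top
  | .atom C, s => .atom (C.subst s)
  | .and Φ Ψ, s => .and (Φ.subst s) (Ψ.subst s)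
  | .imp C Φ, s => .imp (C.subst s) (Φ.subst s)
  | .all S Φ, s => .all S (Φ.subst s.lift)
  | .ex a S Φ, s => .ex a S (Φ.subst (s.keep a))

/-- `∃ ψ. Φ`. -/
def exs (ψ : EEnv) (Φ : CForm) : CForm := ψ.foldr (fun p Ψ => .ex p.1 p.2 Ψ) Φ

def eq (I J : Idx) : CForm := .atom (.eq I J)

def le (I J : Idx) : CForm := .atom (.le I J)

/-- `C ↔ C'`, as two implications. -/
def iff (C C' : Constr) : CForm := .and (.imp C (.atom C')) (.imp C' (.atom C))

end CForm

/-- `Δ; Φ_a ⊨ Φ` is provable. Constraints are decided by entailment; a proof of an existential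
exhibits a well-sorted index term over `Δ`. -/
inductive Prov (c : CostModel) : UEnv → CEnv → CForm → Prop
  | top {Δ Φa} : Prov c Δ Φa .top
  | atom {Δ Φa C} : Entails c Δ [] Φa C → Prov c Δ Φa (.atom C)
  | and {Δ Φa Φ Ψ} : Prov c Δ Φa Φ → Prov c Δ Φa Ψ → Prov c Δ Φa (.and Φ Ψ)
  | imp {Δ Φa C Φ} : Prov c Δ (C :: Φa) Φ → Prov c Δ Φa (.imp C Φ)
  | all {Δ Φa S Φ} : Prov c (S :: Δ) (Φa.subst .shift) Φ → Prov c Δ Φa (.all S Φ)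
  | ex {Δ Φa a S Φ} (I : Idx) :
      HasSort Δ [] I S → Prov c Δ Φa (Φ.subst (.single a I)) → Prov c Δ Φa (.ex a S Φ)

/-- `Δ ⊢ θ : ψ`: the substitution `θ` maps every variable of `ψ` to an index term over `Δ` of the
declared sort, and every other existential variable to itself. -/
def SubstOk (Δ : UEnv) (θ : ℕ → Idx) (ψ : EEnv) : Prop :=
  (∀ a S, (a, S) ∈ ψ → HasSort Δ [] (θ a) S) ∧ ∀ a, a ∉ ψ.dom → θ a = .evar a

/-- The names in `l` are pairwise distinct and not bound in `ψ`. -/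
def Fresh (l : List ℕ) (ψ : EEnv) : Prop := l.Nodup ∧ ∀ a ∈ l, a ∉ ψ.dom

/-- Existential real-sorted variables with the given names. -/
def reals (l : List ℕ) : EEnv := l.map (fun a => (a, ISort.real))

/-! Types. The bound variable of `all` is also bound in the cost annotations. -/

/-- Unary types; `arr A₁ k t A₂` is `A₁ →^{exec(k,t)} A₂`, `all S k t A` is
`∀^{exec(k,t)} i :: S. A`, `cand C A` is `C & A`, `cimp C A` is `C ⊃ A`. -/
inductive UTy where
  | unit
  | int
  | prod (A B : UTy)
  | sum (A B : UTy)
  | arr (A : UTy) (k t : Idx) (B : UTy)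
  | list (n : Idx) (A : UTy)
  | all (S : ISort) (k t : Idx) (A : UTy)
  | ex (S : ISort) (A : UTy)
  | cand (C : Constr) (A : UTy)
  | cimp (C : Constr) (A : UTy)

/-- Relational types; `arr τ₁ t τ₂` is `τ₁ →^{diff(t)} τ₂`, `list n α τ` is `list[n]^α τ`. -/
inductive RTy where
  | unit
  | int
  | prod (τ σ : RTy)
  | sum (τ σ : RTy)
  | arr (τ : RTy) (t : Idx) (σ : RTy)
  | list (n α : Idx) (τ : RTy)
  | all (S : ISort) (t : Idx) (τ : RTy)
  | ex (S : ISort) (τ : RTy)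
  | U (A B : UTy)
  | box (τ : RTy)
  | cand (C : Constr) (τ : RTy)
  | cimp (C : Constr) (τ : RTy)

namespace UTy

def subst : UTy → ISubst → UTy
  | .unit, _ => .unit
  | .int, _ => .int
  | .prod A B, s => .prod (A.subst s) (B.subst s)
  | .sum A B, s => .sum (A.subst s) (B.subst s)
  | .arr A k t B, s => .arr (A.subst s) (k.subst s) (t.subst s) (B.subst s)
  | .list n A, s => .list (n.subst s) (A.subst s)
  | .all S k t A, s => .all S (k.subst s.lift) (t.subst s.lift) (A.subst s.lift)
  | .ex S A, s => .ex S (A.subst s.lift)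
  | .cand C A, s => .cand (C.subst s) (A.subst s)
  | .cimp C A, s => .cimp (C.subst s) (A.subst s)

def Scoped : UTy → ℕ → List ℕ → Prop
  | .unit, _, _ => True
  | .int, _, _ => True
  | .prod A B, d, E => A.Scoped d E ∧ B.Scoped d E
  | .sum A B, d, E => A.Scoped d E ∧ B.Scoped d E
  | .arr A k t B, d, E => A.Scoped d E ∧ k.Scoped d E ∧ t.Scoped d E ∧ B.Scoped d E
  | .list n A, d, E => n.Scoped d E ∧ A.Scoped d E
  | .all _ k t A, d, E => k.Scoped (d + 1) E ∧ t.Scoped (d + 1) E ∧ A.Scoped (d + 1) E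
  | .ex _ A, d, E => A.Scoped (d + 1) E
  | .cand C A, d, E => C.Scoped d E ∧ A.Scoped d E
  | .cimp C A, d, E => C.Scoped d E ∧ A.Scoped d E

/-- Well-formedness of unary types. Sorting does not depend on the assumptions `Φ_a`, so they are
not carried along. -/
def Wf : UEnv → EEnv → UTy → Prop
  | _, _, .unit => True
  | _, _, .int => True
  | Δ, ψ, .prod A B => A.Wf Δ ψ ∧ B.Wf Δ ψ
  | Δ, ψ, .sum A B => A.Wf Δ ψ ∧ B.Wf Δ ψ
  | Δ, ψ, .arr A k t B =>
      A.Wf Δ ψ ∧ B.Wf Δ ψ ∧ HasSort Δ ψ k .real ∧ HasSort Δ ψ t .real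
  | Δ, ψ, .list n A => HasSort Δ ψ n .nat ∧ A.Wf Δ ψ
  | Δ, ψ, .all S k t A =>
      A.Wf (S :: Δ) ψ ∧ HasSort (S :: Δ) ψ k .real ∧ HasSort (S :: Δ) ψ t .real
  | Δ, ψ, .ex S A => A.Wf (S :: Δ) ψ
  | Δ, ψ, .cand C A => C.Wf Δ ψ ∧ A.Wf Δ ψ
  | Δ, ψ, .cimp C A => C.Wf Δ ψ ∧ A.Wf Δ ψ

end UTy

namespace RTy

def subst : RTy → ISubst → RTy
  | .unit, _ => .unit
  | .int, _ => .int
  | .prod τ σ, s => .prod (τ.subst s) (σ.subst s)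
  | .sum τ σ, s => .sum (τ.subst s) (σ.subst s)
  | .arr τ t σ, s => .arr (τ.subst s) (t.subst s) (σ.subst s)
  | .list n α τ, s => .list (n.subst s) (α.subst s) (τ.subst s)
  | .all S t τ, s => .all S (t.subst s.lift) (τ.subst s.lift)
  | .ex S τ, s => .ex S (τ.subst s.lift)
  | .U A B, s => .U (A.subst s) (B.subst s)
  | .box τ, s => .box (τ.subst s)
  | .cand C τ, s => .cand (C.subst s) (τ.subst s)
  | .cimp C τ, s => .cimp (C.subst s) (τ.subst s)

def Scoped : RTy → ℕ → List ℕ → Prop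
  | .unit, _, _ => True
  | .int, _, _ => True
  | .prod τ σ, d, E => τ.Scoped d E ∧ σ.Scoped d E
  | .sum τ σ, d, E => τ.Scoped d E ∧ σ.Scoped d E
  | .arr τ t σ, d, E => τ.Scoped d E ∧ t.Scoped d E ∧ σ.Scoped d E
  | .list n α τ, d, E => n.Scoped d E ∧ α.Scoped d E ∧ τ.Scoped d E
  | .all _ t τ, d, E => t.Scoped (d + 1) E ∧ τ.Scoped (d + 1) E
  | .ex _ τ, d, E => τ.Scoped (d + 1) E
  | .U A B, d, E => A.Scoped d E ∧ B.Scoped d E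
  | .box τ, d, E => τ.Scoped d E
  | .cand C τ, d, E => C.Scoped d E ∧ τ.Scoped d E
  | .cimp C τ, d, E => C.Scoped d E ∧ τ.Scoped d E

/-- Well-formedness of relational types. -/
def Wf : UEnv → EEnv → RTy → Prop
  | _, _, .unit => True
  | _, _, .int => True
  | Δ, ψ, .prod τ σ => τ.Wf Δ ψ ∧ σ.Wf Δ ψ
  | Δ, ψ, .sum τ σ => τ.Wf Δ ψ ∧ σ.Wf Δ ψ
  | Δ, ψ, .arr τ t σ => τ.Wf Δ ψ ∧ σ.Wf Δ ψ ∧ HasSort Δ ψ t .real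
  | Δ, ψ, .list n α τ => HasSort Δ ψ n .nat ∧ HasSort Δ ψ α .nat ∧ τ.Wf Δ ψ
  | Δ, ψ, .all S t τ => τ.Wf (S :: Δ) ψ ∧ HasSort (S :: Δ) ψ t .real
  | Δ, ψ, .ex S τ => τ.Wf (S :: Δ) ψ
  | Δ, ψ, .U A B => A.Wf Δ ψ ∧ B.Wf Δ ψ
  | Δ, ψ, .box τ => τ.Wf Δ ψ
  | Δ, ψ, .cand C τ => C.Wf Δ ψ ∧ τ.Wf Δ ψ
  | Δ, ψ, .cimp C τ => C.Wf Δ ψ ∧ τ.Wf Δ ψ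

/-- The unary projections `|τ|_1` (`left = true`) and `|τ|_2` (`left = false`). -/
def proj (left : Bool) : RTy → UTy
  | .unit => .unit
  | .int => .int
  | .prod τ σ => .prod (τ.proj left) (σ.proj left)
  | .sum τ σ => .sum (τ.proj left) (σ.proj left)
  | .arr τ _ σ => .arr (τ.proj left) .zero .infty (σ.proj left)
  | .list n _ τ => .list n (τ.proj left)
  | .all S _ τ => .all S .zero .infty (τ.proj left)
  | .ex S τ => .ex S (τ.proj left)
  | .U A B => if left then A else B
  | .box τ => τ.proj left
  | .cand C τ => .cand C (τ.proj left)
  | .cimp C τ => .cimp C (τ.proj left)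

end RTy

/-! Typing contexts: finite maps from variables to types, the most recent binding first.
Only the binding that `List.lookup` finds is visible. -/

abbrev UCtx := List (ℕ × UTy)
abbrev RCtx := List (ℕ × RTy)

def UCtx.subst (Ω : UCtx) (s : ISubst) : UCtx := Ω.map (fun p => (p.1, p.2.subst s))

def UCtx.Scoped (Ω : UCtx) (d : ℕ) (E : List ℕ) : Prop :=
  ∀ x A, Ω.lookup x = some A → A.Scoped d E

def UCtx.Wf (Ω : UCtx) (Δ : UEnv) (ψ : EEnv) : Prop :=
  ∀ x A, Ω.lookup x = some A → A.Wf Δ ψ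

namespace RCtx

def subst (Γ : RCtx) (s : ISubst) : RCtx := Γ.map (fun p => (p.1, p.2.subst s))

def Scoped (Γ : RCtx) (d : ℕ) (E : List ℕ) : Prop :=
  ∀ x τ, Γ.lookup x = some τ → τ.Scoped d E

def Wf (Γ : RCtx) (Δ : UEnv) (ψ : EEnv) : Prop :=
  ∀ x τ, Γ.lookup x = some τ → τ.Wf Δ ψ

/-- `|Γ|_1` and `|Γ|_2`. -/
def proj (left : Bool) (Γ : RCtx) : UCtx := Γ.map (fun p => (p.1, p.2.proj left))

/-- `□Γ`. -/
def box (Γ : RCtx) : RCtx := Γ.map (fun p => (p.1, .box p.2))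

/-- `D` is of the form `Γ, Γ'` for some `Γ'`. -/
def Extends (D Γ : RCtx) : Prop := ∀ x τ, Γ.lookup x = some τ → D.lookup x = some τ

end RCtx

/-! Expressions. Term variables and primitive operations are named by natural numbers; index
variables are bound in `iLam`, in the body of `unpack`, in the second branch of `caseL` (the length
`i` of the tail) and in its third branch (`i` and the number `β` of differences of the tail, `β`
innermost). Both cons branches name the head first and the tail second. -/

/-- Expressions of RelCostCore. -/
inductive CExpr where
  | var (x : ℕ)
  | num (n : ℤ)
  | unit
  | fix (f x : ℕ) (e : CExpr)
  | fixNC (f x : ℕ) (e : CExpr)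
  | app (e₁ e₂ : CExpr)
  | prim (ζ : ℕ) (e : CExpr)
  | pair (e₁ e₂ : CExpr)
  | fst (e : CExpr)
  | snd (e : CExpr)
  | inl (e : CExpr)
  | inr (e : CExpr)
  | case (e : CExpr) (x : ℕ) (e₁ : CExpr) (y : ℕ) (e₂ : CExpr)
  | nil
  | consNC (e₁ e₂ : CExpr)
  | consC (e₁ e₂ : CExpr)
  | caseL (e e₁ : CExpr) (h tl : ℕ) (e₂ : CExpr) (h₃ tl₃ : ℕ) (e₃ : CExpr)
  | iLam (e : CExpr)
  | iApp (e : CExpr) (I : Idx)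
  | pack (e : CExpr) (I : Idx)
  | unpack (e₁ : CExpr) (x : ℕ) (e₂ : CExpr)
  | letE (x : ℕ) (e₁ e₂ : CExpr)
  | clet (e₁ : CExpr) (x : ℕ) (e₂ : CExpr)
  | celim (e : CExpr)
  | der (e : CExpr)
  | switch (e : CExpr)
  | nc (e : CExpr)
  | split (e₁ e₂ : CExpr) (C : Constr)
  | contra (e : CExpr)

/-- Expressions of BiRelCost: those of RelCostCore with unary and relational annotations,
`annoU e A k t` for `(e : A, k, t)` and `annoR e τ t` for `(e : τ, t)`. -/
inductive Expr where
  | var (x : ℕ)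
  | num (n : ℤ)
  | unit
  | fix (f x : ℕ) (e : Expr)
  | fixNC (f x : ℕ) (e : Expr)
  | app (e₁ e₂ : Expr)
  | prim (ζ : ℕ) (e : Expr)
  | pair (e₁ e₂ : Expr)
  | fst (e : Expr)
  | snd (e : Expr)
  | inl (e : Expr)
  | inr (e : Expr)
  | case (e : Expr) (x : ℕ) (e₁ : Expr) (y : ℕ) (e₂ : Expr)
  | nil
  | consNC (e₁ e₂ : Expr)
  | consC (e₁ e₂ : Expr)
  | caseL (e e₁ : Expr) (h tl : ℕ) (e₂ : Expr) (h₃ tl₃ : ℕ) (e₃ : Expr)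
  | iLam (e : Expr)
  | iApp (e : Expr) (I : Idx)
  | pack (e : Expr) (I : Idx)
  | unpack (e₁ : Expr) (x : ℕ) (e₂ : Expr)
  | letE (x : ℕ) (e₁ e₂ : Expr)
  | clet (e₁ : Expr) (x : ℕ) (e₂ : Expr)
  | celim (e : Expr)
  | der (e : Expr)
  | switch (e : Expr)
  | nc (e : Expr)
  | split (e₁ e₂ : Expr) (C : Constr)
  | contra (e : Expr)
  | annoU (e : Expr) (A : UTy) (k t : Idx)
  | annoR (e : Expr) (τ : RTy) (t : Idx)

/-- Annotation erasure. -/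
def Expr.erase : Expr → CExpr
  | .var x => .var x
  | .num n => .num n
  | .unit => .unit
  | .fix f x e => .fix f x e.erase
  | .fixNC f x e => .fixNC f x e.erase
  | .app e₁ e₂ => .app e₁.erase e₂.erase
  | .prim ζ e => .prim ζ e.erase
  | .pair e₁ e₂ => .pair e₁.erase e₂.erase
  | .fst e => .fst e.erase
  | .snd e => .snd e.erase
  | .inl e => .inl e.erase
  | .inr e => .inr e.erase
  | .case e x e₁ y e₂ => .case e.erase x e₁.erase y e₂.erase
  | .nil => .nil
  | .consNC e₁ e₂ => .consNC e₁.erase e₂.erase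
  | .consC e₁ e₂ => .consC e₁.erase e₂.erase
  | .caseL e e₁ h tl e₂ h₃ tl₃ e₃ => .caseL e.erase e₁.erase h tl e₂.erase h₃ tl₃ e₃.erase
  | .iLam e => .iLam e.erase
  | .iApp e I => .iApp e.erase I
  | .pack e I => .pack e.erase I
  | .unpack e₁ x e₂ => .unpack e₁.erase x e₂.erase
  | .letE x e₁ e₂ => .letE x e₁.erase e₂.erase
  | .clet e₁ x e₂ => .clet e₁.erase x e₂.erase
  | .celim e => .celim e.erase
  | .der e => .der e.erase
  | .switch e => .switch e.erase
  | .nc e => .nc e.erase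
  | .split e₁ e₂ C => .split e₁.erase e₂.erase C
  | .contra e => .contra e.erase
  | .annoU e _ _ _ => e.erase
  | .annoR e _ _ => e.erase

/-- The primitive environment `Υ`: unary and relational arrow types of primitive operations. -/
structure PrimEnv where
  u : ℕ → Option (UTy × Idx × Idx × UTy)
  r : ℕ → Option (RTy × Idx × RTy)

/-- The types of primitive operations contain no free index variables. -/
def PrimEnv.Closed (Υ : PrimEnv) : Prop :=
  (∀ ζ A k t B, Υ.u ζ = some (A, k, t, B) → (UTy.arr A k t B).Scoped 0 []) ∧
  (∀ ζ τ t σ, Υ.r ζ = some (τ, t, σ) → (RTy.arr τ t σ).Scoped 0 [])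

instance : Add Idx := ⟨Idx.add⟩
instance : Sub Idx := ⟨Idx.sub⟩

/-! Declarative subtyping and type equivalence of RelCostCore. -/

/-- Unary subtyping, `Δ; Φ_a ⊨ A ⊑ A'`. -/
inductive SubU (c : CostModel) : UEnv → CEnv → UTy → UTy → Prop
  | arr {Δ Φa A B A' B' k t k' t'} :
      SubU c Δ Φa A' A → SubU c Δ Φa B B' →
      Entails c Δ [] Φa (.le k' k) → Entails c Δ [] Φa (.le t t') →
      SubU c Δ Φa (.arr A k t B) (.arr A' k' t' B')
  | all {Δ Φa S A A' k t k' t'} :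
      SubU c (S :: Δ) (Φa.subst .shift) A A' →
      Entails c (S :: Δ) [] (Φa.subst .shift) (.le k' k) →
      Entails c (S :: Δ) [] (Φa.subst .shift) (.le t t') →
      SubU c Δ Φa (.all S k t A) (.all S k' t' A')
  | prod {Δ Φa A B A' B'} :
      SubU c Δ Φa A A' → SubU c Δ Φa B B' → SubU c Δ Φa (.prod A B) (.prod A' B')
  | sum {Δ Φa A B A' B'} :
      SubU c Δ Φa A A' → SubU c Δ Φa B B' → SubU c Δ Φa (.sum A B) (.sum A' B')
  | list {Δ Φa n n' A A'} :
      Entails c Δ [] Φa (.eq n n') → SubU c Δ Φa A A' →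
      SubU c Δ Φa (.list n A) (.list n' A')
  | ex {Δ Φa S A A'} :
      SubU c (S :: Δ) (Φa.subst .shift) A A' → SubU c Δ Φa (.ex S A) (.ex S A')
  | cimp {Δ Φa C C' A A'} :
      Entails c Δ [] (C' :: Φa) C → SubU c Δ Φa A A' →
      SubU c Δ Φa (.cimp C A) (.cimp C' A')
  | cand {Δ Φa C C' A A'} :
      Entails c Δ [] (C :: Φa) C' → SubU c Δ Φa A A' →
      SubU c Δ Φa (.cand C A) (.cand C' A')
  | refl {Δ Φa A} : SubU c Δ Φa A A
  | trans {Δ Φa A B C} : SubU c Δ Φa A B → SubU c Δ Φa B C → SubU c Δ Φa A C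

/-- Relational type equivalence, `Δ; Φ_a ⊨ τ ≡ τ'`. -/
inductive EqR (c : CostModel) : UEnv → CEnv → RTy → RTy → Prop
  | unit {Δ Φa} : EqR c Δ Φa .unit .unit
  | int {Δ Φa} : EqR c Δ Φa .int .int
  | arr {Δ Φa τ σ τ' σ' t t'} :
      EqR c Δ Φa τ τ' → EqR c Δ Φa σ σ' → Entails c Δ [] Φa (.eq t t') →
      EqR c Δ Φa (.arr τ t σ) (.arr τ' t' σ')
  | prod {Δ Φa τ σ τ' σ'} :
      EqR c Δ Φa τ τ' → EqR c Δ Φa σ σ' → EqR c Δ Φa (.prod τ σ) (.prod τ' σ')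
  | sum {Δ Φa τ σ τ' σ'} :
      EqR c Δ Φa τ τ' → EqR c Δ Φa σ σ' → EqR c Δ Φa (.sum τ σ) (.sum τ' σ')
  | list {Δ Φa n n' α α' τ τ'} :
      EqR c Δ Φa τ τ' → Entails c Δ [] Φa (.eq n n') → Entails c Δ [] Φa (.eq α α') →
      EqR c Δ Φa (.list n α τ) (.list n' α' τ')
  | all {Δ Φa S t t' τ τ'} :
      EqR c (S :: Δ) (Φa.subst .shift) τ τ' →
      Entails c (S :: Δ) [] (Φa.subst .shift) (.eq t t') →
      EqR c Δ Φa (.all S t τ) (.all S t' τ')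
  | ex {Δ Φa S τ τ'} :
      EqR c (S :: Δ) (Φa.subst .shift) τ τ' → EqR c Δ Φa (.ex S τ) (.ex S τ')
  | box {Δ Φa τ τ'} : EqR c Δ Φa τ τ' → EqR c Δ Φa (.box τ) (.box τ')
  | U {Δ Φa A B A' B'} :
      SubU c Δ Φa A A' → SubU c Δ Φa A' A → SubU c Δ Φa B B' → SubU c Δ Φa B' B →
      EqR c Δ Φa (.U A B) (.U A' B')
  | cimp {Δ Φa C C' τ τ'} :
      Entails c Δ [] (C :: Φa) C' → Entails c Δ [] (C' :: Φa) C → EqR c Δ Φa τ τ' →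
      EqR c Δ Φa (.cimp C τ) (.cimp C' τ')
  | cand {Δ Φa C C' τ τ'} :
      Entails c Δ [] (C :: Φa) C' → Entails c Δ [] (C' :: Φa) C → EqR c Δ Φa τ τ' →
      EqR c Δ Φa (.cand C τ) (.cand C' τ')

/-! Declarative typing of RelCostCore. -/

/-- The length equation `n = i + 1`, where `n` lives outside the scope of the innermost `i`. -/
def consEq (n : Idx) : Constr := .eq (n.subst .shift) (.succ (.var 0))

/-- Unary typing, `Δ; Φ_a; Ω ⊢_k^t e : A`. -/
inductive CoreU (c : CostModel) (Υ : PrimEnv) :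
    UEnv → CEnv → UCtx → Idx → Idx → CExpr → UTy → Prop
  | num {Δ Φa} {Ω : UCtx} {n} : CoreU c Υ Δ Φa Ω .zero .zero (.num n) .int
  | unit {Δ Φa} {Ω : UCtx} : CoreU c Υ Δ Φa Ω .zero .zero .unit .unit
  | var {Δ Φa} {Ω : UCtx} {x A} : Ω.lookup x = some A → CoreU c Υ Δ Φa Ω .zero .zero (.var x) A
  | inl {Δ Φa} {Ω : UCtx} {k t e A B} :
      CoreU c Υ Δ Φa Ω k t e A → B.Wf Δ [] → CoreU c Υ Δ Φa Ω k t (.inl e) (.sum A B)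
  | inr {Δ Φa} {Ω : UCtx} {k t e A B} :
      CoreU c Υ Δ Φa Ω k t e B → A.Wf Δ [] → CoreU c Υ Δ Φa Ω k t (.inr e) (.sum A B)
  | case {Δ Φa} {Ω : UCtx} {k t k' t' e x e₁ y e₂ A B D} :
      CoreU c Υ Δ Φa Ω k t e (.sum A B) →
      CoreU c Υ Δ Φa ((x, A) :: Ω) k' t' e₁ D →
      CoreU c Υ Δ Φa ((y, B) :: Ω) k' t' e₂ D →
      CoreU c Υ Δ Φa Ω (k + k' + .cst .case) (t + t' + .cst .case) (.case e x e₁ y e₂) D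
  | fix {Δ Φa} {Ω : UCtx} {k t f x e A B} :
      CoreU c Υ Δ Φa ((x, A) :: (f, .arr A k t B) :: Ω) k t e B →
      CoreU c Υ Δ Φa Ω .zero .zero (.fix f x e) (.arr A k t B)
  | app {Δ Φa} {Ω : UCtx} {k₁ t₁ k₂ t₂ k t e₁ e₂ A B} :
      CoreU c Υ Δ Φa Ω k₁ t₁ e₁ (.arr A k t B) →
      CoreU c Υ Δ Φa Ω k₂ t₂ e₂ A →
      CoreU c Υ Δ Φa Ω (k₁ + k₂ + k + .cst .app) (t₁ + t₂ + t + .cst .app) (.app e₁ e₂) B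
  | prim {Δ Φa} {Ω : UCtx} {ζ k t k' t' e A B} :
      Υ.u ζ = some (A, k, t, B) →
      CoreU c Υ Δ Φa Ω k' t' e A →
      CoreU c Υ Δ Φa Ω (k + k' + .cst .app) (t + t' + .cst .app) (.prim ζ e) B
  | pair {Δ Φa} {Ω : UCtx} {k₁ t₁ k₂ t₂ e₁ e₂ A B} :
      CoreU c Υ Δ Φa Ω k₁ t₁ e₁ A → CoreU c Υ Δ Φa Ω k₂ t₂ e₂ B →
      CoreU c Υ Δ Φa Ω (k₁ + k₂) (t₁ + t₂) (.pair e₁ e₂) (.prod A B)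
  | fst {Δ Φa} {Ω : UCtx} {k t e A B} :
      CoreU c Υ Δ Φa Ω k t e (.prod A B) →
      CoreU c Υ Δ Φa Ω (k + .cst .proj) (t + .cst .proj) (.fst e) A
  | snd {Δ Φa} {Ω : UCtx} {k t e A B} :
      CoreU c Υ Δ Φa Ω k t e (.prod A B) →
      CoreU c Υ Δ Φa Ω (k + .cst .proj) (t + .cst .proj) (.snd e) B
  | nil {Δ Φa} {Ω : UCtx} {A} :
      A.Wf Δ [] → CoreU c Υ Δ Φa Ω .zero .zero .nil (.list .zero A)
  | cons {Δ Φa} {Ω : UCtx} {k₁ t₁ k₂ t₂ e₁ e₂ n A} :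
      CoreU c Υ Δ Φa Ω k₁ t₁ e₁ A → CoreU c Υ Δ Φa Ω k₂ t₂ e₂ (.list n A) →
      CoreU c Υ Δ Φa Ω (k₁ + k₂) (t₁ + t₂) (.consC e₁ e₂) (.list (.succ n) A)
  | caseL {Δ Φa} {Ω : UCtx} {k t k' t' e e₁ h tl e₂ h₃ tl₃ e₃ n A B} :
      CoreU c Υ Δ Φa Ω k t e (.list n A) →
      CoreU c Υ Δ (.eq n .zero :: Φa) Ω k' t' e₁ B →
      CoreU c Υ (.nat :: Δ) (consEq n :: Φa.subst .shift)
        ((h, A.subst .shift) :: (tl, .list (.var 0) (A.subst .shift)) :: Ω.subst .shift)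
        (k'.subst .shift) (t'.subst .shift) e₂ (B.subst .shift) →
      CoreU c Υ Δ Φa Ω (k + k' + .cst .caseL) (t + t' + .cst .caseL)
        (.caseL e e₁ h tl e₂ h₃ tl₃ e₃) B
  | iLam {Δ Φa} {Ω : UCtx} {S k t e A} :
      CoreU c Υ (S :: Δ) (Φa.subst .shift) (Ω.subst .shift) k t e A →
      CoreU c Υ Δ Φa Ω .zero .zero (.iLam e) (.all S k t A)
  | iApp {Δ Φa} {Ω : UCtx} {S k t k' t' e A I} :
      CoreU c Υ Δ Φa Ω k t e (.all S k' t' A) → HasSort Δ [] I S →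
      CoreU c Υ Δ Φa Ω (k + k'.subst (.inst I)) (t + t'.subst (.inst I)) (.iApp e I)
        (A.subst (.inst I))
  | pack {Δ Φa} {Ω : UCtx} {S k t e A I} :
      CoreU c Υ Δ Φa Ω k t e (A.subst (.inst I)) → HasSort Δ [] I S →
      CoreU c Υ Δ Φa Ω k t (.pack e I) (.ex S A)
  | unpack {Δ Φa} {Ω : UCtx} {S k₁ t₁ k₂ t₂ e₁ x e₂ A B} :
      CoreU c Υ Δ Φa Ω k₁ t₁ e₁ (.ex S A) →
      CoreU c Υ (S :: Δ) (Φa.subst .shift) ((x, A) :: Ω.subst .shift)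
        (k₂.subst .shift) (t₂.subst .shift) e₂ (B.subst .shift) →
      CoreU c Υ Δ Φa Ω (k₁ + k₂ + .cst .unpack) (t₁ + t₂ + .cst .unpack) (.unpack e₁ x e₂) B
  | letE {Δ Φa} {Ω : UCtx} {k₁ t₁ k₂ t₂ x e₁ e₂ A B} :
      CoreU c Υ Δ Φa Ω k₁ t₁ e₁ A → CoreU c Υ Δ Φa ((x, A) :: Ω) k₂ t₂ e₂ B →
      CoreU c Υ Δ Φa Ω (k₁ + k₂ + .cst .letC) (t₁ + t₂ + .cst .letC) (.letE x e₁ e₂) B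
  | candI {Δ Φa} {Ω : UCtx} {k t e C A} :
      Entails c Δ [] Φa C → CoreU c Υ Δ (C :: Φa) Ω k t e A →
      CoreU c Υ Δ Φa Ω k t e (.cand C A)
  | candE {Δ Φa} {Ω : UCtx} {k₁ t₁ k₂ t₂ e₁ x e₂ C A B} :
      CoreU c Υ Δ Φa Ω k₁ t₁ e₁ (.cand C A) →
      CoreU c Υ Δ (C :: Φa) ((x, A) :: Ω) k₂ t₂ e₂ B →
      CoreU c Υ Δ Φa Ω (k₁ + k₂) (t₁ + t₂) (.clet e₁ x e₂) B
  | cimpI {Δ Φa} {Ω : UCtx} {k t e C A} :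
      CoreU c Υ Δ (C :: Φa) Ω k t e A → CoreU c Υ Δ Φa Ω k t e (.cimp C A)
  | cimpE {Δ Φa} {Ω : UCtx} {k t e C A} :
      CoreU c Υ Δ Φa Ω k t e (.cimp C A) → Entails c Δ [] Φa C →
      CoreU c Υ Δ Φa Ω k t (.celim e) A
  | split {Δ Φa} {Ω : UCtx} {k t e₁ e₂ C A} :
      CoreU c Υ Δ (C :: Φa) Ω k t e₁ A → CoreU c Υ Δ (.neg C :: Φa) Ω k t e₂ A →
      CoreU c Υ Δ Φa Ω k t (.split e₁ e₂ C) A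
  | contra {Δ Φa} {Ω : UCtx} {k t e A} :
      Entails c Δ [] Φa .bot → Ω.Wf Δ [] → CoreU c Υ Δ Φa Ω k t (.contra e) A
  | sub {Δ Φa} {Ω : UCtx} {k t k' t' e A A'} :
      CoreU c Υ Δ Φa Ω k t e A → SubU c Δ Φa A A' →
      Entails c Δ [] Φa (.le k' k) → Entails c Δ [] Φa (.le t t') →
      CoreU c Υ Δ Φa Ω k' t' e A'

/-- Relational typing, `Δ; Φ_a; Γ ⊢ e ⊖ e' ≲ t : τ`. -/
inductive CoreR (c : CostModel) (Υ : PrimEnv) :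
    UEnv → CEnv → RCtx → CExpr → CExpr → Idx → RTy → Prop
  | switch {Δ Φa} {Γ : RCtx} {k₁ t₁ k₂ t₂ e e' A B} :
      CoreU c Υ Δ Φa (Γ.proj true) k₁ t₁ e A →
      CoreU c Υ Δ Φa (Γ.proj false) k₂ t₂ e' B →
      CoreR c Υ Δ Φa Γ (.switch e) (.switch e') (t₁ - k₂) (.U A B)
  | nc {Δ Φa} {Γ D : RCtx} {t e τ} :
      CoreR c Υ Δ Φa Γ.box e e t τ → D.Extends Γ.box →
      CoreR c Υ Δ Φa D (.nc e) (.nc e) .zero (.box τ)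
  | der {Δ Φa} {Γ : RCtx} {t e e' τ} :
      CoreR c Υ Δ Φa Γ e e' t (.box τ) → CoreR c Υ Δ Φa Γ (.der e) (.der e') t τ
  | num {Δ Φa} {Γ : RCtx} {n} : CoreR c Υ Δ Φa Γ (.num n) (.num n) .zero .int
  | unit {Δ Φa} {Γ : RCtx} : CoreR c Υ Δ Φa Γ .unit .unit .zero .unit
  | var {Δ Φa} {Γ : RCtx} {x τ} :
      Γ.lookup x = some τ → CoreR c Υ Δ Φa Γ (.var x) (.var x) .zero τ
  | inl {Δ Φa} {Γ : RCtx} {t e e' τ σ} :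
      CoreR c Υ Δ Φa Γ e e' t τ → σ.Wf Δ [] →
      CoreR c Υ Δ Φa Γ (.inl e) (.inl e') t (.sum τ σ)
  | inr {Δ Φa} {Γ : RCtx} {t e e' τ σ} :
      CoreR c Υ Δ Φa Γ e e' t σ → τ.Wf Δ [] →
      CoreR c Υ Δ Φa Γ (.inr e) (.inr e') t (.sum τ σ)
  | case {Δ Φa} {Γ : RCtx} {t t' e e' x e₁ e₁' y e₂ e₂' τ₁ τ₂ τ} :
      CoreR c Υ Δ Φa Γ e e' t (.sum τ₁ τ₂) →
      CoreR c Υ Δ Φa ((x, τ₁) :: Γ) e₁ e₁' t' τ →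
      CoreR c Υ Δ Φa ((y, τ₂) :: Γ) e₂ e₂' t' τ →
      CoreR c Υ Δ Φa Γ (.case e x e₁ y e₂) (.case e' x e₁' y e₂') (t + t') τ
  | fix {Δ Φa} {Γ : RCtx} {t f x e e' τ σ} :
      CoreR c Υ Δ Φa ((x, τ) :: (f, .arr τ t σ) :: Γ) e e' t σ →
      CoreR c Υ Δ Φa Γ (.fix f x e) (.fix f x e') .zero (.arr τ t σ)
  | fixNC {Δ Φa} {Γ D : RCtx} {t f x e τ σ} :
      CoreR c Υ Δ Φa ((x, τ) :: (f, .box (.arr τ t σ)) :: Γ.box) e e t σ →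
      D.Extends Γ.box →
      CoreR c Υ Δ Φa D (.fixNC f x e) (.fixNC f x e) .zero (.box (.arr τ t σ))
  | app {Δ Φa} {Γ : RCtx} {t₁ t₂ t e₁ e₁' e₂ e₂' τ σ} :
      CoreR c Υ Δ Φa Γ e₁ e₁' t₁ (.arr τ t σ) → CoreR c Υ Δ Φa Γ e₂ e₂' t₂ τ →
      CoreR c Υ Δ Φa Γ (.app e₁ e₂) (.app e₁' e₂') (t₁ + t₂ + t) σ
  | prim {Δ Φa} {Γ : RCtx} {ζ t t' e e' τ σ} :
      Υ.r ζ = some (τ, t, σ) → CoreR c Υ Δ Φa Γ e e' t' τ →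
      CoreR c Υ Δ Φa Γ (.prim ζ e) (.prim ζ e') (t + t') σ
  | pair {Δ Φa} {Γ : RCtx} {t₁ t₂ e₁ e₁' e₂ e₂' τ σ} :
      CoreR c Υ Δ Φa Γ e₁ e₁' t₁ τ → CoreR c Υ Δ Φa Γ e₂ e₂' t₂ σ →
      CoreR c Υ Δ Φa Γ (.pair e₁ e₂) (.pair e₁' e₂') (t₁ + t₂) (.prod τ σ)
  | fst {Δ Φa} {Γ : RCtx} {t e e' τ σ} :
      CoreR c Υ Δ Φa Γ e e' t (.prod τ σ) → CoreR c Υ Δ Φa Γ (.fst e) (.fst e') t τ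
  | snd {Δ Φa} {Γ : RCtx} {t e e' τ σ} :
      CoreR c Υ Δ Φa Γ e e' t (.prod τ σ) → CoreR c Υ Δ Φa Γ (.snd e) (.snd e') t σ
  | nil {Δ Φa} {Γ : RCtx} {α τ} :
      τ.Wf Δ [] → CoreR c Υ Δ Φa Γ .nil .nil .zero (.list .zero α τ)
  | consC {Δ Φa} {Γ : RCtx} {t₁ t₂ e₁ e₁' e₂ e₂' n α τ} :
      CoreR c Υ Δ Φa Γ e₁ e₁' t₁ τ → CoreR c Υ Δ Φa Γ e₂ e₂' t₂ (.list n α τ) →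
      CoreR c Υ Δ Φa Γ (.consC e₁ e₂) (.consC e₁' e₂') (t₁ + t₂)
        (.list (.succ n) (.succ α) τ)
  | consNC {Δ Φa} {Γ : RCtx} {t₁ t₂ e₁ e₁' e₂ e₂' n α τ} :
      CoreR c Υ Δ Φa Γ e₁ e₁' t₁ (.box τ) → CoreR c Υ Δ Φa Γ e₂ e₂' t₂ (.list n α τ) →
      CoreR c Υ Δ Φa Γ (.consNC e₁ e₂) (.consNC e₁' e₂') (t₁ + t₂) (.list (.succ n) α τ)
  | caseL {Δ Φa} {Γ : RCtx} {t t' e e' e₁ e₁' h tl e₂ e₂' h₃ tl₃ e₃ e₃' n α τ σ} :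
      CoreR c Υ Δ Φa Γ e e' t (.list n α τ) →
      CoreR c Υ Δ (.eq n .zero :: Φa) Γ e₁ e₁' t' σ →
      CoreR c Υ (.nat :: Δ) (consEq n :: Φa.subst .shift)
        ((h, .box (τ.subst .shift)) ::
          (tl, .list (.var 0) (α.subst .shift) (τ.subst .shift)) :: Γ.subst .shift)
        e₂ e₂' (t'.subst .shift) (σ.subst .shift) →
      CoreR c Υ (.nat :: .nat :: Δ)
        (consEq (α.subst .shift) :: CEnv.subst (consEq n :: Φa.subst .shift) .shift)
        ((h₃, (τ.subst .shift).subst .shift) ::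
          (tl₃, .list (.var 1) (.var 0) ((τ.subst .shift).subst .shift)) ::
          (Γ.subst .shift).subst .shift)
        e₃ e₃' ((t'.subst .shift).subst .shift) ((σ.subst .shift).subst .shift) →
      CoreR c Υ Δ Φa Γ (.caseL e e₁ h tl e₂ h₃ tl₃ e₃) (.caseL e' e₁' h tl e₂' h₃ tl₃ e₃')
        (t + t') σ
  | iLam {Δ Φa} {Γ : RCtx} {S t e e' τ} :
      CoreR c Υ (S :: Δ) (Φa.subst .shift) (Γ.subst .shift) e e' t τ →
      CoreR c Υ Δ Φa Γ (.iLam e) (.iLam e') .zero (.all S t τ)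
  | iApp {Δ Φa} {Γ : RCtx} {S t t' e e' τ I} :
      CoreR c Υ Δ Φa Γ e e' t (.all S t' τ) → HasSort Δ [] I S →
      CoreR c Υ Δ Φa Γ (.iApp e I) (.iApp e' I) (t + t'.subst (.inst I)) (τ.subst (.inst I))
  | pack {Δ Φa} {Γ : RCtx} {S t e e' τ I} :
      CoreR c Υ Δ Φa Γ e e' t (τ.subst (.inst I)) → HasSort Δ [] I S →
      CoreR c Υ Δ Φa Γ (.pack e I) (.pack e' I) t (.ex S τ)
  | unpack {Δ Φa} {Γ : RCtx} {S t₁ t₂ e₁ e₁' x e₂ e₂' τ σ} :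
      CoreR c Υ Δ Φa Γ e₁ e₁' t₁ (.ex S τ) →
      CoreR c Υ (S :: Δ) (Φa.subst .shift) ((x, τ) :: Γ.subst .shift) e₂ e₂'
        (t₂.subst .shift) (σ.subst .shift) →
      CoreR c Υ Δ Φa Γ (.unpack e₁ x e₂) (.unpack e₁' x e₂') (t₁ + t₂) σ
  | letE {Δ Φa} {Γ : RCtx} {t₁ t₂ x e₁ e₁' e₂ e₂' τ σ} :
      CoreR c Υ Δ Φa Γ e₁ e₁' t₁ τ → CoreR c Υ Δ Φa ((x, τ) :: Γ) e₂ e₂' t₂ σ →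
      CoreR c Υ Δ Φa Γ (.letE x e₁ e₂) (.letE x e₁' e₂') (t₁ + t₂) σ
  | candI {Δ Φa} {Γ : RCtx} {t e e' C τ} :
      Entails c Δ [] Φa C → CoreR c Υ Δ (C :: Φa) Γ e e' t τ →
      CoreR c Υ Δ Φa Γ e e' t (.cand C τ)
  | candE {Δ Φa} {Γ : RCtx} {t₁ t₂ e₁ e₁' x e₂ e₂' C τ σ} :
      CoreR c Υ Δ Φa Γ e₁ e₁' t₁ (.cand C τ) →
      CoreR c Υ Δ (C :: Φa) ((x, τ) :: Γ) e₂ e₂' t₂ σ →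
      CoreR c Υ Δ Φa Γ (.clet e₁ x e₂) (.clet e₁' x e₂') (t₁ + t₂) σ
  | cimpI {Δ Φa} {Γ : RCtx} {t e e' C τ} :
      CoreR c Υ Δ (C :: Φa) Γ e e' t τ → CoreR c Υ Δ Φa Γ e e' t (.cimp C τ)
  | cimpE {Δ Φa} {Γ : RCtx} {t e e' C τ} :
      CoreR c Υ Δ Φa Γ e e' t (.cimp C τ) → Entails c Δ [] Φa C →
      CoreR c Υ Δ Φa Γ (.celim e) (.celim e') t τ
  | split {Δ Φa} {Γ : RCtx} {t e₁ e₁' e₂ e₂' C τ} :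
      CoreR c Υ Δ (C :: Φa) Γ e₁ e₁' t τ → CoreR c Υ Δ (.neg C :: Φa) Γ e₂ e₂' t τ →
      CoreR c Υ Δ Φa Γ (.split e₁ e₂ C) (.split e₁' e₂' C) t τ
  | contra {Δ Φa} {Γ : RCtx} {t e e' τ} :
      Entails c Δ [] Φa .bot → Γ.Wf Δ [] →
      CoreR c Υ Δ Φa Γ (.contra e) (.contra e') t τ
  | sub {Δ Φa} {Γ : RCtx} {t t' e e' τ τ'} :
      CoreR c Υ Δ Φa Γ e e' t τ → EqR c Δ Φa τ τ' → Entails c Δ [] Φa (.le t t') →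
      CoreR c Υ Δ Φa Γ e e' t' τ'
  | let_e {Δ Φa} {Γ : RCtx} {k₁ t₁ t₂ x e₁ e₂ e A τ} :
      CoreU c Υ Δ Φa (Γ.proj true) k₁ t₁ e₁ A →
      CoreR c Υ Δ Φa ((x, .U A A) :: Γ) e₂ e t₂ τ →
      CoreR c Υ Δ Φa Γ (.letE x e₁ e₂) e (t₁ + t₂ + .cst .letC) τ
  | e_let {Δ Φa} {Γ : RCtx} {k₁ t₁ t₂ x e₁ e₂ e A τ} :
      CoreU c Υ Δ Φa (Γ.proj false) k₁ t₁ e₁ A →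
      CoreR c Υ Δ Φa ((x, .U A A) :: Γ) e e₂ t₂ τ →
      CoreR c Υ Δ Φa Γ e (.letE x e₁ e₂) (t₂ - k₁ - .cst .letC) τ
  | app_e {Δ Φa} {Γ : RCtx} {k₁ t₁ k t t₂ e₁ e₂ e₂' A₁ A₂ A₂'} :
      CoreU c Υ Δ Φa (Γ.proj true) k₁ t₁ e₁ (.arr A₁ k t A₂) →
      CoreR c Υ Δ Φa Γ e₂ e₂' t₂ (.U A₁ A₂') →
      CoreR c Υ Δ Φa Γ (.app e₁ e₂) e₂' (t₁ + t₂ + t + .cst .app) (.U A₂ A₂')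
  | e_app {Δ Φa} {Γ : RCtx} {k₁ t₁ k t t₂ e₁' e₂ e₂' A₂ A₁' A₂'} :
      CoreU c Υ Δ Φa (Γ.proj false) k₁ t₁ e₁' (.arr A₁' k t A₂') →
      CoreR c Υ Δ Φa Γ e₂ e₂' t₂ (.U A₂ A₁') →
      CoreR c Υ Δ Φa Γ e₂ (.app e₁' e₂') (t₂ - k₁ - k - .cst .app) (.U A₂ A₂')
  | case_e {Δ Φa} {Γ : RCtx} {k t t' e x e₁ y e₂ e' A₁ A₂ τ} :
      CoreU c Υ Δ Φa (Γ.proj true) k t e (.sum A₁ A₂) →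
      CoreR c Υ Δ Φa ((x, .U A₁ A₁) :: Γ) e₁ e' t' τ →
      CoreR c Υ Δ Φa ((y, .U A₂ A₂) :: Γ) e₂ e' t' τ →
      CoreR c Υ Δ Φa Γ (.case e x e₁ y e₂) e' (t' + t + .cst .case) τ
  | e_case {Δ Φa} {Γ : RCtx} {k' t' t e e' x e₁' y e₂' A₁ A₂ τ} :
      CoreU c Υ Δ Φa (Γ.proj false) k' t' e' (.sum A₁ A₂) →
      CoreR c Υ Δ Φa ((x, .U A₁ A₁) :: Γ) e e₁' t τ →
      CoreR c Υ Δ Φa ((y, .U A₂ A₂) :: Γ) e e₂' t τ →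
      CoreR c Υ Δ Φa Γ e (.case e' x e₁' y e₂') (t - k' - .cst .case) τ

/-! Algorithmic subtyping and type equivalence. -/

/-- Algorithmic unary subtyping, `Δ; ψ_a; Φ_a ⊨ A ⊑ A' ⇒ Φ`. -/
inductive AlgSubU : UEnv → EEnv → CEnv → UTy → UTy → CForm → Prop
  | int {Δ ψ Φa} : AlgSubU Δ ψ Φa .int .int .top
  | unit {Δ ψ Φa} : AlgSubU Δ ψ Φa .unit .unit .top
  | arr {Δ ψ Φa A B A' B' k t k' t' Φ₁ Φ₂} :
      AlgSubU Δ ψ Φa A' A Φ₁ → AlgSubU Δ ψ Φa B B' Φ₂ →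
      AlgSubU Δ ψ Φa (.arr A k t B) (.arr A' k' t' B')
        (.and Φ₁ (.and Φ₂ (.and (.le k' k) (.le t t'))))
  | all {Δ ψ Φa S A A' k t k' t' Φ} :
      AlgSubU (S :: Δ) ψ (Φa.subst .shift) A A' Φ →
      AlgSubU Δ ψ Φa (.all S k t A) (.all S k' t' A')
        (.all S (.and Φ (.and (.le k' k) (.le t t'))))
  | prod {Δ ψ Φa A B A' B' Φ₁ Φ₂} :
      AlgSubU Δ ψ Φa A A' Φ₁ → AlgSubU Δ ψ Φa B B' Φ₂ →
      AlgSubU Δ ψ Φa (.prod A B) (.prod A' B') (.and Φ₁ Φ₂)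
  | sum {Δ ψ Φa A B A' B' Φ₁ Φ₂} :
      AlgSubU Δ ψ Φa A A' Φ₁ → AlgSubU Δ ψ Φa B B' Φ₂ →
      AlgSubU Δ ψ Φa (.sum A B) (.sum A' B') (.and Φ₁ Φ₂)
  | list {Δ ψ Φa n n' A A' Φ} :
      AlgSubU Δ ψ Φa A A' Φ →
      AlgSubU Δ ψ Φa (.list n A) (.list n' A') (.and (.eq n n') Φ)
  | ex {Δ ψ Φa S A A' Φ} :
      AlgSubU (S :: Δ) ψ (Φa.subst .shift) A A' Φ →
      AlgSubU Δ ψ Φa (.ex S A) (.ex S A') (.all S Φ)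
  | cimp {Δ ψ Φa C C' A A' Φ} :
      AlgSubU Δ ψ Φa A A' Φ →
      AlgSubU Δ ψ Φa (.cimp C A) (.cimp C' A') (.and (.imp C' (.atom C)) Φ)
  | cand {Δ ψ Φa C C' A A' Φ} :
      AlgSubU Δ ψ Φa A A' Φ →
      AlgSubU Δ ψ Φa (.cand C A) (.cand C' A') (.and (.imp C (.atom C')) Φ)
  | refl {Δ ψ Φa A} : AlgSubU Δ ψ Φa A A .top

/-- Algorithmic relational type equivalence, `Δ; ψ_a; Φ_a ⊨ τ ≡ τ' ⇒ Φ`. -/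
inductive AlgEqR : UEnv → EEnv → CEnv → RTy → RTy → CForm → Prop
  | int {Δ ψ Φa} : AlgEqR Δ ψ Φa .int .int .top
  | unit {Δ ψ Φa} : AlgEqR Δ ψ Φa .unit .unit .top
  | arr {Δ ψ Φa τ σ τ' σ' t t' Φ₁ Φ₂} :
      AlgEqR Δ ψ Φa τ τ' Φ₁ → AlgEqR Δ ψ Φa σ σ' Φ₂ →
      AlgEqR Δ ψ Φa (.arr τ t σ) (.arr τ' t' σ') (.and Φ₁ (.and Φ₂ (.eq t t')))
  | prod {Δ ψ Φa τ σ τ' σ' Φ₁ Φ₂} :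
      AlgEqR Δ ψ Φa τ τ' Φ₁ → AlgEqR Δ ψ Φa σ σ' Φ₂ →
      AlgEqR Δ ψ Φa (.prod τ σ) (.prod τ' σ') (.and Φ₁ Φ₂)
  | sum {Δ ψ Φa τ σ τ' σ' Φ₁ Φ₂} :
      AlgEqR Δ ψ Φa τ τ' Φ₁ → AlgEqR Δ ψ Φa σ σ' Φ₂ →
      AlgEqR Δ ψ Φa (.sum τ σ) (.sum τ' σ') (.and Φ₁ Φ₂)
  | list {Δ ψ Φa n n' α α' τ τ' Φ} :
      AlgEqR Δ ψ Φa τ τ' Φ →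
      AlgEqR Δ ψ Φa (.list n α τ) (.list n' α' τ') (.and Φ (.and (.eq n n') (.eq α α')))
  | all {Δ ψ Φa S t t' τ τ' Φ} :
      AlgEqR (S :: Δ) ψ (Φa.subst .shift) τ τ' Φ →
      AlgEqR Δ ψ Φa (.all S t τ) (.all S t' τ') (.all S (.and Φ (.eq t t')))
  | ex {Δ ψ Φa S τ τ' Φ} :
      AlgEqR (S :: Δ) ψ (Φa.subst .shift) τ τ' Φ →
      AlgEqR Δ ψ Φa (.ex S τ) (.ex S τ') (.all S Φ)
  | box {Δ ψ Φa τ τ' Φ} :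
      AlgEqR Δ ψ Φa τ τ' Φ → AlgEqR Δ ψ Φa (.box τ) (.box τ') Φ
  | U {Δ ψ Φa A B A' B' Φ₁ Φ₁' Φ₂ Φ₂'} :
      AlgSubU Δ ψ Φa A A' Φ₁ → AlgSubU Δ ψ Φa A' A Φ₁' →
      AlgSubU Δ ψ Φa B B' Φ₂ → AlgSubU Δ ψ Φa B' B Φ₂' →
      AlgEqR Δ ψ Φa (.U A B) (.U A' B') (.and (.and Φ₁ Φ₁') (.and Φ₂ Φ₂'))
  | cimp {Δ ψ Φa C C' τ τ' Φ} :
      AlgEqR Δ ψ Φa τ τ' Φ →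
      AlgEqR Δ ψ Φa (.cimp C τ) (.cimp C' τ') (.and (.iff C C') Φ)
  | cand {Δ ψ Φa C C' τ τ' Φ} :
      AlgEqR Δ ψ Φa τ τ' Φ →
      AlgEqR Δ ψ Φa (.cand C τ) (.cand C' τ') (.and (.iff C C') Φ)

/-! Algorithmic (bidirectional) typing of BiRelCost. -/

mutual

/-- Unary checking, `Δ; ψ_a; Φ_a; Ω ⊢ e ↓ A, k, t ⇒ Φ`. -/
inductive ChkU (c : CostModel) (Υ : PrimEnv) :
    UEnv → EEnv → CEnv → UCtx → Expr → UTy → Idx → Idx → CForm → Prop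
  | pair {Δ ψa Φa} {Ω : UCtx} {e₁ e₂ A B k t k₁ t₁ k₂ t₂ Φ₁ Φ₂} :
      Fresh [k₁, t₁, k₂, t₂] ψa →
      ChkU c Υ Δ (reals [k₁, t₁] ++ ψa) Φa Ω e₁ A (.evar k₁) (.evar t₁) Φ₁ →
      ChkU c Υ Δ (reals [k₂, t₂] ++ ψa) Φa Ω e₂ B (.evar k₂) (.evar t₂) Φ₂ →
      ChkU c Υ Δ ψa Φa Ω (.pair e₁ e₂) (.prod A B) k t
        (.exs (reals [k₁, t₁]) (.and Φ₁ (.exs (reals [k₂, t₂]) (.and Φ₂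
          (.and (.eq (.evar t₁ + .evar t₂) t) (.eq k (.evar k₁ + .evar k₂)))))))
  | inl {Δ ψa Φa} {Ω : UCtx} {e A B k t Φ} :
      ChkU c Υ Δ ψa Φa Ω e A k t Φ → B.Wf Δ ψa →
      ChkU c Υ Δ ψa Φa Ω (.inl e) (.sum A B) k t Φ
  | inr {Δ ψa Φa} {Ω : UCtx} {e A B k t Φ} :
      ChkU c Υ Δ ψa Φa Ω e B k t Φ → A.Wf Δ ψa →
      ChkU c Υ Δ ψa Φa Ω (.inr e) (.sum A B) k t Φ
  | case {Δ ψa Φa} {Ω : UCtx} {e x e₁ y e₂ A B D k t ψ ke te k' t' Φ₁ Φ₂ Φ₃} :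
      InfU c Υ Δ ψa Φa Ω e (.sum A B) ψ ke te Φ₁ →
      Fresh [k', t'] (ψ ++ ψa) →
      ChkU c Υ Δ (reals [k', t'] ++ ψ ++ ψa) Φa ((x, A) :: Ω) e₁ D (.evar k') (.evar t') Φ₂ →
      ChkU c Υ Δ (reals [k', t'] ++ ψ ++ ψa) Φa ((y, B) :: Ω) e₂ D (.evar k') (.evar t') Φ₃ →
      ChkU c Υ Δ ψa Φa Ω (.case e x e₁ y e₂) D k t
        (.exs ψ (.and Φ₁ (.exs (reals [k', t']) (.and Φ₂ (.and Φ₃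
          (.and (.eq k (.evar k' + ke + .cst .case)) (.eq (.evar t' + te + .cst .case) t)))))))
  | fix {Δ ψa Φa} {Ω : UCtx} {f x e A B k t k' t' Φ} :
      ChkU c Υ Δ ψa Φa ((x, A) :: (f, .arr A k' t' B) :: Ω) e B k' t' Φ →
      ChkU c Υ Δ ψa Φa Ω (.fix f x e) (.arr A k' t' B) k t
        (.and Φ (.and (.eq k .zero) (.eq .zero t)))
  | iLam {Δ ψa Φa} {Ω : UCtx} {e S A k t ke te Φ} :
      ChkU c Υ (S :: Δ) ψa (Φa.subst .shift) (Ω.subst .shift) e A ke te Φ →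
      ChkU c Υ Δ ψa Φa Ω (.iLam e) (.all S ke te A) k t
        (.and (.all S Φ) (.and (.eq k .zero) (.eq .zero t)))
  | pack {Δ ψa Φa} {Ω : UCtx} {e I S A k t Φ} :
      ChkU c Υ Δ ψa Φa Ω e (A.subst (.inst I)) k t Φ → HasSort Δ [] I S →
      ChkU c Υ Δ ψa Φa Ω (.pack e I) (.ex S A) k t Φ
  | unpack {Δ ψa Φa} {Ω : UCtx} {e₁ x e₂ S A B k t ψ k₁ t₁ k₂ t₂ Φ₁ Φ₂} :
      InfU c Υ Δ ψa Φa Ω e₁ (.ex S A) ψ k₁ t₁ Φ₁ →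
      Fresh [k₂, t₂] (ψ ++ ψa) →
      ChkU c Υ (S :: Δ) (reals [k₂, t₂] ++ ψ ++ ψa) (Φa.subst .shift)
        ((x, A) :: Ω.subst .shift) e₂ (B.subst .shift) (.evar k₂) (.evar t₂) Φ₂ →
      ChkU c Υ Δ ψa Φa Ω (.unpack e₁ x e₂) B k t
        (.exs ψ (.and Φ₁ (.exs (reals [k₂, t₂]) (.and (.all S Φ₂)
          (.and (.eq k (k₁ + .evar k₂ + .cst .unpack))
            (.eq (t₁ + .evar t₂ + .cst .unpack) t))))))
  | nil {Δ ψa Φa} {Ω : UCtx} {n A k t} :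
      A.Wf Δ ψa →
      ChkU c Υ Δ ψa Φa Ω .nil (.list n A) k t
        (.and (.eq n .zero) (.and (.eq k .zero) (.eq .zero t)))
  | cons {Δ ψa Φa} {Ω : UCtx} {e₁ e₂ n A k t k₁ t₁ k₂ t₂ i Φ₁ Φ₂} :
      Fresh [k₁, t₁, k₂, t₂, i] ψa →
      ChkU c Υ Δ (reals [k₁, t₁] ++ ψa) Φa Ω e₁ A (.evar k₁) (.evar t₁) Φ₁ →
      ChkU c Υ Δ ((i, .nat) :: reals [k₂, t₂] ++ ψa) Φa Ω e₂ (.list (.evar i) A)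
        (.evar k₂) (.evar t₂) Φ₂ →
      ChkU c Υ Δ ψa Φa Ω (.consC e₁ e₂) (.list n A) k t
        (.exs (reals [k₁, t₁]) (.and Φ₁ (.exs (reals [k₂, t₂]) (.ex i .nat
          (.and Φ₂ (.and (.eq n (.succ (.evar i)))
            (.and (.eq k (.evar k₁ + .evar k₂)) (.eq (.evar t₁ + .evar t₂) t))))))))
  | caseL {Δ ψa Φa} {Ω : UCtx} {e e₁ h tl e₂ h₃ tl₃ e₃ n A B k t ψ k₁ t₁ k₂ t₂ Φ₁ Φ₂ Φ₃} :
      InfU c Υ Δ ψa Φa Ω e (.list n A) ψ k₁ t₁ Φ₁ →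
      Fresh [k₂, t₂] (ψ ++ ψa) →
      ChkU c Υ Δ (reals [k₂, t₂] ++ ψ ++ ψa) (.eq n .zero :: Φa) Ω e₁ B
        (.evar k₂) (.evar t₂) Φ₂ →
      ChkU c Υ (.nat :: Δ) (reals [k₂, t₂] ++ ψ ++ ψa) (consEq n :: Φa.subst .shift)
        ((h, A.subst .shift) :: (tl, .list (.var 0) (A.subst .shift)) :: Ω.subst .shift)
        e₂ (B.subst .shift) (.evar k₂) (.evar t₂) Φ₃ →
      ChkU c Υ Δ ψa Φa Ω (.caseL e e₁ h tl e₂ h₃ tl₃ e₃) B k t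
        (.exs ψ (.and Φ₁ (.exs (reals [k₂, t₂])
          (.and (.imp (.eq n .zero) Φ₂) (.and (.all .nat (.imp (consEq n) Φ₃))
            (.and (.eq k (k₁ + .evar k₂ + .cst .caseL))
              (.eq (t₁ + .evar t₂ + .cst .caseL) t)))))))
  | letE {Δ ψa Φa} {Ω : UCtx} {x e₁ e₂ A B k t ψ k₁ t₁ k₂ t₂ Φ₁ Φ₂} :
      InfU c Υ Δ ψa Φa Ω e₁ A ψ k₁ t₁ Φ₁ →
      Fresh [k₂, t₂] (ψ ++ ψa) →
      ChkU c Υ Δ (reals [k₂, t₂] ++ ψ ++ ψa) Φa ((x, A) :: Ω) e₂ B (.evar k₂) (.evar t₂) Φ₂ →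
      ChkU c Υ Δ ψa Φa Ω (.letE x e₁ e₂) B k t
        (.exs ψ (.and Φ₁ (.exs (reals [k₂, t₂]) (.and Φ₂
          (.and (.eq k (k₁ + .evar k₂ + .cst .letC)) (.eq (t₁ + .evar t₂ + .cst .letC) t))))))
  | candI {Δ ψa Φa} {Ω : UCtx} {e C A k t Φ} :
      ChkU c Υ Δ ψa (C :: Φa) Ω e A k t Φ →
      ChkU c Υ Δ ψa Φa Ω e (.cand C A) k t (.and (.atom C) (.imp C Φ))
  | candE {Δ ψa Φa} {Ω : UCtx} {e₁ x e₂ C A B k t ψ k₁ t₁ k₂ t₂ Φ₁ Φ₂} :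
      InfU c Υ Δ ψa Φa Ω e₁ (.cand C A) ψ k₁ t₁ Φ₁ →
      Fresh [k₂, t₂] (ψ ++ ψa) →
      ChkU c Υ Δ (reals [k₂, t₂] ++ ψ ++ ψa) (C :: Φa) ((x, A) :: Ω) e₂ B
        (.evar k₂) (.evar t₂) Φ₂ →
      ChkU c Υ Δ ψa Φa Ω (.clet e₁ x e₂) B k t
        (.exs ψ (.and Φ₁ (.exs (reals [k₂, t₂]) (.and (.imp C Φ₂)
          (.and (.eq k (k₁ + .evar k₂)) (.eq (t₁ + .evar t₂) t))))))
  | cimpI {Δ ψa Φa} {Ω : UCtx} {e C A k t Φ} :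
      ChkU c Υ Δ ψa (C :: Φa) Ω e A k t Φ →
      ChkU c Υ Δ ψa Φa Ω e (.cimp C A) k t (.imp C Φ)
  | split {Δ ψa Φa} {Ω : UCtx} {e₁ e₂ C A k t Φ₁ Φ₂} :
      ChkU c Υ Δ ψa (C :: Φa) Ω e₁ A k t Φ₁ → ChkU c Υ Δ ψa (.neg C :: Φa) Ω e₂ A k t Φ₂ →
      C.Wf Δ [] →
      ChkU c Υ Δ ψa Φa Ω (.split e₁ e₂ C) A k t (.and (.imp C Φ₁) (.imp (.neg C) Φ₂))
  | contra {Δ ψa Φa} {Ω : UCtx} {e A k t} :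
      Entails c Δ ψa Φa .bot → Ω.Wf Δ ψa →
      ChkU c Υ Δ ψa Φa Ω (.contra e) A k t .top
  | updown {Δ ψa Φa} {Ω : UCtx} {e A A' k t ψ k' t' Φ₁ Φ₂} :
      InfU c Υ Δ ψa Φa Ω e A' ψ k' t' Φ₁ →
      AlgSubU Δ (ψ ++ ψa) Φa A' A Φ₂ →
      ChkU c Υ Δ ψa Φa Ω e A k t
        (.exs ψ (.and (.and Φ₁ Φ₂) (.and (.le t' t) (.le k k'))))

/-- Unary inference, `Δ; ψ_a; Φ_a; Ω ⊢ e ↑ A ⇒ [ψ], k, t, Φ`. -/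
inductive InfU (c : CostModel) (Υ : PrimEnv) :
    UEnv → EEnv → CEnv → UCtx → Expr → UTy → EEnv → Idx → Idx → CForm → Prop
  | num {Δ ψa Φa} {Ω : UCtx} {n} : InfU c Υ Δ ψa Φa Ω (.num n) .int [] .zero .zero .top
  | unit {Δ ψa Φa} {Ω : UCtx} : InfU c Υ Δ ψa Φa Ω .unit .unit [] .zero .zero .top
  | var {Δ ψa Φa} {Ω : UCtx} {x A} :
      Ω.lookup x = some A → InfU c Υ Δ ψa Φa Ω (.var x) A [] .zero .zero .top
  | fst {Δ ψa Φa} {Ω : UCtx} {e A B ψ k t Φ} :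
      InfU c Υ Δ ψa Φa Ω e (.prod A B) ψ k t Φ →
      InfU c Υ Δ ψa Φa Ω (.fst e) A ψ (k + .cst .proj) (t + .cst .proj) Φ
  | snd {Δ ψa Φa} {Ω : UCtx} {e A B ψ k t Φ} :
      InfU c Υ Δ ψa Φa Ω e (.prod A B) ψ k t Φ →
      InfU c Υ Δ ψa Φa Ω (.snd e) B ψ (k + .cst .proj) (t + .cst .proj) Φ
  | app {Δ ψa Φa} {Ω : UCtx} {e₁ e₂ A B ψ ke te k₁ t₁ k₂ t₂ Φ₁ Φ₂} :
      InfU c Υ Δ ψa Φa Ω e₁ (.arr A ke te B) ψ k₁ t₁ Φ₁ →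
      Fresh [k₂, t₂] (ψ ++ ψa) →
      ChkU c Υ Δ (reals [k₂, t₂] ++ ψ ++ ψa) Φa Ω e₂ A (.evar k₂) (.evar t₂) Φ₂ →
      InfU c Υ Δ ψa Φa Ω (.app e₁ e₂) B (reals [k₂, t₂] ++ ψ)
        (k₁ + .evar k₂ + ke + .cst .app) (t₁ + .evar t₂ + te + .cst .app) (.and Φ₁ Φ₂)
  | prim {Δ ψa Φa} {Ω : UCtx} {ζ e A B ke te k t Φ} :
      Υ.u ζ = some (A, ke, te, B) →
      Fresh [k, t] ψa →
      ChkU c Υ Δ (reals [k, t] ++ ψa) Φa Ω e A (.evar k) (.evar t) Φ →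
      InfU c Υ Δ ψa Φa Ω (.prim ζ e) B (reals [k, t])
        (.evar k + ke + .cst .app) (.evar t + te + .cst .app) Φ
  | iApp {Δ ψa Φa} {Ω : UCtx} {e I S A ψ k t ke te Φ} :
      InfU c Υ Δ ψa Φa Ω e (.all S ke te A) ψ k t Φ → HasSort Δ [] I S →
      InfU c Υ Δ ψa Φa Ω (.iApp e I) (A.subst (.inst I)) ψ
        (k + ke.subst (.inst I)) (t + te.subst (.inst I)) Φ
  | cimpE {Δ ψa Φa} {Ω : UCtx} {e C A ψ k t Φ} :
      InfU c Υ Δ ψa Φa Ω e (.cimp C A) ψ k t Φ →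
      InfU c Υ Δ ψa Φa Ω (.celim e) A ψ k t (.and (.atom C) Φ)
  | anno {Δ ψa Φa} {Ω : UCtx} {e A k t Φ} :
      ChkU c Υ Δ ψa Φa Ω e A k t Φ → A.Wf Δ [] →
      A.Scoped Δ.length [] → k.Scoped Δ.length [] → t.Scoped Δ.length [] →
      InfU c Υ Δ ψa Φa Ω (.annoU e A k t) A [] k t Φ

end

mutual

/-- Relational checking, `Δ; ψ_a; Φ_a; Γ ⊢ e ⊖ e' ↓ τ, t ⇒ Φ`. -/
inductive ChkR (c : CostModel) (Υ : PrimEnv) :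
    UEnv → EEnv → CEnv → RCtx → Expr → Expr → RTy → Idx → CForm → Prop
  | switch {Δ ψa Φa} {Γ : RCtx} {e e' A B t k₁ t₁ k₂ t₂ Φ₁ Φ₂} :
      Fresh [k₁, t₁, k₂, t₂] ψa →
      ChkU c Υ Δ (reals [k₁, t₁] ++ ψa) Φa (Γ.proj true) e A (.evar k₁) (.evar t₁) Φ₁ →
      ChkU c Υ Δ (reals [k₂, t₂] ++ ψa) Φa (Γ.proj false) e' B (.evar k₂) (.evar t₂) Φ₂ →
      ChkR c Υ Δ ψa Φa Γ (.switch e) (.switch e') (.U A B) t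
        (.exs (reals [k₁, t₁]) (.and Φ₁ (.exs (reals [k₂, t₂]) (.and Φ₂
          (.eq (.evar t₁ - .evar k₂) t)))))
  | nc {Δ ψa Φa} {Γ D : RCtx} {e τ t t' Φ} :
      Fresh [t'] ψa →
      ChkR c Υ Δ (reals [t'] ++ ψa) Φa Γ.box e e τ (.evar t') Φ →
      D.Extends Γ.box →
      ChkR c Υ Δ ψa Φa D (.nc e) (.nc e) (.box τ) t
        (.and (.eq .zero t) (.exs (reals [t']) Φ))
  | pair {Δ ψa Φa} {Γ : RCtx} {e₁ e₁' e₂ e₂' τ σ t t₁ t₂ Φ₁ Φ₂} :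
      Fresh [t₁, t₂] ψa →
      ChkR c Υ Δ (reals [t₁] ++ ψa) Φa Γ e₁ e₁' τ (.evar t₁) Φ₁ →
      ChkR c Υ Δ (reals [t₂] ++ ψa) Φa Γ e₂ e₂' σ (.evar t₂) Φ₂ →
      ChkR c Υ Δ ψa Φa Γ (.pair e₁ e₂) (.pair e₁' e₂') (.prod τ σ) t
        (.exs (reals [t₁]) (.and Φ₁ (.exs (reals [t₂]) (.and Φ₂
          (.eq (.evar t₁ + .evar t₂) t)))))
  | inl {Δ ψa Φa} {Γ : RCtx} {e e' τ σ t Φ} :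
      ChkR c Υ Δ ψa Φa Γ e e' τ t Φ → σ.Wf Δ ψa →
      ChkR c Υ Δ ψa Φa Γ (.inl e) (.inl e') (.sum τ σ) t Φ
  | inr {Δ ψa Φa} {Γ : RCtx} {e e' τ σ t Φ} :
      ChkR c Υ Δ ψa Φa Γ e e' σ t Φ → τ.Wf Δ ψa →
      ChkR c Υ Δ ψa Φa Γ (.inr e) (.inr e') (.sum τ σ) t Φ
  | case {Δ ψa Φa} {Γ : RCtx} {e e' x e₁ e₁' y e₂ e₂' τ₁ τ₂ τ t ψ te t' Φ₁ Φ₂ Φ₃} :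
      InfR c Υ Δ ψa Φa Γ e e' (.sum τ₁ τ₂) ψ te Φ₁ →
      Fresh [t'] (ψ ++ ψa) →
      ChkR c Υ Δ (reals [t'] ++ ψ ++ ψa) Φa ((x, τ₁) :: Γ) e₁ e₁' τ (.evar t') Φ₂ →
      ChkR c Υ Δ (reals [t'] ++ ψ ++ ψa) Φa ((y, τ₂) :: Γ) e₂ e₂' τ (.evar t') Φ₃ →
      ChkR c Υ Δ ψa Φa Γ (.case e x e₁ y e₂) (.case e' x e₁' y e₂') τ t
        (.exs ψ (.and Φ₁ (.exs (reals [t']) (.and Φ₂ (.and Φ₃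
          (.eq (.evar t' + te) t))))))
  | fix {Δ ψa Φa} {Γ : RCtx} {f x e e' τ σ t t' Φ} :
      ChkR c Υ Δ ψa Φa ((x, τ) :: (f, .arr τ t' σ) :: Γ) e e' σ t' Φ →
      ChkR c Υ Δ ψa Φa Γ (.fix f x e) (.fix f x e') (.arr τ t' σ) t (.and Φ (.eq .zero t))
  | fixNC {Δ ψa Φa} {Γ D : RCtx} {f x e τ σ t t' Φ} :
      ChkR c Υ Δ ψa Φa ((x, τ) :: (f, .box (.arr τ t' σ)) :: Γ.box) e e σ t' Φ →
      D.Extends Γ.box →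
      ChkR c Υ Δ ψa Φa D (.fixNC f x e) (.fixNC f x e) (.box (.arr τ t' σ)) t
        (.and Φ (.eq .zero t))
  | iLam {Δ ψa Φa} {Γ : RCtx} {e e' S τ t te Φ} :
      ChkR c Υ (S :: Δ) ψa (Φa.subst .shift) (Γ.subst .shift) e e' τ te Φ →
      ChkR c Υ Δ ψa Φa Γ (.iLam e) (.iLam e') (.all S te τ) t
        (.and (.all S Φ) (.eq .zero t))
  | pack {Δ ψa Φa} {Γ : RCtx} {e e' I S τ t Φ} :
      ChkR c Υ Δ ψa Φa Γ e e' (τ.subst (.inst I)) t Φ → HasSort Δ [] I S →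
      ChkR c Υ Δ ψa Φa Γ (.pack e I) (.pack e' I) (.ex S τ) t Φ
  | unpack {Δ ψa Φa} {Γ : RCtx} {e₁ e₁' x e₂ e₂' S τ σ t ψ t₁ t₂ Φ₁ Φ₂} :
      InfR c Υ Δ ψa Φa Γ e₁ e₁' (.ex S τ) ψ t₁ Φ₁ →
      Fresh [t₂] (ψ ++ ψa) →
      ChkR c Υ (S :: Δ) (reals [t₂] ++ ψ ++ ψa) (Φa.subst .shift) ((x, τ) :: Γ.subst .shift)
        e₂ e₂' (σ.subst .shift) (.evar t₂) Φ₂ →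
      ChkR c Υ Δ ψa Φa Γ (.unpack e₁ x e₂) (.unpack e₁' x e₂') σ t
        (.exs ψ (.and Φ₁ (.exs (reals [t₂]) (.and (.all S Φ₂) (.eq (t₁ + .evar t₂) t)))))
  | nil {Δ ψa Φa} {Γ : RCtx} {n α τ t} :
      τ.Wf Δ ψa →
      ChkR c Υ Δ ψa Φa Γ .nil .nil (.list n α τ) t (.and (.eq n .zero) (.eq .zero t))
  | consNC {Δ ψa Φa} {Γ : RCtx} {e₁ e₁' e₂ e₂' n α τ t t₁ t₂ i Φ₁ Φ₂} :
      Fresh [t₁, t₂, i] ψa →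
      ChkR c Υ Δ (reals [t₁] ++ ψa) Φa Γ e₁ e₁' (.box τ) (.evar t₁) Φ₁ →
      ChkR c Υ Δ ((i, .nat) :: reals [t₂] ++ ψa) Φa Γ e₂ e₂' (.list (.evar i) α τ)
        (.evar t₂) Φ₂ →
      ChkR c Υ Δ ψa Φa Γ (.consNC e₁ e₂) (.consNC e₁' e₂') (.list n α τ) t
        (.exs (reals [t₁]) (.and Φ₁ (.exs (reals [t₂]) (.ex i .nat
          (.and Φ₂ (.and (.eq n (.succ (.evar i))) (.eq (.evar t₁ + .evar t₂) t)))))))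
  | consC {Δ ψa Φa} {Γ : RCtx} {e₁ e₁' e₂ e₂' n α τ t t₁ t₂ i β Φ₁ Φ₂} :
      Fresh [t₁, t₂, i, β] ψa →
      ChkR c Υ Δ (reals [t₁] ++ ψa) Φa Γ e₁ e₁' τ (.evar t₁) Φ₁ →
      ChkR c Υ Δ ((i, .nat) :: (β, .nat) :: reals [t₂] ++ ψa) Φa Γ e₂ e₂'
        (.list (.evar i) (.evar β) τ) (.evar t₂) Φ₂ →
      ChkR c Υ Δ ψa Φa Γ (.consC e₁ e₂) (.consC e₁' e₂') (.list n α τ) t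
        (.exs (reals [t₁]) (.and Φ₁ (.exs (reals [t₂]) (.ex i .nat
          (.and (.eq n (.succ (.evar i))) (.ex β .nat
            (.and Φ₂ (.and (.eq α (.succ (.evar β)))
              (.eq (.evar t₁ + .evar t₂) t)))))))))
  | caseL {Δ ψa Φa} {Γ : RCtx}
      {e e' e₁ e₁' h tl e₂ e₂' h₃ tl₃ e₃ e₃' n α τ σ t ψ t₁ t₂ Φe Φ₁ Φ₂ Φ₃} :
      InfR c Υ Δ ψa Φa Γ e e' (.list n α τ) ψ t₁ Φe →
      Fresh [t₂] (ψ ++ ψa) →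
      ChkR c Υ Δ (reals [t₂] ++ ψ ++ ψa) (.eq n .zero :: Φa) Γ e₁ e₁' σ (.evar t₂) Φ₁ →
      ChkR c Υ (.nat :: Δ) (reals [t₂] ++ ψ ++ ψa) (consEq n :: Φa.subst .shift)
        ((h, .box (τ.subst .shift)) ::
          (tl, .list (.var 0) (α.subst .shift) (τ.subst .shift)) :: Γ.subst .shift)
        e₂ e₂' (σ.subst .shift) (.evar t₂) Φ₂ →
      ChkR c Υ (.nat :: .nat :: Δ) (reals [t₂] ++ ψ ++ ψa)
        (consEq (α.subst .shift) :: CEnv.subst (consEq n :: Φa.subst .shift) .shift)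
        ((h₃, (τ.subst .shift).subst .shift) ::
          (tl₃, .list (.var 1) (.var 0) ((τ.subst .shift).subst .shift)) ::
          (Γ.subst .shift).subst .shift)
        e₃ e₃' ((σ.subst .shift).subst .shift) (.evar t₂) Φ₃ →
      ChkR c Υ Δ ψa Φa Γ (.caseL e e₁ h tl e₂ h₃ tl₃ e₃) (.caseL e' e₁' h tl e₂' h₃ tl₃ e₃')
        σ t
        (.exs ψ (.and Φe (.exs (reals [t₂])
          (.and (.and (.imp (.eq n .zero) Φ₁)
              (.all .nat (.imp (consEq n)
                (.and Φ₂ (.all .nat (.imp (consEq (α.subst .shift)) Φ₃))))))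
            (.eq (t₁ + .evar t₂) t)))))
  | letE {Δ ψa Φa} {Γ : RCtx} {x e₁ e₁' e₂ e₂' τ σ t ψ t₁ t₂ Φ₁ Φ₂} :
      InfR c Υ Δ ψa Φa Γ e₁ e₁' τ ψ t₁ Φ₁ →
      Fresh [t₂] (ψ ++ ψa) →
      ChkR c Υ Δ (reals [t₂] ++ ψ ++ ψa) Φa ((x, τ) :: Γ) e₂ e₂' σ (.evar t₂) Φ₂ →
      ChkR c Υ Δ ψa Φa Γ (.letE x e₁ e₂) (.letE x e₁' e₂') σ t
        (.exs ψ (.and Φ₁ (.exs (reals [t₂]) (.and Φ₂ (.eq (t₁ + .evar t₂) t)))))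
  | candI {Δ ψa Φa} {Γ : RCtx} {e e' C τ t Φ} :
      ChkR c Υ Δ ψa (C :: Φa) Γ e e' τ t Φ →
      ChkR c Υ Δ ψa Φa Γ e e' (.cand C τ) t (.and (.atom C) (.imp C Φ))
  | candE {Δ ψa Φa} {Γ : RCtx} {e₁ e₁' x e₂ e₂' C τ σ t ψ t₁ t₂ Φ₁ Φ₂} :
      InfR c Υ Δ ψa Φa Γ e₁ e₁' (.cand C τ) ψ t₁ Φ₁ →
      Fresh [t₂] (ψ ++ ψa) →
      ChkR c Υ Δ (reals [t₂] ++ ψ ++ ψa) (C :: Φa) ((x, τ) :: Γ) e₂ e₂' σ (.evar t₂) Φ₂ →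
      ChkR c Υ Δ ψa Φa Γ (.clet e₁ x e₂) (.clet e₁' x e₂') σ t
        (.exs ψ (.and Φ₁ (.exs (reals [t₂]) (.and (.imp C Φ₂) (.eq (t₁ + .evar t₂) t)))))
  | cimpI {Δ ψa Φa} {Γ : RCtx} {e e' C τ t Φ} :
      ChkR c Υ Δ ψa (C :: Φa) Γ e e' τ t Φ →
      ChkR c Υ Δ ψa Φa Γ e e' (.cimp C τ) t (.imp C Φ)
  | split {Δ ψa Φa} {Γ : RCtx} {e₁ e₁' e₂ e₂' C τ t Φ₁ Φ₂} :
      ChkR c Υ Δ ψa (C :: Φa) Γ e₁ e₁' τ t Φ₁ →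
      ChkR c Υ Δ ψa (.neg C :: Φa) Γ e₂ e₂' τ t Φ₂ →
      C.Wf Δ [] →
      ChkR c Υ Δ ψa Φa Γ (.split e₁ e₂ C) (.split e₁' e₂' C) τ t
        (.and (.imp C Φ₁) (.imp (.neg C) Φ₂))
  | contra {Δ ψa Φa} {Γ : RCtx} {e e' τ t} :
      Entails c Δ ψa Φa .bot → Γ.Wf Δ ψa →
      ChkR c Υ Δ ψa Φa Γ (.contra e) (.contra e') τ t .top
  | updown {Δ ψa Φa} {Γ : RCtx} {e e' τ τ' t ψ t' Φ₁ Φ₂} :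
      InfR c Υ Δ ψa Φa Γ e e' τ' ψ t' Φ₁ →
      AlgEqR Δ (ψ ++ ψa) Φa τ' τ Φ₂ →
      ChkR c Υ Δ ψa Φa Γ e e' τ t (.exs ψ (.and (.and Φ₁ Φ₂) (.le t' t)))
  | let_e {Δ ψa Φa} {Γ : RCtx} {x e₁ e₂ e A τ t ψ k₁ t₁ t₂ Φ₁ Φ₂} :
      InfU c Υ Δ ψa Φa (Γ.proj true) e₁ A ψ k₁ t₁ Φ₁ →
      Fresh [t₂] (ψ ++ ψa) →
      ChkR c Υ Δ (reals [t₂] ++ ψ ++ ψa) Φa ((x, .U A A) :: Γ) e₂ e τ (.evar t₂) Φ₂ →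
      ChkR c Υ Δ ψa Φa Γ (.letE x e₁ e₂) e τ t
        (.exs ψ (.and Φ₁ (.exs (reals [t₂]) (.and Φ₂
          (.eq (t₁ + .evar t₂ + .cst .letC) t)))))
  | e_let {Δ ψa Φa} {Γ : RCtx} {x e₁ e₂ e A τ t ψ k₁ t₁ t₂ Φ₁ Φ₂} :
      InfU c Υ Δ ψa Φa (Γ.proj false) e₁ A ψ k₁ t₁ Φ₁ →
      Fresh [t₂] (ψ ++ ψa) →
      ChkR c Υ Δ (reals [t₂] ++ ψ ++ ψa) Φa ((x, .U A A) :: Γ) e e₂ τ (.evar t₂) Φ₂ →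
      ChkR c Υ Δ ψa Φa Γ e (.letE x e₁ e₂) τ t
        (.exs ψ (.and Φ₁ (.exs (reals [t₂]) (.and Φ₂
          (.eq (.evar t₂ - k₁ - .cst .letC) t)))))
  | app_e {Δ ψa Φa} {Γ : RCtx} {e₁ e₂ e₂' A₁ A₂ A A₂' t ψ ke te k₁ t₁ t₂ Φ₁ Φ₂ Φ₃} :
      InfU c Υ Δ ψa Φa (Γ.proj true) e₁ (.arr A₁ ke te A₂) ψ k₁ t₁ Φ₁ →
      Fresh [t₂] (ψ ++ ψa) →
      ChkR c Υ Δ (reals [t₂] ++ ψ ++ ψa) Φa Γ e₂ e₂' (.U A₁ A₂') (.evar t₂) Φ₂ →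
      AlgSubU Δ (ψ ++ ψa) Φa A₂ A Φ₃ →
      ChkR c Υ Δ ψa Φa Γ (.app e₁ e₂) e₂' (.U A A₂') t
        (.exs ψ (.and Φ₁ (.and (.exs (reals [t₂]) (.and Φ₂
          (.eq (t₁ + .evar t₂ + te + .cst .app) t))) Φ₃)))
  | e_app {Δ ψa Φa} {Γ : RCtx} {e₁' e₂ e₂' A A₁' A₂' A' t ψ ke te k₁ t₁ t₂ Φ₁ Φ₂ Φ₃} :
      InfU c Υ Δ ψa Φa (Γ.proj false) e₁' (.arr A₁' ke te A₂') ψ k₁ t₁ Φ₁ →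
      Fresh [t₂] (ψ ++ ψa) →
      ChkR c Υ Δ (reals [t₂] ++ ψ ++ ψa) Φa Γ e₂ e₂' (.U A A₁') (.evar t₂) Φ₂ →
      AlgSubU Δ (ψ ++ ψa) Φa A₂' A' Φ₃ →
      ChkR c Υ Δ ψa Φa Γ e₂ (.app e₁' e₂') (.U A A') t
        (.exs ψ (.and Φ₁ (.and (.exs (reals [t₂]) (.and Φ₂
          (.eq (.evar t₂ - k₁ - ke + .cst .app) t))) Φ₃)))
  | case_e {Δ ψa Φa} {Γ : RCtx} {e x e₁ y e₂ e' A₁ A₂ τ t ψ k₁ t₁ t₂ Φ₁ Φ₂ Φ₃} :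
      InfU c Υ Δ ψa Φa (Γ.proj true) e (.sum A₁ A₂) ψ k₁ t₁ Φ₁ →
      Fresh [t₂] (ψ ++ ψa) →
      ChkR c Υ Δ (reals [t₂] ++ ψ ++ ψa) Φa ((x, .U A₁ A₁) :: Γ) e₁ e' τ (.evar t₂) Φ₂ →
      ChkR c Υ Δ (reals [t₂] ++ ψ ++ ψa) Φa ((y, .U A₂ A₂) :: Γ) e₂ e' τ (.evar t₂) Φ₃ →
      ChkR c Υ Δ ψa Φa Γ (.case e x e₁ y e₂) e' τ t
        (.exs ψ (.and Φ₁ (.exs (reals [t₂]) (.and Φ₂ (.and Φ₃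
          (.eq (t₁ + .evar t₂ + .cst .case) t))))))
  | e_case {Δ ψa Φa} {Γ : RCtx} {e e' x e₁' y e₂' A₁ A₂ τ t ψ k₁ t₁ t₂ Φ₁ Φ₂ Φ₃} :
      InfU c Υ Δ ψa Φa (Γ.proj false) e' (.sum A₁ A₂) ψ k₁ t₁ Φ₁ →
      Fresh [t₂] (ψ ++ ψa) →
      ChkR c Υ Δ (reals [t₂] ++ ψ ++ ψa) Φa ((x, .U A₁ A₁) :: Γ) e e₁' τ (.evar t₂) Φ₂ →
      ChkR c Υ Δ (reals [t₂] ++ ψ ++ ψa) Φa ((y, .U A₂ A₂) :: Γ) e e₂' τ (.evar t₂) Φ₃ →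
      ChkR c Υ Δ ψa Φa Γ e (.case e' x e₁' y e₂') τ t
        (.exs ψ (.and Φ₁ (.exs (reals [t₂]) (.and Φ₂ (.and Φ₃
          (.eq (.evar t₂ - k₁ - .cst .case) t))))))

/-- Relational inference, `Δ; ψ_a; Φ_a; Γ ⊢ e ⊖ e' ↑ τ ⇒ [ψ], t, Φ`. -/
inductive InfR (c : CostModel) (Υ : PrimEnv) :
    UEnv → EEnv → CEnv → RCtx → Expr → Expr → RTy → EEnv → Idx → CForm → Prop
  | switch {Δ ψa Φa} {Γ : RCtx} {e e' A B ψ₁ ψ₂ k₁ t₁ k₂ t₂ Φ₁ Φ₂} :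
      InfU c Υ Δ ψa Φa (Γ.proj true) e A ψ₁ k₁ t₁ Φ₁ →
      InfU c Υ Δ ψa Φa (Γ.proj false) e' B ψ₂ k₂ t₂ Φ₂ →
      ψ₁.dom.Disjoint ψ₂.dom →
      InfR c Υ Δ ψa Φa Γ (.switch e) (.switch e') (.U A B) (ψ₁ ++ ψ₂) (t₁ - k₂) (.and Φ₁ Φ₂)
  | der {Δ ψa Φa} {Γ : RCtx} {e e' τ ψ t Φ} :
      InfR c Υ Δ ψa Φa Γ e e' (.box τ) ψ t Φ →
      InfR c Υ Δ ψa Φa Γ (.der e) (.der e') τ ψ t Φ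
  | num {Δ ψa Φa} {Γ : RCtx} {n} : InfR c Υ Δ ψa Φa Γ (.num n) (.num n) .int [] .zero .top
  | unit {Δ ψa Φa} {Γ : RCtx} : InfR c Υ Δ ψa Φa Γ .unit .unit .unit [] .zero .top
  | var {Δ ψa Φa} {Γ : RCtx} {x τ} :
      Γ.lookup x = some τ → InfR c Υ Δ ψa Φa Γ (.var x) (.var x) τ [] .zero .top
  | fst {Δ ψa Φa} {Γ : RCtx} {e e' τ σ ψ t Φ} :
      InfR c Υ Δ ψa Φa Γ e e' (.prod τ σ) ψ t Φ →
      InfR c Υ Δ ψa Φa Γ (.fst e) (.fst e') τ ψ t Φ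
  | snd {Δ ψa Φa} {Γ : RCtx} {e e' τ σ ψ t Φ} :
      InfR c Υ Δ ψa Φa Γ e e' (.prod τ σ) ψ t Φ →
      InfR c Υ Δ ψa Φa Γ (.snd e) (.snd e') σ ψ t Φ
  | app {Δ ψa Φa} {Γ : RCtx} {e₁ e₁' e₂ e₂' τ σ ψ te t₁ t₂ Φ₁ Φ₂} :
      InfR c Υ Δ ψa Φa Γ e₁ e₁' (.arr τ te σ) ψ t₁ Φ₁ →
      Fresh [t₂] (ψ ++ ψa) →
      ChkR c Υ Δ (reals [t₂] ++ ψ ++ ψa) Φa Γ e₂ e₂' τ (.evar t₂) Φ₂ →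
      InfR c Υ Δ ψa Φa Γ (.app e₁ e₂) (.app e₁' e₂') σ (reals [t₂] ++ ψ)
        (t₁ + .evar t₂ + te) (.and Φ₁ Φ₂)
  | prim {Δ ψa Φa} {Γ : RCtx} {ζ e e' τ σ te t Φ} :
      Υ.r ζ = some (τ, te, σ) →
      Fresh [t] ψa →
      ChkR c Υ Δ (reals [t] ++ ψa) Φa Γ e e' τ (.evar t) Φ →
      InfR c Υ Δ ψa Φa Γ (.prim ζ e) (.prim ζ e') σ (reals [t]) (.evar t + te) Φ
  | iApp {Δ ψa Φa} {Γ : RCtx} {e e' I S τ ψ t te Φ} :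
      InfR c Υ Δ ψa Φa Γ e e' (.all S te τ) ψ t Φ → HasSort Δ [] I S →
      InfR c Υ Δ ψa Φa Γ (.iApp e I) (.iApp e' I) (τ.subst (.inst I)) ψ
        (t + te.subst (.inst I)) Φ
  | cimpE {Δ ψa Φa} {Γ : RCtx} {e e' C τ ψ t Φ} :
      InfR c Υ Δ ψa Φa Γ e e' (.cimp C τ) ψ t Φ →
      InfR c Υ Δ ψa Φa Γ (.celim e) (.celim e') τ ψ t (.and (.atom C) Φ)
  | anno {Δ ψa Φa} {Γ : RCtx} {e e' τ t Φ} :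
      ChkR c Υ Δ ψa Φa Γ e e' τ t Φ → τ.Wf Δ [] →
      τ.Scoped Δ.length [] → t.Scoped Δ.length [] →
      InfR c Υ Δ ψa Φa Γ (.annoR e τ t) (.annoR e' τ t) τ [] t Φ

end

end BiRelCost

namespace BiRelCost

/-! Substitution lemmas for index terms. -/

-- Up to its bidirectional organisation, an algorithmic derivation is a RelCostCore derivation in
-- which unknown costs, lengths and difference counts are existential variables and most side
-- conditions are postponed into `Φ`. A proof of `Φ[θ]` supplies what was postponed: an index term
-- over `Δ` for every existential quantifier and an entailment for every atom. Soundness is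
-- therefore an induction on the algorithmic derivation, checking and inference simultaneously, in
-- which the proof of `Φ` is inverted alongside (`Prov.exs_inv` and its relatives) and the matching
-- core rule is applied to the instantiated premises. The unary judgments come first, since they
-- never refer to the relational ones.
--
-- The delicate point is that every inverted `∃` enlarges the substitution, so the premises of one
-- rule arrive under different substitutions `θ`, `θ₁`, `θ₂`. They fit together because freshness
-- makes each substitution agree with its predecessor on all variables already in scope, and because
-- instances depend only on variables in scope (`Idx.subst_congr` and its analogues for types,
-- constraints and contexts). For inferred types and costs this needs `InfU.scoped` and
-- `InfR.scoped`: their variables lie in `ψ ++ ψa`. Successive witnesses collapse into one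
-- simultaneous substitution because a witness contains no existential variable
-- (`CForm.subst_subst`).
--
-- The induction statement speaks of an arbitrary `θ` that is well-sorted on `ψa`, and of any
-- context that looks up like the instance of `Ω` (`UInst`, `RInst`). Equality of contexts as lists
-- would be too strong: scoping restricts only visible bindings, so a shadowed one may change when
-- `θ` is extended.
--
-- Under an index binder `θ` becomes `up θ`, which commutes with weakening. The existentials for the
-- costs of a branch are quantified outside the `∀`, so their witnesses are weakened terms, as the
-- core rules demand. Index terms written in expressions have no existential variables, hence
-- instantiation commutes with `θ` as well.
--
-- The cost computed by a core rule is reconciled with the prescribed one by subsumption, using the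
-- equations in `Φ` and commutativity of addition. Only e/app requires a genuine inequality, from
-- nonnegativity of the cost constants. The semantics of index terms is needed otherwise only for
-- `contra`, whose premise is an entailment over all valuations of `ψa` (`Entails.subst_ofE`).

@[simp] theorem Idx.eval_add (c : CostModel) (I J : Idx) (ρ η : ℕ → EReal) :
    (I + J).eval c ρ η = I.eval c ρ η + J.eval c ρ η := rfl

@[simp] theorem Idx.eval_sub (c : CostModel) (I J : Idx) (ρ η : ℕ → EReal) :
    (I - J).eval c ρ η = I.eval c ρ η - J.eval c ρ η := rfl

@[simp] theorem Idx.subst_add (I J : Idx) (s : ISubst) :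
    (I + J).subst s = I.subst s + J.subst s := rfl

theorem liftRen_comp (f g : ℕ → ℕ) (n : ℕ) :
    liftRen g (liftRen f n) = liftRen (fun m => g (f m)) n := by
  cases n <;> rfl

/-- Lifting a substitution under a binder is defined by renaming, so fusion has to be established in
stages: two renamings, a renaming followed by a substitution, the reverse order, and only then two
substitutions. -/
theorem Idx.rename_rename (I : Idx) (f g : ℕ → ℕ) :
    (I.rename f).rename g = I.rename (fun n => g (f n)) := by
  induction I generalizing f g with
  | sum I J K hI hJ hK =>
    simp only [Idx.rename, hI, hJ, hK, Idx.sum.injEq, true_and]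
    congr 1; funext n; exact liftRen_comp f g n
  | _ => simp_all [Idx.rename]

namespace ISubst

theorem eq_of {s s' : ISubst} (hu : ∀ n, s.u n = s'.u n) (he : ∀ a, s.e a = s'.e a) : s = s' := by
  obtain ⟨u, e⟩ := s
  obtain ⟨u', e'⟩ := s'
  simp only [mk.injEq]
  exact ⟨funext hu, funext he⟩

/-- Composition, `s` first. -/
def comp (s s' : ISubst) : ISubst := ⟨fun n => (s.u n).subst s', fun a => (s.e a).subst s'⟩

end ISubst

theorem Idx.subst_rename (I : Idx) (f : ℕ → ℕ) (s : ISubst) :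
    (I.rename f).subst s = I.subst ⟨fun n => s.u (f n), s.e⟩ := by
  induction I generalizing f s with
  | sum I J K hI hJ hK =>
    simp only [Idx.rename, Idx.subst, hI, hJ, hK, Idx.sum.injEq, true_and]
    congr 1
    exact ISubst.eq_of (fun n => by cases n <;> rfl) (fun _ => rfl)
  | _ => simp_all [Idx.rename, Idx.subst]

theorem Idx.rename_subst (I : Idx) (f : ℕ → ℕ) (s : ISubst) :
    (I.subst s).rename f = I.subst ⟨fun n => (s.u n).rename f, fun a => (s.e a).rename f⟩ := by
  induction I generalizing f s with
  | sum I J K hI hJ hK =>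
    simp only [Idx.rename, Idx.subst, hI, hJ, hK, Idx.sum.injEq, true_and]
    congr 1
    refine ISubst.eq_of (fun n => ?_) (fun a => ?_)
    · cases n with
      | zero => rfl
      | succ n => simp only [ISubst.lift, Idx.rename_rename]; rfl
    · simp only [ISubst.lift, Idx.rename_rename]; rfl
  | _ => simp_all [Idx.rename, Idx.subst]

theorem ISubst.lift_comp (s s' : ISubst) : (s.comp s').lift = s.lift.comp s'.lift := by
  refine ISubst.eq_of (fun n => ?_) (fun a => ?_)
  · cases n with
    | zero => rfl
    | succ n =>
      simp only [ISubst.lift, ISubst.comp, Idx.subst_rename, Idx.rename_subst]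
  · simp only [ISubst.lift, ISubst.comp, Idx.subst_rename, Idx.rename_subst]

theorem Idx.subst_subst (I : Idx) (s s' : ISubst) :
    (I.subst s).subst s' = I.subst (s.comp s') := by
  induction I generalizing s s' with
  | sum I J K hI hJ hK => simp only [Idx.subst, hI, hJ, hK, ISubst.lift_comp]
  | _ => simp_all [Idx.subst, ISubst.comp]

theorem ISubst.lift_id : ISubst.lift ⟨.var, .evar⟩ = ⟨.var, .evar⟩ :=
  ISubst.eq_of (fun n => by cases n <;> rfl) (fun _ => rfl)

theorem Idx.subst_id (I : Idx) : I.subst ⟨.var, .evar⟩ = I := by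
  induction I with
  | sum I J K hI hJ hK => simp only [Idx.subst, ISubst.lift_id, hI, hJ, hK]
  | _ => simp_all [Idx.subst]

/-- Reconciles the two forms of weakening: lifting uses renaming, while the typing rules use the
substitution `ISubst.shift`. -/
theorem Idx.rename_succ (I : Idx) : I.rename Nat.succ = I.subst .shift := by
  have h := I.rename_subst Nat.succ ⟨.var, .evar⟩
  rw [Idx.subst_id] at h
  exact h

/-- Agreement of two substitutions on the variables of a scope. -/
def ISubst.AgreeOn (d : ℕ) (E : List ℕ) (s s' : ISubst) : Prop :=
  (∀ n < d, s.u n = s'.u n) ∧ ∀ a ∈ E, s.e a = s'.e a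

theorem ISubst.AgreeOn.lift {d : ℕ} {E : List ℕ} {s s' : ISubst} (h : s.AgreeOn d E s') :
    s.lift.AgreeOn (d + 1) E s'.lift := by
  refine ⟨fun n hn => ?_, fun a ha => ?_⟩
  · cases n with
    | zero => rfl
    | succ n => simp only [ISubst.lift, h.1 n (by omega)]
  · simp only [ISubst.lift, h.2 a ha]

/-- The basis for exchanging a substitution for an extension of it: only the variables in scope are
ever consulted, and a binder enlarges the universal scope by a variable that both lifted
substitutions fix. -/
theorem Idx.subst_congr {I : Idx} {d : ℕ} {E : List ℕ} {s s' : ISubst}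
    (hI : I.Scoped d E) (h : s.AgreeOn d E s') : I.subst s = I.subst s' := by
  induction I generalizing d s s' with
  | var n => exact h.1 n hI
  | evar a => exact h.2 a hI
  | sum I J K ihI ihJ ihK =>
    simp only [Idx.subst, ihI hI.1 h, ihJ hI.2.1 h, ihK hI.2.2 h.lift]
  | cst | zero | infty => rfl
  | succ I ih | ceil I ih | floor I ih | log I ih => simp only [Idx.subst, ih hI h]
  | _ => rename_i ih₁ ih₂; simp only [Idx.subst, ih₁ hI.1 h, ih₂ hI.2 h]

/-- A substitution maps the variables of a scope to terms of another scope. -/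
def ISubst.Maps (s : ISubst) (d : ℕ) (E : List ℕ) (d' : ℕ) (E' : List ℕ) : Prop :=
  (∀ n < d, (s.u n).Scoped d' E') ∧ ∀ a ∈ E, (s.e a).Scoped d' E'

theorem Idx.Scoped.rename {I : Idx} {d d' : ℕ} {E : List ℕ} {f : ℕ → ℕ}
    (hI : I.Scoped d E) (hf : ∀ n < d, f n < d') : (I.rename f).Scoped d' E := by
  induction I generalizing d d' f with
  | var n => exact hf n hI
  | evar a => exact hI
  | sum I J K ihI ihJ ihK =>
    refine ⟨ihI hI.1 hf, ihJ hI.2.1 hf, ihK hI.2.2 (fun n hn => ?_)⟩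
    cases n with
    | zero => simp [liftRen]
    | succ n => simpa [liftRen] using hf n (by omega)
  | cst | zero | infty => trivial
  | succ I ih | ceil I ih | floor I ih | log I ih => exact ih (d := d) hI hf
  | _ => rename_i ih₁ ih₂; exact ⟨ih₁ hI.1 hf, ih₂ hI.2 hf⟩

theorem ISubst.Maps.lift {s : ISubst} {d d' : ℕ} {E E' : List ℕ} (h : s.Maps d E d' E') :
    s.lift.Maps (d + 1) E (d' + 1) E' := by
  refine ⟨fun n hn => ?_, fun a ha => (h.2 a ha).rename (fun n hn => Nat.succ_lt_succ hn)⟩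
  cases n with
  | zero => exact Nat.succ_pos _
  | succ n => exact (h.1 n (by omega)).rename (fun n hn => Nat.succ_lt_succ hn)

theorem Idx.Scoped.subst {I : Idx} {d d' : ℕ} {E E' : List ℕ} {s : ISubst}
    (hI : I.Scoped d E) (hs : s.Maps d E d' E') : (I.subst s).Scoped d' E' := by
  induction I generalizing d d' s with
  | var n => exact hs.1 n hI
  | evar a => exact hs.2 a hI
  | sum I J K ihI ihJ ihK => exact ⟨ihI hI.1 hs, ihJ hI.2.1 hs, ihK hI.2.2 hs.lift⟩
  | cst | zero | infty => trivial
  | succ I ih | ceil I ih | floor I ih | log I ih => exact ih (d := d) hI hs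
  | _ => rename_i ih₁ ih₂; exact ⟨ih₁ hI.1 hs, ih₂ hI.2 hs⟩

theorem ISubst.maps_id {d d' : ℕ} {E E' : List ℕ} (hd : d ≤ d') (hE : E ⊆ E') :
    ISubst.Maps ⟨.var, .evar⟩ d E d' E' :=
  ⟨fun _ hn => lt_of_lt_of_le hn hd, fun _ ha => hE ha⟩

theorem ISubst.maps_shift (d : ℕ) (E : List ℕ) : ISubst.shift.Maps d E (d + 1) E :=
  ⟨fun _ hn => Nat.succ_lt_succ hn, fun _ ha => ha⟩

theorem ISubst.maps_inst {I : Idx} {d : ℕ} (hI : I.Scoped d []) (E : List ℕ) :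
    (ISubst.inst I).Maps (d + 1) E d E := by
  refine ⟨fun n hn => ?_, fun _ ha => ha⟩
  cases n with
  | zero =>
    -- The term put for the innermost variable has no existential variables, so it is in scope for
    -- every `E`; the identity substitution serves as weakening.
    have := hI.subst (ISubst.maps_id le_rfl (List.nil_subset E))
    rwa [Idx.subst_id] at this
  | succ n => exact Nat.lt_of_succ_lt_succ hn

/-! Substitution of existential variables. -/

/-- Weakening of the range of a substitution by one universal variable. -/
def up (θ : ℕ → Idx) : ℕ → Idx := fun a => (θ a).rename Nat.succ

/-- Substitutions of existential variables alone are stable under binders, so the induction never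
leaves the class `ofE`. -/
theorem ISubst.ofE_lift (θ : ℕ → Idx) : (ISubst.ofE θ).lift = .ofE (up θ) :=
  ISubst.eq_of (fun n => by cases n <;> rfl) (fun _ => rfl)

theorem ISubst.shift_comp_lift (s : ISubst) : ISubst.shift.comp s.lift = s.comp .shift := by
  refine ISubst.eq_of (fun n => ?_) (fun a => ?_)
  · exact Idx.rename_succ _
  · exact Idx.rename_succ _

theorem ISubst.agreeOn_ofE {d : ℕ} {E : List ℕ} {θ θ' : ℕ → Idx} (h : ∀ a ∈ E, θ a = θ' a) :
    (ISubst.ofE θ).AgreeOn d E (.ofE θ') := ⟨fun _ _ => rfl, h⟩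

theorem Idx.Scoped.subst_ofE_of_nil {I : Idx} {d : ℕ} (h : I.Scoped d []) (θ : ℕ → Idx) :
    I.subst (.ofE θ) = I := by
  conv_rhs => rw [← I.subst_id]
  exact Idx.subst_congr h ⟨fun _ _ => rfl, by simp⟩

/-- On the innermost variable the two sides give `I[θ]` and `I`, which is where the absence of
existential variables in `I` enters. It lets `pack` and index application commute with
instantiation. -/
theorem ISubst.inst_comp_ofE {I : Idx} {d : ℕ} (hI : I.Scoped d []) (θ : ℕ → Idx) :
    (ISubst.inst I).comp (.ofE θ) = (ISubst.ofE θ).lift.comp (.inst I) := by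
  refine ISubst.eq_of (fun n => ?_) (fun a => ?_)
  · cases n with
    | zero => exact hI.subst_ofE_of_nil θ
    | succ n => rfl
  · simp only [comp, lift, ofE, Idx.subst_rename]
    exact (Idx.subst_id _).symm

/-! Substitution lemmas for constraints, types and contexts. -/

theorem Constr.subst_subst (C : Constr) (s s' : ISubst) :
    (C.subst s).subst s' = C.subst (s.comp s') := by
  induction C <;> simp_all [Constr.subst, Idx.subst_subst]

theorem UTy.subst_subst (A : UTy) (s s' : ISubst) :
    (A.subst s).subst s' = A.subst (s.comp s') := by
  induction A generalizing s s' <;>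
    simp_all [UTy.subst, Idx.subst_subst, Constr.subst_subst, ISubst.lift_comp]

theorem RTy.subst_subst (τ : RTy) (s s' : ISubst) :
    (τ.subst s).subst s' = τ.subst (s.comp s') := by
  induction τ generalizing s s' <;>
    simp_all [RTy.subst, Idx.subst_subst, Constr.subst_subst, UTy.subst_subst, ISubst.lift_comp]

theorem CEnv.subst_subst (Φa : CEnv) (s s' : ISubst) :
    (Φa.subst s).subst s' = Φa.subst (s.comp s') := by
  simp [CEnv.subst, Constr.subst_subst]

theorem Constr.subst_congr {C : Constr} {d : ℕ} {E : List ℕ} {s s' : ISubst}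
    (hC : C.Scoped d E) (h : s.AgreeOn d E s') : C.subst s = C.subst s' := by
  induction C with
  | eq I J | lt I J =>
    simp only [Constr.subst, Idx.subst_congr hC.1 h, Idx.subst_congr hC.2 h]
  | neg C ih => simp only [Constr.subst, ih hC]

theorem UTy.subst_congr {A : UTy} {d : ℕ} {E : List ℕ} {s s' : ISubst}
    (hA : A.Scoped d E) (h : s.AgreeOn d E s') : A.subst s = A.subst s' := by
  induction A generalizing d s s' with
  | unit | int => rfl
  | prod A B ih₁ ih₂ | sum A B ih₁ ih₂ => simp only [UTy.subst, ih₁ hA.1 h, ih₂ hA.2 h]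
  | arr A k t B ih₁ ih₂ =>
    simp only [UTy.subst, ih₁ hA.1 h, Idx.subst_congr hA.2.1 h, Idx.subst_congr hA.2.2.1 h,
      ih₂ hA.2.2.2 h]
  | list n A ih => simp only [UTy.subst, Idx.subst_congr hA.1 h, ih hA.2 h]
  | all S k t A ih =>
    simp only [UTy.subst, Idx.subst_congr hA.1 h.lift, Idx.subst_congr hA.2.1 h.lift,
      ih hA.2.2 h.lift]
  | ex S A ih => simp only [UTy.subst, ih (d := d + 1) hA h.lift]
  | cand C A ih | cimp C A ih => simp only [UTy.subst, Constr.subst_congr hA.1 h, ih hA.2 h]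

theorem RTy.subst_congr {τ : RTy} {d : ℕ} {E : List ℕ} {s s' : ISubst}
    (hA : τ.Scoped d E) (h : s.AgreeOn d E s') : τ.subst s = τ.subst s' := by
  induction τ generalizing d s s' with
  | unit | int => rfl
  | prod A B ih₁ ih₂ | sum A B ih₁ ih₂ => simp only [RTy.subst, ih₁ hA.1 h, ih₂ hA.2 h]
  | arr A t B ih₁ ih₂ =>
    simp only [RTy.subst, ih₁ hA.1 h, Idx.subst_congr hA.2.1 h, ih₂ hA.2.2 h]
  | list n α A ih =>
    simp only [RTy.subst, Idx.subst_congr hA.1 h, Idx.subst_congr hA.2.1 h, ih hA.2.2 h]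
  | all S t A ih => simp only [RTy.subst, Idx.subst_congr hA.1 h.lift, ih hA.2 h.lift]
  | ex S A ih => simp only [RTy.subst, ih (d := d + 1) hA h.lift]
  | U A B => simp only [RTy.subst, UTy.subst_congr hA.1 h, UTy.subst_congr hA.2 h]
  | box A ih => simp only [RTy.subst, ih (d := d) hA h]
  | cand C A ih | cimp C A ih => simp only [RTy.subst, Constr.subst_congr hA.1 h, ih hA.2 h]

theorem CEnv.subst_congr {Φa : CEnv} {d : ℕ} {E : List ℕ} {s s' : ISubst}
    (hΦ : Φa.Scoped d E) (h : s.AgreeOn d E s') : Φa.subst s = Φa.subst s' :=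
  List.map_congr_left fun C hC => Constr.subst_congr (hΦ C hC) h

theorem Constr.Scoped.subst {C : Constr} {d d' : ℕ} {E E' : List ℕ} {s : ISubst}
    (hC : C.Scoped d E) (hs : s.Maps d E d' E') : (C.subst s).Scoped d' E' := by
  induction C with
  | eq I J | lt I J => exact ⟨hC.1.subst hs, hC.2.subst hs⟩
  | neg C ih => exact ih hC

theorem UTy.Scoped.subst {A : UTy} {d d' : ℕ} {E E' : List ℕ} {s : ISubst}
    (hA : A.Scoped d E) (hs : s.Maps d E d' E') : (A.subst s).Scoped d' E' := by
  induction A generalizing d d' s with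
  | unit | int => trivial
  | prod A B ih₁ ih₂ | sum A B ih₁ ih₂ => exact ⟨ih₁ hA.1 hs, ih₂ hA.2 hs⟩
  | arr A k t B ih₁ ih₂ =>
    exact ⟨ih₁ hA.1 hs, hA.2.1.subst hs, hA.2.2.1.subst hs, ih₂ hA.2.2.2 hs⟩
  | list n A ih => exact ⟨hA.1.subst hs, ih hA.2 hs⟩
  | all S k t A ih =>
    exact ⟨hA.1.subst hs.lift, hA.2.1.subst hs.lift, ih hA.2.2 hs.lift⟩
  | ex S A ih => exact ih (d := d + 1) hA hs.lift
  | cand C A ih | cimp C A ih => exact ⟨hA.1.subst hs, ih hA.2 hs⟩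

theorem RTy.Scoped.subst {τ : RTy} {d d' : ℕ} {E E' : List ℕ} {s : ISubst}
    (hτ : τ.Scoped d E) (hs : s.Maps d E d' E') : (τ.subst s).Scoped d' E' := by
  induction τ generalizing d d' s with
  | unit | int => trivial
  | prod A B ih₁ ih₂ | sum A B ih₁ ih₂ => exact ⟨ih₁ hτ.1 hs, ih₂ hτ.2 hs⟩
  | arr A t B ih₁ ih₂ => exact ⟨ih₁ hτ.1 hs, hτ.2.1.subst hs, ih₂ hτ.2.2 hs⟩
  | list n α A ih => exact ⟨hτ.1.subst hs, hτ.2.1.subst hs, ih hτ.2.2 hs⟩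
  | all S t A ih => exact ⟨hτ.1.subst hs.lift, ih hτ.2 hs.lift⟩
  | ex S A ih => exact ih (d := d + 1) hτ hs.lift
  | U A B => exact ⟨hτ.1.subst hs, hτ.2.subst hs⟩
  | box A ih => exact ih (d := d) hτ hs
  | cand C A ih | cimp C A ih => exact ⟨hτ.1.subst hs, ih hτ.2 hs⟩

theorem Constr.subst_id (C : Constr) : C.subst ⟨.var, .evar⟩ = C := by
  induction C <;> simp_all [Constr.subst, Idx.subst_id]

theorem UTy.subst_id (A : UTy) : A.subst ⟨.var, .evar⟩ = A := by
  induction A <;> simp_all [UTy.subst, Idx.subst_id, Constr.subst_id, ISubst.lift_id]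

theorem RTy.subst_id (τ : RTy) : τ.subst ⟨.var, .evar⟩ = τ := by
  induction τ <;>
    simp_all [RTy.subst, Idx.subst_id, Constr.subst_id, UTy.subst_id, ISubst.lift_id]

-- Weakening of scopes; scoping of extended, weakened and projected contexts.

section Mono

variable {d d' : ℕ} {E E' : List ℕ}

theorem Idx.Scoped.mono {I : Idx} (h : I.Scoped d E) (hd : d ≤ d') (hE : E ⊆ E') :
    I.Scoped d' E' := by
  simpa only [Idx.subst_id] using h.subst (ISubst.maps_id hd hE)

theorem Constr.Scoped.mono {C : Constr} (h : C.Scoped d E) (hd : d ≤ d') (hE : E ⊆ E') :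
    C.Scoped d' E' := by
  simpa only [Constr.subst_id] using h.subst (ISubst.maps_id hd hE)

theorem UTy.Scoped.mono {A : UTy} (h : A.Scoped d E) (hd : d ≤ d') (hE : E ⊆ E') :
    A.Scoped d' E' := by
  simpa only [UTy.subst_id] using h.subst (ISubst.maps_id hd hE)

theorem RTy.Scoped.mono {τ : RTy} (h : τ.Scoped d E) (hd : d ≤ d') (hE : E ⊆ E') :
    τ.Scoped d' E' := by
  simpa only [RTy.subst_id] using h.subst (ISubst.maps_id hd hE)

theorem CEnv.Scoped.mono {Φa : CEnv} (h : Φa.Scoped d E) (hE : E ⊆ E') : Φa.Scoped d E' :=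
  fun C hC => (h C hC).mono le_rfl hE

theorem UCtx.Scoped.mono {Ω : UCtx} (h : Ω.Scoped d E) (hE : E ⊆ E') : Ω.Scoped d E' :=
  fun x A hx => (h x A hx).mono le_rfl hE

theorem RCtx.Scoped.mono {Γ : RCtx} (h : Γ.Scoped d E) (hE : E ⊆ E') : Γ.Scoped d E' :=
  fun x A hx => (h x A hx).mono le_rfl hE

theorem CEnv.Scoped.cons {Φa : CEnv} {C : Constr} (hC : C.Scoped d E) (h : Φa.Scoped d E) :
    CEnv.Scoped (C :: Φa) d E := by
  intro D hD
  rcases List.mem_cons.1 hD with rfl | hD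
  exacts [hC, h D hD]

theorem CEnv.Scoped.shift {Φa : CEnv} (h : Φa.Scoped d E) :
    CEnv.Scoped (Φa.subst .shift) (d + 1) E := by
  intro D hD
  obtain ⟨C, hC, rfl⟩ := List.mem_map.1 hD
  exact (h C hC).subst (ISubst.maps_shift d E)

/-- Substitution, unary projection and boxing of contexts are all maps of this shape, so every
statement about them reduces to visible bindings. -/
theorem lookup_map {α β : Type*} (f : α → β) (l : List (ℕ × α)) (x : ℕ) :
    (l.map (fun p => (p.1, f p.2))).lookup x = (l.lookup x).map f := by
  induction l with
  | nil => rfl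
  | cons p l ih =>
    obtain ⟨y, a⟩ := p
    simp only [List.map_cons, List.lookup_cons]
    cases x == y <;> simp [ih]

theorem UCtx.Scoped.cons {Ω : UCtx} {x : ℕ} {A : UTy} (hA : A.Scoped d E)
    (h : Ω.Scoped d E) : UCtx.Scoped ((x, A) :: Ω) d E := by
  intro y B hB
  rw [List.lookup_cons] at hB
  cases hy : y == x <;> simp only [hy] at hB
  · exact h y B hB
  · cases hB; exact hA

theorem RCtx.Scoped.cons {Γ : RCtx} {x : ℕ} {τ : RTy} (hA : τ.Scoped d E)
    (h : Γ.Scoped d E) : RCtx.Scoped ((x, τ) :: Γ) d E := by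
  intro y B hB
  rw [List.lookup_cons] at hB
  cases hy : y == x <;> simp only [hy] at hB
  · exact h y B hB
  · cases hB; exact hA

theorem UCtx.Scoped.shift {Ω : UCtx} (h : Ω.Scoped d E) :
    UCtx.Scoped (Ω.subst .shift) (d + 1) E := by
  intro x A hA
  rw [UCtx.subst, lookup_map (fun A : UTy => A.subst .shift)] at hA
  obtain ⟨B, hB, rfl⟩ := Option.map_eq_some_iff.1 hA
  exact (h x B hB).subst (ISubst.maps_shift d E)

theorem RCtx.Scoped.shift {Γ : RCtx} (h : Γ.Scoped d E) :
    RCtx.Scoped (Γ.subst .shift) (d + 1) E := by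
  intro x A hA
  rw [RCtx.subst, lookup_map (fun τ : RTy => τ.subst .shift)] at hA
  obtain ⟨B, hB, rfl⟩ := Option.map_eq_some_iff.1 hA
  exact (h x B hB).subst (ISubst.maps_shift d E)

theorem RTy.Scoped.proj {τ : RTy} (h : τ.Scoped d E) (left : Bool) :
    (τ.proj left).Scoped d E := by
  induction τ generalizing d with
  | unit | int => trivial
  | prod A B ih₁ ih₂ | sum A B ih₁ ih₂ => exact ⟨ih₁ h.1, ih₂ h.2⟩
  | arr A t B ih₁ ih₂ => exact ⟨ih₁ h.1, trivial, trivial, ih₂ h.2.2⟩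
  | list n α A ih => exact ⟨h.1, ih h.2.2⟩
  | all S t A ih => exact ⟨trivial, trivial, ih h.2⟩
  | ex S A ih => exact ih (d := d + 1) h
  | U A B => cases left <;> first | exact h.1 | exact h.2
  | box A ih => exact ih (d := d) h
  | cand C A ih | cimp C A ih => exact ⟨h.1, ih h.2⟩

theorem RCtx.Scoped.proj {Γ : RCtx} (h : Γ.Scoped d E) (left : Bool) :
    (Γ.proj left).Scoped d E := by
  intro x A hA
  rw [RCtx.proj, lookup_map (fun τ : RTy => τ.proj left)] at hA
  obtain ⟨B, hB, rfl⟩ := Option.map_eq_some_iff.1 hA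
  exact (h x B hB).proj left

end Mono

/-- The only costs that projection introduces are the closed terms `0` and `∞`, which no
substitution affects. -/
theorem RTy.proj_subst (τ : RTy) (left : Bool) (s : ISubst) :
    (τ.subst s).proj left = (τ.proj left).subst s := by
  induction τ generalizing s with
  | U A B => cases left <;> rfl
  | _ => simp_all [RTy.proj, RTy.subst, UTy.subst, Idx.subst]

/-! Sorting and well-formedness. -/

theorem HasSort.rename {Δ Δ' : UEnv} {ψ : EEnv} {I : Idx} {S : ISort} {f : ℕ → ℕ}
    (h : HasSort Δ ψ I S) (hf : ∀ n S, Δ[n]? = some S → Δ'[f n]? = some S) :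
    HasSort Δ' ψ (I.rename f) S := by
  induction h generalizing Δ' f with
  | var h => exact .var (hf _ _ h)
  | evar h => exact .evar h
  | cst => exact .cst
  | zero => exact .zero
  | infty => exact .infty
  | succ _ ih => exact .succ (ih hf)
  | add _ _ ih₁ ih₂ => exact .add (ih₁ hf) (ih₂ hf)
  | sub _ _ ih₁ ih₂ => exact .sub (ih₁ hf) (ih₂ hf)
  | div _ _ ih₁ ih₂ => exact .div (ih₁ hf) (ih₂ hf)
  | mul _ _ ih₁ ih₂ => exact .mul (ih₁ hf) (ih₂ hf)
  | ceil _ ih => exact .ceil (ih hf)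
  | floor _ ih => exact .floor (ih hf)
  | log _ ih => exact .log (ih hf)
  | pow _ _ ih₁ ih₂ => exact .pow (ih₁ hf) (ih₂ hf)
  | min _ _ ih₁ ih₂ => exact .min (ih₁ hf) (ih₂ hf)
  | max _ _ ih₁ ih₂ => exact .max (ih₁ hf) (ih₂ hf)
  | sum _ _ _ ih₁ ih₂ ih₃ =>
    refine .sum (ih₁ hf) (ih₂ hf) (ih₃ fun n S hn => ?_)
    cases n with
    | zero => exact hn
    | succ n => exact hf n S hn
  | subsort _ ih => exact .subsort (ih hf)

/-- For empty `ψ` this shows that a term sorted over `Δ` alone, such as the witness of an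
existential, contains no existential variable. -/
theorem HasSort.scoped {Δ : UEnv} {ψ : EEnv} {I : Idx} {S : ISort} (h : HasSort Δ ψ I S) :
    I.Scoped Δ.length ψ.dom := by
  induction h with
  | var h => exact (List.getElem?_eq_some_iff.1 h).1
  | evar h => exact List.mem_map.2 ⟨_, h, rfl⟩
  | cst | zero | infty => trivial
  | succ _ ih | ceil _ ih | floor _ ih | log _ ih | subsort _ ih => exact ih
  | sum _ _ _ ih₁ ih₂ ih₃ => exact ⟨ih₁, ih₂, ih₃⟩
  | _ => rename_i ih₁ ih₂; exact ⟨ih₁, ih₂⟩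

/-- A substitution respects the sorts of two scopes. -/
def ISubst.Sorted (s : ISubst) (Δ : UEnv) (ψ : EEnv) (Δ' : UEnv) (ψ' : EEnv) : Prop :=
  (∀ n S, Δ[n]? = some S → HasSort Δ' ψ' (s.u n) S) ∧
    ∀ a S, (a, S) ∈ ψ → HasSort Δ' ψ' (s.e a) S

theorem ISubst.Sorted.lift {s : ISubst} {Δ Δ' : UEnv} {ψ ψ' : EEnv} (h : s.Sorted Δ ψ Δ' ψ')
    (S : ISort) : s.lift.Sorted (S :: Δ) ψ (S :: Δ') ψ' := by
  refine ⟨fun n S' hn => ?_, fun a S' ha => (h.2 a S' ha).rename fun n S hn => hn⟩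
  cases n with
  | zero => exact .var hn
  | succ n => exact (h.1 n S' hn).rename fun n S hn => hn

theorem HasSort.subst {Δ Δ' : UEnv} {ψ ψ' : EEnv} {I : Idx} {S : ISort} {s : ISubst}
    (h : HasSort Δ ψ I S) (hs : s.Sorted Δ ψ Δ' ψ') : HasSort Δ' ψ' (I.subst s) S := by
  induction h generalizing Δ' s with
  | var h => exact hs.1 _ _ h
  | evar h => exact hs.2 _ _ h
  | cst => exact .cst
  | zero => exact .zero
  | infty => exact .infty
  | succ _ ih => exact .succ (ih hs)
  | add _ _ ih₁ ih₂ => exact .add (ih₁ hs) (ih₂ hs)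
  | sub _ _ ih₁ ih₂ => exact .sub (ih₁ hs) (ih₂ hs)
  | div _ _ ih₁ ih₂ => exact .div (ih₁ hs) (ih₂ hs)
  | mul _ _ ih₁ ih₂ => exact .mul (ih₁ hs) (ih₂ hs)
  | ceil _ ih => exact .ceil (ih hs)
  | floor _ ih => exact .floor (ih hs)
  | log _ ih => exact .log (ih hs)
  | pow _ _ ih₁ ih₂ => exact .pow (ih₁ hs) (ih₂ hs)
  | min _ _ ih₁ ih₂ => exact .min (ih₁ hs) (ih₂ hs)
  | max _ _ ih₁ ih₂ => exact .max (ih₁ hs) (ih₂ hs)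
  | sum _ _ _ ih₁ ih₂ ih₃ => exact .sum (ih₁ hs) (ih₂ hs) (ih₃ (hs.lift _))
  | subsort _ ih => exact .subsort (ih hs)

theorem Constr.Wf.scoped {Δ : UEnv} {ψ : EEnv} {C : Constr} (h : C.Wf Δ ψ) :
    C.Scoped Δ.length ψ.dom := by
  induction C with
  | eq I J | lt I J => exact ⟨h.1.scoped, h.2.scoped⟩
  | neg C ih => exact ih h

section WfSubst

variable {Δ Δ' : UEnv} {ψ ψ' : EEnv} {s : ISubst}

theorem Constr.Wf.subst {C : Constr} (h : C.Wf Δ ψ) (hs : s.Sorted Δ ψ Δ' ψ') :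
    (C.subst s).Wf Δ' ψ' := by
  induction C with
  | eq I J | lt I J => exact ⟨h.1.subst hs, h.2.subst hs⟩
  | neg C ih => exact ih h

theorem UTy.Wf.subst {A : UTy} (h : A.Wf Δ ψ) (hs : s.Sorted Δ ψ Δ' ψ') :
    (A.subst s).Wf Δ' ψ' := by
  induction A generalizing Δ Δ' s with
  | unit | int => trivial
  | prod A B ih₁ ih₂ | sum A B ih₁ ih₂ => exact ⟨ih₁ h.1 hs, ih₂ h.2 hs⟩
  | arr A k t B ih₁ ih₂ =>
    exact ⟨ih₁ h.1 hs, ih₂ h.2.1 hs, h.2.2.1.subst hs, h.2.2.2.subst hs⟩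
  | list n A ih => exact ⟨h.1.subst hs, ih h.2 hs⟩
  | all S k t A ih =>
    exact ⟨ih h.1 (hs.lift S), h.2.1.subst (hs.lift S), h.2.2.subst (hs.lift S)⟩
  | ex S A ih => exact ih (Δ := S :: Δ) h (hs.lift S)
  | cand C A ih | cimp C A ih => exact ⟨h.1.subst hs, ih h.2 hs⟩

theorem RTy.Wf.subst {τ : RTy} (h : τ.Wf Δ ψ) (hs : s.Sorted Δ ψ Δ' ψ') :
    (τ.subst s).Wf Δ' ψ' := by
  induction τ generalizing Δ Δ' s with
  | unit | int => trivial
  | prod A B ih₁ ih₂ | sum A B ih₁ ih₂ => exact ⟨ih₁ h.1 hs, ih₂ h.2 hs⟩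
  | arr A t B ih₁ ih₂ => exact ⟨ih₁ h.1 hs, ih₂ h.2.1 hs, h.2.2.subst hs⟩
  | list n α A ih => exact ⟨h.1.subst hs, h.2.1.subst hs, ih h.2.2 hs⟩
  | all S t A ih => exact ⟨ih h.1 (hs.lift S), h.2.subst (hs.lift S)⟩
  | ex S A ih => exact ih (Δ := S :: Δ) h (hs.lift S)
  | U A B => exact ⟨h.1.subst hs, h.2.subst hs⟩
  | box A ih => exact ih (Δ := Δ) h hs
  | cand C A ih | cimp C A ih => exact ⟨h.1.subst hs, ih h.2 hs⟩

end WfSubst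

/-! Evaluation. -/

theorem Idx.eval_rename (c : CostModel) (I : Idx) (f : ℕ → ℕ) (ρ η : ℕ → EReal) :
    (I.rename f).eval c ρ η = I.eval c (fun n => ρ (f n)) η := by
  induction I generalizing f ρ with
  | sum I J K ihI ihJ ihK =>
    simp only [Idx.rename, Idx.eval, ihI, ihJ, ihK]
    refine Finset.sum_congr rfl fun j _ => ?_
    congr 1; funext n; cases n <;> rfl
  | _ => simp_all [Idx.rename, Idx.eval]

/-- Substitution corresponds to changing the valuation. Under a sum the lifted substitution is
evaluated in a valuation extended by the summation index, and the weakening it contains discards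
exactly that entry. -/
theorem Idx.eval_subst (c : CostModel) (I : Idx) (s : ISubst) (ρ η : ℕ → EReal) :
    (I.subst s).eval c ρ η =
      I.eval c (fun n => (s.u n).eval c ρ η) (fun a => (s.e a).eval c ρ η) := by
  induction I generalizing s ρ with
  | sum I J K ihI ihJ ihK =>
    simp only [Idx.subst, Idx.eval, ihI, ihJ, ihK]
    refine Finset.sum_congr rfl fun j _ => ?_
    congr 1
    · funext n
      cases n with
      | zero => rfl
      | succ n => simp only [ISubst.lift, Idx.eval_rename]; rfl
    · funext a; simp only [ISubst.lift, Idx.eval_rename]; rfl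
  | _ => simp_all [Idx.subst, Idx.eval]

theorem Constr.holds_subst (c : CostModel) (C : Constr) (s : ISubst) (ρ η : ℕ → EReal) :
    (C.subst s).Holds c ρ η ↔
      C.Holds c (fun n => (s.u n).eval c ρ η) (fun a => (s.e a).eval c ρ η) := by
  induction C with
  | eq I J | lt I J => simp only [Constr.subst, Constr.Holds, Idx.eval_subst]
  | neg C ih => simp only [Constr.subst, Constr.Holds, ih]

/-- With natural arguments only two branches of `epow` are reachable: exponent `0`, with value `1`,
and the real power. -/
theorem epow_natCast (m n : ℕ) : epow m n = ((m ^ n : ℕ) : EReal) := by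
  unfold epow
  have hr : ((m : EReal).toReal ^ (n : EReal).toReal : ℝ) = ((m ^ n : ℕ) : ℝ) := by
    have h1 : ∀ k : ℕ, (k : EReal).toReal = k := fun k => EReal.toReal_coe k
    rw [h1, h1, Real.rpow_natCast]; push_cast; rfl
  rcases Nat.eq_zero_or_pos n with rfl | hn
  · simp
  · rw [if_neg (by exact_mod_cast hn.ne'), if_neg (EReal.natCast_ne_top m),
      if_neg (EReal.natCast_ne_top n), if_neg (EReal.natCast_ne_bot n),
      if_neg (EReal.natCast_ne_bot m), hr]
    rfl

/-- The real carrier is everything, so the content lies in sort `ℕ`: ceiling and floor take natural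
values by definition, and the naturals are closed under the remaining operations of that sort. This
makes the values of a well-sorted substitution an admissible valuation. -/
theorem HasSort.eval_mem {c : CostModel} {Δ : UEnv} {ψ : EEnv} {I : Idx} {S : ISort}
    (h : HasSort Δ ψ I S) {ρ η : ℕ → EReal} (hρ : ∀ n S, Δ[n]? = some S → ρ n ∈ S.carrier)
    (hη : ∀ a S, (a, S) ∈ ψ → η a ∈ S.carrier) : I.eval c ρ η ∈ S.carrier := by
  induction h generalizing ρ with
  | var h => exact hρ _ _ h
  | evar h => exact hη _ _ h
  | cst | infty | sub | div | log | subsort => trivial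
  | zero => exact ⟨0, by simp [Idx.eval]⟩
  | ceil | floor => exact ⟨_, rfl⟩
  | @succ _ _ _ S _ ih =>
    cases S with
    | real => trivial
    | nat => obtain ⟨m, hm⟩ := ih hρ hη; exact ⟨m + 1, by simp [Idx.eval, ← hm]⟩
  | @add _ _ _ _ S _ _ ih₁ ih₂ =>
    cases S with
    | real => trivial
    | nat =>
      obtain ⟨m, hm⟩ := ih₁ hρ hη; obtain ⟨n, hn⟩ := ih₂ hρ hη
      exact ⟨m + n, by simp [Idx.eval, ← hm, ← hn]⟩
  | @mul _ _ _ _ S _ _ ih₁ ih₂ =>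
    cases S with
    | real => trivial
    | nat =>
      obtain ⟨m, hm⟩ := ih₁ hρ hη; obtain ⟨n, hn⟩ := ih₂ hρ hη
      exact ⟨m * n, by simp [Idx.eval, ← hm, ← hn, EReal.natCast_mul]⟩
  | @pow _ _ _ _ S _ _ ih₁ ih₂ =>
    cases S with
    | real => trivial
    | nat =>
      obtain ⟨m, hm⟩ := ih₁ hρ hη; obtain ⟨n, hn⟩ := ih₂ hρ hη
      exact ⟨m ^ n, by simp only [Idx.eval, ← hm, ← hn, epow_natCast]⟩
  | min _ _ ih₁ ih₂ =>
    simp only [Idx.eval]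
    rcases min_choice (Idx.eval c _ ρ η) (Idx.eval c _ ρ η) with h | h <;> rw [h]
    exacts [ih₁ hρ hη, ih₂ hρ hη]
  | max _ _ ih₁ ih₂ =>
    simp only [Idx.eval]
    rcases max_choice (Idx.eval c _ ρ η) (Idx.eval c _ ρ η) with h | h <;> rw [h]
    exacts [ih₁ hρ hη, ih₂ hρ hη]
  | @sum _ _ _ _ _ S _ _ _ _ _ ih =>
    cases S with
    | real => trivial
    | nat =>
      simp only [Idx.eval]
      -- Closure under addition, with `0` for the empty sum; the summation index is itself a natural
      -- number, so the extended valuation is again well-sorted.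
      refine Finset.sum_induction _ (· ∈ ISort.nat.carrier) ?_ ⟨0, by simp⟩ fun j _ => ?_
      · rintro _ _ ⟨m, rfl⟩ ⟨n, rfl⟩; exact ⟨m + n, by simp⟩
      · refine ih (fun n S hn => ?_) hη
        cases n with
        | zero => cases hn; exact ⟨j, rfl⟩
        | succ n => exact hρ n S hn

-- Domains and freshness of existential environments.

@[simp] theorem EEnv.dom_append (ψ ψ' : EEnv) : EEnv.dom (ψ ++ ψ') = ψ.dom ++ ψ'.dom :=
  List.map_append

@[simp] theorem EEnv.dom_nil : EEnv.dom [] = [] := rfl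

@[simp] theorem EEnv.dom_cons (p : ℕ × ISort) (ψ : EEnv) :
    EEnv.dom (p :: ψ) = p.1 :: ψ.dom := rfl

@[simp] theorem reals_dom (l : List ℕ) : (reals l).dom = l := by
  simp [reals, EEnv.dom, Function.comp_def]

/-- The variables of `ψ` are pairwise distinct and not bound in `ψa`. -/
def EEnv.FreshFor (ψ ψa : EEnv) : Prop := Fresh ψ.dom ψa

theorem Fresh.reals {l : List ℕ} {ψa : EEnv} (h : Fresh l ψa) : (reals l).FreshFor ψa := by
  simpa [EEnv.FreshFor] using h

theorem EEnv.FreshFor.append {ψ ψ' ψa : EEnv} (h : ψ.FreshFor (ψ' ++ ψa))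
    (h' : ψ'.FreshFor ψa) : EEnv.FreshFor (ψ ++ ψ') ψa := by
  simp only [EEnv.FreshFor, Fresh, EEnv.dom_append, List.mem_append, not_or] at h h' ⊢
  refine ⟨List.nodup_append.2 ⟨h.1, h'.1, ?_⟩, ?_⟩
  · rintro a ha _ hb rfl
    exact (h.2 a ha).1 hb
  · rintro a (ha | ha)
    exacts [(h.2 a ha).2, h'.2 a ha]

/-! Substitutions for existential variables, and proofs of generated constraints. -/

/-- `θ` maps every existential variable to itself or to a term without existential variables. -/
def Clean (θ : ℕ → Idx) : Prop := ∀ a, θ a = .evar a ∨ ∃ d, (θ a).Scoped d []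

/-- `θ` is well-sorted on `ψ` and clean everywhere. -/
def SubstWf (Δ : UEnv) (θ : ℕ → Idx) (ψ : EEnv) : Prop :=
  (∀ a S, (a, S) ∈ ψ → HasSort Δ [] (θ a) S) ∧ Clean θ

/-- A term sorted over `Δ` alone has no existential variables, and outside `ψ` the substitution is
the identity; so every value is of one of the two clean forms. -/
theorem SubstOk.substWf {Δ : UEnv} {θ : ℕ → Idx} {ψ : EEnv} (h : SubstOk Δ θ ψ) :
    SubstWf Δ θ ψ := by
  refine ⟨h.1, fun a => ?_⟩
  by_cases ha : a ∈ ψ.dom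
  · obtain ⟨⟨_, S⟩, hS, rfl⟩ := List.mem_map.1 ha
    exact .inr ⟨_, (h.1 _ S hS).scoped⟩
  · exact .inl (h.2 a ha)

/-- This is why `SubstWf` replaces `SubstOk` in the induction: the latter requires the identity
outside its environment and would fail for a smaller one. Premises that do not see each other's
existential variables need such restrictions. -/
theorem SubstWf.mono {Δ : UEnv} {θ : ℕ → Idx} {ψ ψ' : EEnv} (h : SubstWf Δ θ ψ)
    (hψ : ψ' ⊆ ψ) : SubstWf Δ θ ψ' :=
  ⟨fun a S ha => h.1 a S (hψ ha), h.2⟩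

theorem SubstWf.up {Δ : UEnv} {θ : ℕ → Idx} {ψ : EEnv} (h : SubstWf Δ θ ψ) (S : ISort) :
    SubstWf (S :: Δ) (up θ) ψ := by
  refine ⟨fun a S' ha => (h.1 a S' ha).rename fun n S hn => hn, fun a => ?_⟩
  rcases h.2 a with ha | ⟨d, hd⟩
  · exact .inl (by simp [BiRelCost.up, ha, Idx.rename])
  · exact .inr ⟨d + 1, hd.rename fun n hn => Nat.succ_lt_succ hn⟩

theorem SubstWf.sorted {Δ : UEnv} {θ : ℕ → Idx} {ψ : EEnv} (h : SubstWf Δ θ ψ) :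
    (ISubst.ofE θ).Sorted Δ ψ Δ [] :=
  ⟨fun _ _ hn => .var hn, h.1⟩

theorem ISubst.shift_comp_up (θ : ℕ → Idx) :
    ISubst.shift.comp (.ofE (up θ)) = (ISubst.ofE θ).comp .shift := by
  rw [← ISubst.ofE_lift, ISubst.shift_comp_lift]

theorem ISubst.keep_ofE (θ : ℕ → Idx) (a : ℕ) :
    (ISubst.ofE θ).keep a = .ofE (Function.update θ a (.evar a)) := rfl

theorem ISubst.comp_ofE (θ θ' : ℕ → Idx) :
    (ISubst.ofE θ).comp (.ofE θ') = .ofE (fun a => (θ a).subst (.ofE θ')) := rfl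

theorem Clean.update {θ : ℕ → Idx} (h : Clean θ) (a : ℕ) {I : Idx}
    (hI : I = .evar a ∨ ∃ d, I.Scoped d []) : Clean (Function.update θ a I) := by
  intro b
  by_cases hb : b = a
  · subst hb; simpa using hI
  · simpa [hb] using h b

theorem Clean.up {θ : ℕ → Idx} (h : Clean θ) : Clean (up θ) := by
  intro a
  rcases h a with ha | ⟨d, hd⟩
  · exact .inl (by simp [BiRelCost.up, ha, Idx.rename])
  · exact .inr ⟨d + 1, hd.rename fun n hn => Nat.succ_lt_succ hn⟩

/-- Substitution does not rename the bound names of `∃`, so fusion fails in general: a value of `θ`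
mentioning a bound name would be captured. Cleanness excludes this, since away from the bound name a
value is either the variable itself or free of existential variables. -/
theorem CForm.subst_subst (Φ : CForm) {θ : ℕ → Idx} (hθ : Clean θ) (θ' : ℕ → Idx) :
    (Φ.subst (.ofE θ)).subst (.ofE θ') = Φ.subst (.ofE (fun a => (θ a).subst (.ofE θ'))) := by
  induction Φ generalizing θ θ' with
  | top => rfl
  | atom C => simp only [CForm.subst, Constr.subst_subst, ISubst.comp_ofE]
  | and Φ Ψ ih₁ ih₂ => simp only [CForm.subst, ih₁ hθ, ih₂ hθ]
  | imp C Φ ih => simp only [CForm.subst, ih hθ, Constr.subst_subst, ISubst.comp_ofE]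
  | all S Φ ih =>
    simp only [CForm.subst, ISubst.ofE_lift, ih hθ.up]
    congr 3
    funext a
    simp only [up, Idx.rename_succ, Idx.subst_subst]
    rw [← ISubst.shift_comp_up]
  | ex a S Φ ih =>
    simp only [CForm.subst, ISubst.keep_ofE, ih (hθ.update a (.inl rfl))]
    congr 3
    funext b
    by_cases hb : b = a
    · subst hb; simp [Idx.subst, ISubst.ofE]
    · simp only [Function.update_of_ne hb]
      rcases hθ b with h | ⟨d, hd⟩
      · simp [h, Idx.subst, ISubst.ofE, hb]
      · exact Idx.subst_congr hd ⟨fun _ _ => rfl, by simp⟩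

-- Inversion of provability.

namespace Prov

variable {c : CostModel} {Δ : UEnv} {Φa : CEnv} {s : ISubst}

theorem and_inv {Φ Ψ : CForm} (h : Prov c Δ Φa ((CForm.and Φ Ψ).subst s)) :
    Prov c Δ Φa (Φ.subst s) ∧ Prov c Δ Φa (Ψ.subst s) := by
  cases h with | and h₁ h₂ => exact ⟨h₁, h₂⟩

theorem atom_inv {C : Constr} (h : Prov c Δ Φa ((CForm.atom C).subst s)) :
    Entails c Δ [] Φa (C.subst s) := by
  cases h with | atom h => exact h

theorem eq_inv {I J : Idx} (h : Prov c Δ Φa ((CForm.eq I J).subst s)) :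
    Entails c Δ [] Φa (.eq (I.subst s) (J.subst s)) := atom_inv h

theorem le_inv {I J : Idx} (h : Prov c Δ Φa ((CForm.le I J).subst s)) :
    Entails c Δ [] Φa (.le (I.subst s) (J.subst s)) := atom_inv h

theorem imp_inv {C : Constr} {Φ : CForm} (h : Prov c Δ Φa ((CForm.imp C Φ).subst s)) :
    Prov c Δ (C.subst s :: Φa) (Φ.subst s) := by
  cases h with | imp h => exact h

theorem all_inv {S : ISort} {Φ : CForm} (h : Prov c Δ Φa ((CForm.all S Φ).subst s)) :
    Prov c (S :: Δ) (Φa.subst .shift) (Φ.subst s.lift) := by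
  cases h with | all h => exact h

/-- The terms proving the quantifiers are collected into one extension of `θ`. Distinctness of the
names keeps a later witness from overwriting an earlier one; their freshness for `ψa` keeps `θ`
unchanged on old variables. -/
theorem exs_inv {ψ ψa : EEnv} {θ : ℕ → Idx} {Φ : CForm}
    (h : Prov c Δ Φa ((CForm.exs ψ Φ).subst (.ofE θ))) (hθ : SubstWf Δ θ ψa)
    (hψ : ψ.FreshFor ψa) :
    ∃ θ', SubstWf Δ θ' (ψ ++ ψa) ∧ (∀ a ∈ ψa.dom, θ a = θ' a) ∧
      Prov c Δ Φa (Φ.subst (.ofE θ')) := by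
  -- The form proved by induction on `ψ` does not mention `ψa` and records agreement everywhere
  -- outside `ψ`, which is what the recursion can pass on.
  suffices H : ∃ θ', (∀ a S, (a, S) ∈ ψ → HasSort Δ [] (θ' a) S) ∧ Clean θ' ∧
      (∀ a, a ∉ ψ.dom → θ a = θ' a) ∧ Prov c Δ Φa (Φ.subst (.ofE θ')) by
    obtain ⟨θ', h₁, h₂, h₃, h₄⟩ := H
    have h₅ : ∀ a ∈ ψa.dom, θ a = θ' a := fun a ha => h₃ a fun h' => hψ.2 a h' ha
    refine ⟨θ', ⟨fun a S ha => ?_, h₂⟩, h₅, h₄⟩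
    rcases List.mem_append.1 ha with ha | ha
    · exact h₁ a S ha
    · rw [← h₅ a (List.mem_map.2 ⟨_, ha, rfl⟩)]; exact hθ.1 a S ha
  have hc := hθ.2
  have hn : ψ.dom.Nodup := hψ.1
  clear hθ hψ
  induction ψ generalizing θ with
  | nil => exact ⟨θ, by simp, hc, fun _ _ => rfl, h⟩
  | cons p ψ ih =>
    obtain ⟨a, S⟩ := p
    rw [EEnv.dom_cons, List.nodup_cons] at hn
    cases h with
    | ex I hI h =>
      rw [ISubst.keep_ofE, ISubst.single, CForm.subst_subst _ (hc.update a (.inl rfl))] at h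
      -- Sparing `a` first and then replacing it by the witness amounts to one update of `θ`,
      -- because the other values of `θ` either are other variables or have no existential variables
      -- in which `a` could occur.
      have hE : (fun b => (Function.update θ a (Idx.evar a) b).subst
          (.ofE (Function.update Idx.evar a I))) = Function.update θ a I := by
        funext b
        by_cases hb : b = a
        · subst hb; simp [Idx.subst, ISubst.ofE]
        · simp only [Function.update_of_ne hb]
          rcases hc b with h' | ⟨d, hd⟩
          · simp [h', Idx.subst, ISubst.ofE, hb]
          · exact hd.subst_ofE_of_nil _
      rw [hE] at h
      obtain ⟨θ', h₁, h₂, h₃, h₄⟩ := ih h (hc.update a (.inr ⟨_, hI.scoped⟩)) hn.2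
      refine ⟨θ', fun b S' hb => ?_, h₂, fun b hb => ?_, h₄⟩
      · rcases List.mem_cons.1 hb with hb | hb
        · cases hb
          -- By distinctness `a` is not in the rest of `ψ`, so the final substitution still has the
          -- witness `I` at `a`.
          rw [← h₃ a hn.1]; simpa using hI
        · exact h₁ b S' hb
      · simp only [EEnv.dom_cons, List.mem_cons, not_or] at hb
        rw [← h₃ b hb.2, Function.update_of_ne hb.1]

end Prov

/-- A valuation of `Δ` yields one of `ψ` by evaluating `θ`; it respects the sorts by
`HasSort.eval_mem`, and the original entailment is applied to it. It serves the `contra` rules. -/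
theorem Entails.subst_ofE {c : CostModel} {Δ : UEnv} {ψ : EEnv} {Φa : CEnv} {C : Constr}
    {θ : ℕ → Idx} (h : Entails c Δ ψ Φa C) (hθ : SubstWf Δ θ ψ) :
    Entails c Δ [] (Φa.subst (.ofE θ)) (C.subst (.ofE θ)) := by
  intro ρ η hρ hη hΦ
  rw [Constr.holds_subst]
  refine h ρ _ hρ (fun a S ha => (hθ.1 a S ha).eval_mem hρ (by simp)) fun D hD => ?_
  exact (Constr.holds_subst c D (.ofE θ) ρ η).1 (hΦ _ (List.mem_map.2 ⟨D, hD, rfl⟩))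

-- Entailed equations and inequalities between index terms.

section Entailment

variable {c : CostModel} {Δ : UEnv} {ψ : EEnv} {Φa : CEnv}

theorem Entails.le_of_eval {I J : Idx}
    (h : ∀ ρ η : ℕ → EReal, (∀ D ∈ Φa, D.Holds c ρ η) →
      (∀ n S, Δ[n]? = some S → ρ n ∈ S.carrier) →
      (∀ a S, (a, S) ∈ ψ → η a ∈ S.carrier) → I.eval c ρ η ≤ J.eval c ρ η) :
    Entails c Δ ψ Φa (.le I J) :=
  fun ρ η hρ hη hΦ => not_lt.2 (h ρ η hΦ hρ hη)

theorem Entails.le_refl (I : Idx) : Entails c Δ ψ Φa (.le I I) :=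
  Entails.le_of_eval fun _ _ _ _ _ => _root_.le_rfl

theorem Entails.eq_refl (I : Idx) : Entails c Δ ψ Φa (.eq I I) := fun _ _ _ _ _ => rfl

theorem Entails.eq_symm {I J : Idx} (h : Entails c Δ ψ Φa (.eq I J)) :
    Entails c Δ ψ Φa (.eq J I) := fun ρ η hρ hη hΦ => Eq.symm (h ρ η hρ hη hΦ)

theorem Entails.le_of_eq {I J : Idx} (h : Entails c Δ ψ Φa (.eq I J)) :
    Entails c Δ ψ Φa (.le I J) :=
  Entails.le_of_eval fun ρ η hΦ hρ hη => _root_.le_of_eq (h ρ η hρ hη hΦ)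

theorem Entails.le_of_eq_of_le {I J K : Idx} (h : Entails c Δ ψ Φa (.eq J K))
    (h' : ∀ ρ η, I.eval c ρ η ≤ J.eval c ρ η) : Entails c Δ ψ Φa (.le I K) :=
  Entails.le_of_eval fun ρ η hΦ hρ hη =>
    (h' ρ η).trans (_root_.le_of_eq (h ρ η hρ hη hΦ))

theorem Entails.self_cons (C : Constr) : Entails c Δ ψ (C :: Φa) C :=
  fun _ _ _ _ h => h C List.mem_cons_self

end Entailment

/-! Soundness of algorithmic subtyping and equivalence. -/

/-- Relational equivalence has no reflexivity rule, yet subsumption on the cost alone requires a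
derivation of it. -/
theorem EqR.refl {c : CostModel} {Δ : UEnv} {Φa : CEnv} (τ : RTy) : EqR c Δ Φa τ τ := by
  induction τ generalizing Δ Φa with
  | unit => exact .unit
  | int => exact .int
  | prod _ _ ih₁ ih₂ => exact .prod ih₁ ih₂
  | sum _ _ ih₁ ih₂ => exact .sum ih₁ ih₂
  | arr _ t _ ih₁ ih₂ => exact .arr ih₁ ih₂ (.eq_refl t)
  | list n α _ ih => exact .list ih (.eq_refl n) (.eq_refl α)
  | all S t _ ih => exact .all ih (.eq_refl t)
  | ex S _ ih => exact .ex ih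
  | U A B => exact .U .refl .refl .refl .refl
  | box _ ih => exact .box ih
  | cand C _ ih => exact .cand (.self_cons C) (.self_cons C) ih
  | cimp C _ ih => exact .cimp (.self_cons C) (.self_cons C) ih

/-- The algorithmic rules never consult their assumptions: all conditions go into `Φ`. Hence neither
scoping nor any relation between `Φa` and `Φb` is needed, and the substitution is arbitrary, which
lets the induction pass under binders. -/
theorem AlgSubU.sound {c : CostModel} {Δ : UEnv} {ψ : EEnv} {Φa : CEnv} {A A' : UTy} {Φ : CForm}
    (h : AlgSubU Δ ψ Φa A A' Φ) {s : ISubst} {Φb : CEnv} (hΦ : Prov c Δ Φb (Φ.subst s)) :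
    SubU c Δ Φb (A.subst s) (A'.subst s) := by
  induction h generalizing s Φb with
  | int | unit | refl => exact .refl
  | arr _ _ ih₁ ih₂ =>
    obtain ⟨h₁, h⟩ := hΦ.and_inv
    obtain ⟨h₂, h⟩ := h.and_inv
    exact .arr (ih₁ h₁) (ih₂ h₂) h.and_inv.1.le_inv h.and_inv.2.le_inv
  | all _ ih =>
    obtain ⟨h₁, h⟩ := hΦ.all_inv.and_inv
    exact .all (ih h₁) h.and_inv.1.le_inv h.and_inv.2.le_inv
  | prod _ _ ih₁ ih₂ => exact .prod (ih₁ hΦ.and_inv.1) (ih₂ hΦ.and_inv.2)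
  | sum _ _ ih₁ ih₂ => exact .sum (ih₁ hΦ.and_inv.1) (ih₂ hΦ.and_inv.2)
  | list _ ih => exact .list hΦ.and_inv.1.eq_inv (ih hΦ.and_inv.2)
  | ex _ ih => exact .ex (ih hΦ.all_inv)
  | cimp _ ih => exact .cimp hΦ.and_inv.1.imp_inv.atom_inv (ih hΦ.and_inv.2)
  | cand _ ih => exact .cand hΦ.and_inv.1.imp_inv.atom_inv (ih hΦ.and_inv.2)

theorem AlgEqR.sound {c : CostModel} {Δ : UEnv} {ψ : EEnv} {Φa : CEnv} {τ τ' : RTy} {Φ : CForm}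
    (h : AlgEqR Δ ψ Φa τ τ' Φ) {s : ISubst} {Φb : CEnv} (hΦ : Prov c Δ Φb (Φ.subst s)) :
    EqR c Δ Φb (τ.subst s) (τ'.subst s) := by
  induction h generalizing s Φb with
  | int => exact .int
  | unit => exact .unit
  | arr _ _ ih₁ ih₂ =>
    obtain ⟨h₁, h⟩ := hΦ.and_inv
    exact .arr (ih₁ h₁) (ih₂ h.and_inv.1) h.and_inv.2.eq_inv
  | all _ ih => exact .all (ih hΦ.all_inv.and_inv.1) hΦ.all_inv.and_inv.2.eq_inv
  | prod _ _ ih₁ ih₂ => exact .prod (ih₁ hΦ.and_inv.1) (ih₂ hΦ.and_inv.2)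
  | sum _ _ ih₁ ih₂ => exact .sum (ih₁ hΦ.and_inv.1) (ih₂ hΦ.and_inv.2)
  | list _ ih =>
    obtain ⟨h₁, h⟩ := hΦ.and_inv
    exact .list (ih h₁) h.and_inv.1.eq_inv h.and_inv.2.eq_inv
  | ex _ ih => exact .ex (ih hΦ.all_inv)
  | box _ ih => exact .box (ih hΦ)
  | U h₁ h₂ h₃ h₄ =>
    obtain ⟨h, h'⟩ := hΦ.and_inv
    exact .U (h₁.sound h.and_inv.1) (h₂.sound h.and_inv.2) (h₃.sound h'.and_inv.1)
      (h₄.sound h'.and_inv.2)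
  | cimp _ ih =>
    obtain ⟨h, h'⟩ := hΦ.and_inv
    exact .cimp h.and_inv.1.imp_inv.atom_inv h.and_inv.2.imp_inv.atom_inv (ih h')
  | cand _ ih =>
    obtain ⟨h, h'⟩ := hΦ.and_inv
    exact .cand h.and_inv.1.imp_inv.atom_inv h.and_inv.2.imp_inv.atom_inv (ih h')

/-! Scoping and freshness of the results of inference. -/

theorem EEnv.dom_subset_append (ψ ψ' ψa : EEnv) :
    EEnv.dom (ψ' ++ ψa) ⊆ EEnv.dom (ψ ++ ψ' ++ ψa) := by
  simp

theorem EEnv.freshFor_nil (ψa : EEnv) : EEnv.FreshFor [] ψa := ⟨List.nodup_nil, by simp⟩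

/-- New names arise only in the two application rules, each of which chooses them away from the
names already generated or in scope. -/
theorem InfU.fresh {c : CostModel} {Υ : PrimEnv} :
    ∀ {Δ : UEnv} {ψa : EEnv} {Φa : CEnv} {Ω : UCtx} {e : Expr} {A : UTy} {ψ : EEnv} {k t : Idx}
      {Φ : CForm}, InfU c Υ Δ ψa Φa Ω e A ψ k t Φ → ψ.FreshFor ψa
  | _, _, _, _, _, _, _, _, _, _, .num | _, _, _, _, _, _, _, _, _, _, .unit
  | _, _, _, _, _, _, _, _, _, _, .var _ | _, _, _, _, _, _, _, _, _, _, .anno .. =>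
    EEnv.freshFor_nil _
  | _, _, _, _, _, _, _, _, _, _, .fst h | _, _, _, _, _, _, _, _, _, _, .snd h
  | _, _, _, _, _, _, _, _, _, _, .iApp h _ | _, _, _, _, _, _, _, _, _, _, .cimpE h => h.fresh
  | _, _, _, _, _, _, _, _, _, _, .app h hf _ => hf.reals.append h.fresh
  | _, _, _, _, _, _, _, _, _, _, .prim _ hf _ => hf.reals

/-- Inferred types are parts or instances of types found in the context, in the primitive
environment or in annotations; inferred costs add the latent costs of such types and fresh
variables. Applied when the substitution is later enlarged, to see that these results do not change.
-/
theorem InfU.scoped {c : CostModel} {Υ : PrimEnv} (hΥ : Υ.Closed) :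
    ∀ {Δ : UEnv} {ψa : EEnv} {Φa : CEnv} {Ω : UCtx} {e : Expr} {A : UTy} {ψ : EEnv} {k t : Idx}
      {Φ : CForm}, InfU c Υ Δ ψa Φa Ω e A ψ k t Φ → Ω.Scoped Δ.length ψa.dom →
      A.Scoped Δ.length (ψ ++ ψa).dom ∧ k.Scoped Δ.length (ψ ++ ψa).dom ∧
        t.Scoped Δ.length (ψ ++ ψa).dom
  | _, _, _, _, _, _, _, _, _, _, .num => by
    intro hΩ
    exact ⟨trivial, trivial, trivial⟩
  | _, _, _, _, _, _, _, _, _, _, .unit => by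
    intro hΩ
    exact ⟨trivial, trivial, trivial⟩
  | _, _, _, _, _, _, _, _, _, _, .var hx => by
    intro hΩ
    exact ⟨hΩ _ _ hx, trivial, trivial⟩
  | _, _, _, _, _, _, _, _, _, _, .fst h => by
    intro hΩ
    obtain ⟨hA, hk, ht⟩ := h.scoped hΥ hΩ
    exact ⟨hA.1, ⟨hk, trivial⟩, ⟨ht, trivial⟩⟩
  | _, _, _, _, _, _, _, _, _, _, .snd h => by
    intro hΩ
    obtain ⟨hA, hk, ht⟩ := h.scoped hΥ hΩ
    exact ⟨hA.2, ⟨hk, trivial⟩, ⟨ht, trivial⟩⟩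
  | _, _, _, _, _, _, _, _, _, _, .app h hf _ => by
    intro hΩ
    obtain ⟨⟨_, hke, hte, hB⟩, hk, ht⟩ := h.scoped hΥ hΩ
    have hE := EEnv.dom_subset_append
    refine ⟨hB.mono le_rfl (hE _ _ _),
      ⟨⟨⟨hk.mono le_rfl (hE _ _ _), ?_⟩, hke.mono le_rfl (hE _ _ _)⟩, trivial⟩,
      ⟨⟨⟨ht.mono le_rfl (hE _ _ _), ?_⟩, hte.mono le_rfl (hE _ _ _)⟩, trivial⟩⟩ <;>
      simp [Idx.Scoped]
  | _, _, _, _, _, _, _, _, _, _, .prim hζ hf _ => by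
    intro hΩ
    obtain ⟨_, hk, ht, hB⟩ := hΥ.1 _ _ _ _ _ hζ
    refine ⟨hB.mono (Nat.zero_le _) (by simp),
      ⟨⟨?_, hk.mono (Nat.zero_le _) (by simp)⟩, trivial⟩,
      ⟨⟨?_, ht.mono (Nat.zero_le _) (by simp)⟩, trivial⟩⟩ <;> simp [Idx.Scoped]
  | _, _, _, _, _, _, _, _, _, _, .iApp h hI => by
    intro hΩ
    obtain ⟨⟨hke, hte, hA⟩, hk, ht⟩ := h.scoped hΥ hΩ
    have hs := ISubst.maps_inst hI.scoped
    exact ⟨hA.subst (hs _), ⟨hk, hke.subst (hs _)⟩, ⟨ht, hte.subst (hs _)⟩⟩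
  | _, _, _, _, _, _, _, _, _, _, .cimpE h => by
    intro hΩ
    obtain ⟨hA, hk, ht⟩ := h.scoped hΥ hΩ
    exact ⟨hA.2, hk, ht⟩
  | _, _, _, _, _, _, _, _, _, _, .anno _ _ hA hk ht => by
    intro hΩ
    exact ⟨hA.mono le_rfl (by simp), hk.mono le_rfl (by simp), ht.mono le_rfl (by simp)⟩

theorem InfR.fresh {c : CostModel} {Υ : PrimEnv} :
    ∀ {Δ : UEnv} {ψa : EEnv} {Φa : CEnv} {Γ : RCtx} {e e' : Expr} {τ : RTy} {ψ : EEnv} {t : Idx}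
      {Φ : CForm}, InfR c Υ Δ ψa Φa Γ e e' τ ψ t Φ → ψ.FreshFor ψa
  | _, _, _, _, _, _, _, _, _, _, .num | _, _, _, _, _, _, _, _, _, _, .unit
  | _, _, _, _, _, _, _, _, _, _, .var _ | _, _, _, _, _, _, _, _, _, _, .anno .. =>
    EEnv.freshFor_nil _
  | _, _, _, _, _, _, _, _, _, _, .fst h | _, _, _, _, _, _, _, _, _, _, .snd h
  | _, _, _, _, _, _, _, _, _, _, .iApp h _ | _, _, _, _, _, _, _, _, _, _, .cimpE h
  | _, _, _, _, _, _, _, _, _, _, .der h => h.fresh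
  | _, _, _, _, _, _, _, _, _, _, .app h hf _ => hf.reals.append h.fresh
  | _, _, _, _, _, _, _, _, _, _, .prim _ hf _ => hf.reals
  | _, _, _, _, _, _, _, _, _, _, .switch h₁ h₂ hd => by
    -- The two inferences are independent, each fresh only for `ψa`; that their names do not clash
    -- is the disjointness premise of the rule.
    refine EEnv.FreshFor.append ⟨h₁.fresh.1, fun a ha => ?_⟩ h₂.fresh
    simp only [EEnv.dom_append, List.mem_append, not_or]
    exact ⟨fun ha' => hd ha ha', h₁.fresh.2 a ha⟩

theorem InfR.scoped {c : CostModel} {Υ : PrimEnv} (hΥ : Υ.Closed) :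
    ∀ {Δ : UEnv} {ψa : EEnv} {Φa : CEnv} {Γ : RCtx} {e e' : Expr} {τ : RTy} {ψ : EEnv} {t : Idx}
      {Φ : CForm}, InfR c Υ Δ ψa Φa Γ e e' τ ψ t Φ → Γ.Scoped Δ.length ψa.dom →
      τ.Scoped Δ.length (ψ ++ ψa).dom ∧ t.Scoped Δ.length (ψ ++ ψa).dom
  | _, _, _, _, _, _, _, _, _, _, .num => by
    intro hΓ
    exact ⟨trivial, trivial⟩
  | _, _, _, _, _, _, _, _, _, _, .unit => by
    intro hΓ
    exact ⟨trivial, trivial⟩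
  | _, _, _, _, _, _, _, _, _, _, .var hx => by
    intro hΓ
    exact ⟨hΓ _ _ hx, trivial⟩
  | _, _, _, _, _, _, _, _, _, _, .switch h₁ h₂ _ => by
    intro hΓ
    obtain ⟨hA, _, ht⟩ := h₁.scoped hΥ (hΓ.proj true)
    obtain ⟨hB, hk, _⟩ := h₂.scoped hΥ (hΓ.proj false)
    refine ⟨⟨hA.mono le_rfl ?_, hB.mono le_rfl ?_⟩, ⟨ht.mono le_rfl ?_, hk.mono le_rfl ?_⟩⟩ <;>
      simp only [EEnv.dom_append, List.subset_def, List.mem_append] <;> tauto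
  | _, _, _, _, _, _, _, _, _, _, .der h => by
    intro hΓ
    exact h.scoped hΥ hΓ
  | _, _, _, _, _, _, _, _, _, _, .fst h => by
    intro hΓ
    exact ⟨(h.scoped hΥ hΓ).1.1, (h.scoped hΥ hΓ).2⟩
  | _, _, _, _, _, _, _, _, _, _, .snd h => by
    intro hΓ
    exact ⟨(h.scoped hΥ hΓ).1.2, (h.scoped hΥ hΓ).2⟩
  | _, _, _, _, _, _, _, _, _, _, .app h hf _ => by
    intro hΓ
    obtain ⟨⟨_, hte, hσ⟩, ht⟩ := h.scoped hΥ hΓ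
    have hE := EEnv.dom_subset_append
    refine ⟨hσ.mono le_rfl (hE _ _ _),
      ⟨⟨ht.mono le_rfl (hE _ _ _), ?_⟩, hte.mono le_rfl (hE _ _ _)⟩⟩
    simp [Idx.Scoped]
  | _, _, _, _, _, _, _, _, _, _, .prim hζ hf _ => by
    intro hΓ
    obtain ⟨_, ht, hσ⟩ := hΥ.2 _ _ _ _ hζ
    refine ⟨hσ.mono (Nat.zero_le _) (by simp), ⟨?_, ht.mono (Nat.zero_le _) (by simp)⟩⟩
    simp [Idx.Scoped]
  | _, _, _, _, _, _, _, _, _, _, .iApp h hI => by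
    intro hΓ
    obtain ⟨⟨hte, hτ⟩, ht⟩ := h.scoped hΥ hΓ
    have hs := ISubst.maps_inst hI.scoped
    exact ⟨hτ.subst (hs _), ⟨ht, hte.subst (hs _)⟩⟩
  | _, _, _, _, _, _, _, _, _, _, .cimpE h => by
    intro hΓ
    exact ⟨(h.scoped hΥ hΓ).1.2, (h.scoped hΥ hΓ).2⟩
  | _, _, _, _, _, _, _, _, _, _, .anno _ _ hτ ht => by
    intro hΓ
    exact ⟨hτ.mono le_rfl (by simp), ht.mono le_rfl (by simp)⟩

/-! Commutation of existential substitutions with weakening and instantiation. -/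

section Commute

variable (θ : ℕ → Idx)

theorem Idx.subst_shift_up (I : Idx) :
    (I.subst .shift).subst (.ofE (up θ)) = (I.subst (.ofE θ)).subst .shift := by
  rw [Idx.subst_subst, Idx.subst_subst, ISubst.shift_comp_up]

theorem UTy.subst_shift_up (A : UTy) :
    (A.subst .shift).subst (.ofE (up θ)) = (A.subst (.ofE θ)).subst .shift := by
  rw [UTy.subst_subst, UTy.subst_subst, ISubst.shift_comp_up]

theorem RTy.subst_shift_up (τ : RTy) :
    (τ.subst .shift).subst (.ofE (up θ)) = (τ.subst (.ofE θ)).subst .shift := by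
  rw [RTy.subst_subst, RTy.subst_subst, ISubst.shift_comp_up]

theorem CEnv.subst_shift_up (Φa : CEnv) :
    (Φa.subst .shift).subst (.ofE (up θ)) = (Φa.subst (.ofE θ)).subst .shift := by
  rw [CEnv.subst_subst, CEnv.subst_subst, ISubst.shift_comp_up]

/-- For a cost variable quantified outside an index binder: its value inside the binder is the
weakened witness, the form in which the core rules require the cost of a branch. -/
theorem Idx.evar_subst_up (a : ℕ) :
    (Idx.evar a).subst (.ofE (up θ)) = ((Idx.evar a).subst (.ofE θ)).subst .shift :=
  Idx.subst_shift_up θ (.evar a)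

theorem consEq_subst (n : Idx) :
    (consEq n).subst (.ofE (up θ)) = consEq (n.subst (.ofE θ)) := by
  simp only [consEq, Constr.subst, Idx.subst_shift_up]; rfl

variable {θ} {I : Idx} {d : ℕ} (hI : I.Scoped d [])
include hI

theorem Idx.subst_inst_ofE (J : Idx) :
    (J.subst (.inst I)).subst (.ofE θ) = (J.subst (ISubst.ofE θ).lift).subst (.inst I) := by
  rw [Idx.subst_subst, Idx.subst_subst, ISubst.inst_comp_ofE hI]

theorem UTy.subst_inst_ofE (A : UTy) :
    (A.subst (.inst I)).subst (.ofE θ) = (A.subst (ISubst.ofE θ).lift).subst (.inst I) := by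
  rw [UTy.subst_subst, UTy.subst_subst, ISubst.inst_comp_ofE hI]

theorem RTy.subst_inst_ofE (τ : RTy) :
    (τ.subst (.inst I)).subst (.ofE θ) = (τ.subst (ISubst.ofE θ).lift).subst (.inst I) := by
  rw [RTy.subst_subst, RTy.subst_subst, ISubst.inst_comp_ofE hI]

end Commute

-- Instances depend only on the existential variables in scope.

section Congr

variable {d : ℕ} {E : List ℕ} {θ θ' : ℕ → Idx} (h : ∀ a ∈ E, θ a = θ' a)
include h

theorem Idx.Scoped.ofE_congr {I : Idx} (hI : I.Scoped d E) :
    I.subst (.ofE θ) = I.subst (.ofE θ') := Idx.subst_congr hI (ISubst.agreeOn_ofE h)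

theorem Constr.Scoped.ofE_congr {C : Constr} (hC : C.Scoped d E) :
    C.subst (.ofE θ) = C.subst (.ofE θ') := Constr.subst_congr hC (ISubst.agreeOn_ofE h)

theorem UTy.Scoped.ofE_congr {A : UTy} (hA : A.Scoped d E) :
    A.subst (.ofE θ) = A.subst (.ofE θ') := UTy.subst_congr hA (ISubst.agreeOn_ofE h)

theorem RTy.Scoped.ofE_congr {τ : RTy} (hτ : τ.Scoped d E) :
    τ.subst (.ofE θ) = τ.subst (.ofE θ') := RTy.subst_congr hτ (ISubst.agreeOn_ofE h)

theorem CEnv.Scoped.ofE_congr {Φa : CEnv} (hΦ : Φa.Scoped d E) :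
    Φa.subst (.ofE θ) = Φa.subst (.ofE θ') := CEnv.subst_congr hΦ (ISubst.agreeOn_ofE h)

end Congr

theorem UTy.Scoped.subst_ofE_of_nil {A : UTy} {d : ℕ} (h : A.Scoped d []) (θ : ℕ → Idx) :
    A.subst (.ofE θ) = A :=
  (h.ofE_congr (θ' := .evar) (by simp)).trans A.subst_id

theorem RTy.Scoped.subst_ofE_of_nil {τ : RTy} {d : ℕ} (h : τ.Scoped d []) (θ : ℕ → Idx) :
    τ.subst (.ofE θ) = τ :=
  (h.ofE_congr (θ' := .evar) (by simp)).trans τ.subst_id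

theorem Constr.Scoped.subst_ofE_of_nil {C : Constr} {d : ℕ} (h : C.Scoped d []) (θ : ℕ → Idx) :
    C.subst (.ofE θ) = C :=
  (h.ofE_congr (θ' := .evar) (by simp)).trans C.subst_id

/-! Instances of a unary judgment under an existential substitution. -/

/-- `Φb` and `Ω'` are the instances under `θ` of the well-scoped `Φa` and `Ω`; the instance of a
context is determined only up to shadowed bindings. -/
structure UInst (Δ : UEnv) (ψa : EEnv) (Φa : CEnv) (Ω : UCtx) (θ : ℕ → Idx) (Φb : CEnv)
    (Ω' : UCtx) : Prop where
  wf : SubstWf Δ θ ψa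
  cenv : Φa.Scoped Δ.length ψa.dom
  ctx : Ω.Scoped Δ.length ψa.dom
  eq : Φb = Φa.subst (.ofE θ)
  lookup : ∀ x, Ω'.lookup x = (Ω.lookup x).map fun A => A.subst (.ofE θ)

namespace UInst

variable {Δ : UEnv} {ψa : EEnv} {Φa : CEnv} {Ω : UCtx} {θ : ℕ → Idx} {Φb : CEnv} {Ω' : UCtx}

/-- The same `Φb` and `Ω'` serve as instances under the enlarged substitution; this holds because
contexts are compared through lookup and only visible bindings are known to be in scope. -/
theorem extend (h : UInst Δ ψa Φa Ω θ Φb Ω') {ψ : EEnv} {θ' : ℕ → Idx} (hθ' : SubstWf Δ θ' ψ)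
    (ha : ∀ a ∈ ψa.dom, θ a = θ' a) 
    (hψ : ψa.dom ⊆ ψ.dom := by intro _ h; simp [h]) :
    UInst Δ ψ Φa Ω θ' Φb Ω' where
  wf := hθ'
  cenv := h.cenv.mono hψ
  ctx := h.ctx.mono hψ
  eq := h.eq.trans (h.cenv.ofE_congr ha)
  lookup x := by
    rw [h.lookup]
    cases hx : Ω.lookup x with
    | none => rfl
    | some A => simp only [Option.map_some, (h.ctx x A hx).ofE_congr ha]

theorem assume (h : UInst Δ ψa Φa Ω θ Φb Ω') {C : Constr} (hC : C.Scoped Δ.length ψa.dom) :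
    UInst Δ ψa (C :: Φa) Ω θ (C.subst (.ofE θ) :: Φb) Ω' :=
  { h with
    cenv := h.cenv.cons hC
    eq := by rw [h.eq]; rfl }

theorem bind (h : UInst Δ ψa Φa Ω θ Φb Ω') (x : ℕ) {A : UTy}
    (hA : A.Scoped Δ.length ψa.dom) :
    UInst Δ ψa Φa ((x, A) :: Ω) θ Φb ((x, A.subst (.ofE θ)) :: Ω') :=
  { h with
    ctx := h.ctx.cons hA
    lookup := fun y => by
      simp only [List.lookup_cons]
      cases y == x
      · exact h.lookup y
      · rfl }

theorem shift (h : UInst Δ ψa Φa Ω θ Φb Ω') (S : ISort) :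
    UInst (S :: Δ) ψa (Φa.subst .shift) (Ω.subst .shift) (up θ) (Φb.subst .shift)
      (Ω'.subst .shift) where
  wf := h.wf.up S
  cenv := h.cenv.shift
  ctx := h.ctx.shift
  eq := by rw [h.eq, CEnv.subst_shift_up]
  lookup x := by
    simp only [UCtx.subst, lookup_map (fun A : UTy => A.subst .shift), h.lookup, Option.map_map]
    congr 1
    funext A
    exact (UTy.subst_shift_up θ A).symm

theorem ctx_wf (h : UInst Δ ψa Φa Ω θ Φb Ω') (hΩ : Ω.Wf Δ ψa) : Ω'.Wf Δ [] := by
  intro x A hA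
  rw [h.lookup] at hA
  obtain ⟨B, hB, rfl⟩ := Option.map_eq_some_iff.1 hA
  exact (hΩ x B hB).subst h.wf.sorted

end UInst

-- Inversion of the constraint shapes of checking rules, and adjustment of costs.

theorem Prov.all_ofE_inv {c : CostModel} {Δ : UEnv} {Φa : CEnv} {S : ISort} {Φ : CForm}
    {θ : ℕ → Idx} (h : Prov c Δ Φa ((CForm.all S Φ).subst (.ofE θ))) :
    Prov c (S :: Δ) (Φa.subst .shift) (Φ.subst (.ofE (up θ))) :=
  ISubst.ofE_lift θ ▸ h.all_inv

/-- Rules with two checked premises choose all fresh names at once. Their constraint nevertheless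
nests the second block of quantifiers inside the first, so the second must be fresh for the first as
well. The second block may carry sorts other than `ℝ`. -/
theorem Fresh.split {l l' : List ℕ} {ψ ψa : EEnv} (h : Fresh (l ++ l') ψa) (hψ : ψ.dom = l') :
    (BiRelCost.reals l).FreshFor ψa ∧ ψ.FreshFor (BiRelCost.reals l ++ ψa) := by
  obtain ⟨hn, hm⟩ := h
  rw [List.nodup_append] at hn
  refine ⟨Fresh.reals ⟨hn.1, fun a ha => hm a (by simp [ha])⟩, hψ ▸ hn.2.1, fun a ha => ?_⟩
  rw [hψ] at ha
  simp only [EEnv.dom_append, reals_dom, List.mem_append, not_or]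
  exact ⟨fun h => hn.2.2 a h a ha rfl, hm a (by simp [ha])⟩

/-- The common shape of the constraints of two-stage rules: the first premise is constrained before
the second block of witnesses exists. The agreement facts allow everything to be moved to `θ₂`. -/
theorem Prov.exs_and_exs_inv {c : CostModel} {Δ : UEnv} {Φa : CEnv} {ψ ψ' ψa : EEnv}
    {θ : ℕ → Idx} {Φ Ψ : CForm}
    (h : Prov c Δ Φa ((CForm.exs ψ (.and Φ (.exs ψ' Ψ))).subst (.ofE θ))) (hθ : SubstWf Δ θ ψa)
    (hψ : ψ.FreshFor ψa) (hψ' : ψ'.FreshFor (ψ ++ ψa)) :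
    ∃ θ₁ θ₂, SubstWf Δ θ₁ (ψ ++ ψa) ∧ SubstWf Δ θ₂ (ψ' ++ ψ ++ ψa) ∧
      (∀ a ∈ ψa.dom, θ a = θ₁ a) ∧ (∀ a ∈ ψa.dom, θ a = θ₂ a) ∧
      (∀ a ∈ EEnv.dom (ψ ++ ψa), θ₁ a = θ₂ a) ∧
      Prov c Δ Φa (Φ.subst (.ofE θ₁)) ∧ Prov c Δ Φa (Ψ.subst (.ofE θ₂)) := by
  obtain ⟨θ₁, w₁, a₁, h⟩ := h.exs_inv hθ hψ
  obtain ⟨p₁, h⟩ := h.and_inv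
  obtain ⟨θ₂, w₂, a₂, p₂⟩ := h.exs_inv w₁ hψ'
  rw [← List.append_assoc] at w₂
  exact ⟨θ₁, θ₂, w₁, w₂, a₁, fun a ha => (a₁ a ha).trans (a₂ a (by simp [ha])), a₂, p₁, p₂⟩

/-- The equations on total costs in `Φ` are used only through subsumption, so the required cost need
not be syntactically the one computed by the core rule. -/
theorem CoreU.of_eq {c : CostModel} {Υ : PrimEnv} {Δ : UEnv} {Φa : CEnv} {Ω : UCtx}
    {k t k' t' : Idx} {e : CExpr} {A : UTy} (h : CoreU c Υ Δ Φa Ω k t e A)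
    (hk : Entails c Δ [] Φa (.eq k' k)) (ht : Entails c Δ [] Φa (.eq t t')) :
    CoreU c Υ Δ Φa Ω k' t' e A :=
  h.sub .refl hk.le_of_eq ht.le_of_eq

theorem Idx.eval_add_right_comm (c : CostModel) (I J K : Idx) (ρ η : ℕ → EReal) :
    (I + J + K).eval c ρ η = (J + I + K).eval c ρ η := by
  simp only [Idx.eval_add, add_comm (I.eval c ρ η)]

theorem Entails.eq_trans_eval {c : CostModel} {Δ : UEnv} {ψ : EEnv} {Φa : CEnv} {I J K : Idx}
    (h : Entails c Δ ψ Φa (.eq I J)) (h' : ∀ ρ η, J.eval c ρ η = K.eval c ρ η) :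
    Entails c Δ ψ Φa (.eq I K) :=
  fun ρ η hρ hη hΦ => Eq.trans (h ρ η hρ hη hΦ) (h' ρ η)

theorem consEq_scoped {n : Idx} {d : ℕ} {E : List ℕ} (h : n.Scoped d E) :
    (consEq n).Scoped (d + 1) E :=
  ⟨h.subst (ISubst.maps_shift d E), Nat.succ_pos d⟩

theorem Idx.scoped_evar {a d : ℕ} {E : List ℕ} (h : a ∈ E) : (Idx.evar a).Scoped d E := h

/-! Soundness of unary typechecking. -/

mutual

/-- Inputs must be in scope of `ψa`, so that their instances survive the addition of witnesses; the
index term is fixed by `θ`, but the context only by its visible bindings. -/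
theorem ChkU.sound {c : CostModel} {Υ : PrimEnv} (hΥ : Υ.Closed) :
    ∀ {Δ : UEnv} {ψa : EEnv} {Φa : CEnv} {Ω : UCtx} {e : Expr} {A : UTy} {k t : Idx} {Φ : CForm},
      ChkU c Υ Δ ψa Φa Ω e A k t Φ → ∀ {θ : ℕ → Idx} {Φb : CEnv} {Ω' : UCtx},
      UInst Δ ψa Φa Ω θ Φb Ω' → A.Scoped Δ.length ψa.dom → k.Scoped Δ.length ψa.dom →
      t.Scoped Δ.length ψa.dom → Prov c Δ Φb (Φ.subst (.ofE θ)) →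
      CoreU c Υ Δ Φb Ω' (k.subst (.ofE θ)) (t.subst (.ofE θ)) e.erase (A.subst (.ofE θ))
  | _, _, _, _, _, _, _, _, _, .pair hf h₁ h₂ => by
    intro hI hA hk ht hΦ
    have fr := Fresh.split (l := [_, _]) hf (reals_dom _)
    obtain ⟨θ₁, θ₂, w₁, w₂, a₁, a₂, a₁₂, p₁, p₂⟩ := hΦ.exs_and_exs_inv hI.wf fr.1 fr.2
    have c₁ := h₁.sound hΥ (hI.extend w₁ a₁) (hA.1.mono le_rfl (fun _ h => by simp [h]))
      (Idx.scoped_evar (by simp)) (Idx.scoped_evar (by simp)) p₁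
    -- The second premise does not have `k₁`, `t₁` in scope, so `θ₂` is restricted to the
    -- environment of that premise.
    have c₂ := h₂.sound hΥ (hI.extend (w₂.mono (by simp)) a₂) (hA.2.mono le_rfl (fun _ h => by simp [h]))
      (Idx.scoped_evar (by simp)) (Idx.scoped_evar (by simp)) p₂.and_inv.1
    -- The first premise is moved to `θ₂`: its cost variables agree there, and its type is rewritten
    -- by way of `θ`, with which both substitutions agree on `ψa`.
    rw [Idx.Scoped.ofE_congr a₁₂ (d := 0) (Idx.scoped_evar (by simp)),
      Idx.Scoped.ofE_congr a₁₂ (d := 0) (Idx.scoped_evar (by simp)), ← hA.1.ofE_congr a₁,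
      hA.1.ofE_congr a₂] at c₁
    rw [hA.ofE_congr a₂, hk.ofE_congr a₂, ht.ofE_congr a₂]
    exact (CoreU.pair c₁ c₂).of_eq p₂.and_inv.2.and_inv.2.eq_inv p₂.and_inv.2.and_inv.1.eq_inv
  | _, _, _, _, _, _, _, _, _, .inl h hB => by
    intro hI hA hk ht hΦ
    exact .inl (h.sound hΥ hI hA.1 hk ht hΦ) (hB.subst hI.wf.sorted)
  | _, _, _, _, _, _, _, _, _, .inr h hB => by
    intro hI hA hk ht hΦ
    exact .inr (h.sound hΥ hI hA.2 hk ht hΦ) (hB.subst hI.wf.sorted)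
  | _, _, _, _, _, _, _, _, _, .case h₁ hf h₂ h₃ => by
    intro hI hA hk ht hΦ
    obtain ⟨θ₁, θ₂, w₁, w₂, a₁, a₂, a₁₂, p₁, p₂⟩ := hΦ.exs_and_exs_inv hI.wf h₁.fresh hf.reals
    obtain ⟨p₂, p⟩ := p₂.and_inv
    obtain ⟨p₃, p⟩ := p.and_inv
    obtain ⟨sA, sk, st⟩ := h₁.scoped hΥ hI.ctx
    have c₁ := h₁.sound hΥ hI a₁ w₁ p₁
    rw [sA.ofE_congr a₁₂, sk.ofE_congr a₁₂, st.ofE_congr a₁₂] at c₁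
    have sA' (ψ) := sA.mono le_rfl (EEnv.dom_subset_append ψ _ _)
    have I₂ := hI.extend w₂ a₂
    have c₂ := h₂.sound hΥ (I₂.bind _ (sA' _).1) (hA.mono le_rfl (fun _ h => by simp [h]))
      (Idx.scoped_evar (by simp)) (Idx.scoped_evar (by simp)) p₂
    have c₃ := h₃.sound hΥ (I₂.bind _ (sA' _).2) (hA.mono le_rfl (fun _ h => by simp [h]))
      (Idx.scoped_evar (by simp)) (Idx.scoped_evar (by simp)) p₃
    rw [hA.ofE_congr a₂, hk.ofE_congr a₂, ht.ofE_congr a₂]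
    -- The algorithmic equations list the cost of the branches before that of the scrutinee; the
    -- core rule has the opposite order.
    exact (CoreU.case c₁ c₂ c₃).of_eq
      (p.and_inv.1.eq_inv.eq_trans_eval fun _ _ => Idx.eval_add_right_comm ..)
      (p.and_inv.2.eq_inv.eq_symm.eq_trans_eval fun _ _ => Idx.eval_add_right_comm ..).eq_symm
  | _, _, _, _, _, _, _, _, _, .fix h => by
    intro hI hA hk ht hΦ
    obtain ⟨p₁, p⟩ := hΦ.and_inv
    exact (CoreU.fix (h.sound hΥ ((hI.bind _ hA).bind _ hA.1) hA.2.2.2 hA.2.1 hA.2.2.1 p₁)).of_eq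
      p.and_inv.1.eq_inv p.and_inv.2.eq_inv
  | _, _, _, _, _, _, _, _, _, .iLam h => by
    intro hI hA hk ht hΦ
    obtain ⟨p₁, p⟩ := hΦ.and_inv
    have c₁ := h.sound hΥ (hI.shift _) hA.2.2 hA.1 hA.2.1 p₁.all_ofE_inv
    rw [← ISubst.ofE_lift] at c₁
    exact (CoreU.iLam c₁).of_eq p.and_inv.1.eq_inv p.and_inv.2.eq_inv
  | _, _, _, _, _, _, _, _, _, .pack h hJ => by
    intro hI hA hk ht hΦ
    have c₁ := h.sound hΥ hI (UTy.Scoped.subst hA (ISubst.maps_inst hJ.scoped _)) hk ht hΦ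
    rw [UTy.subst_inst_ofE hJ.scoped] at c₁
    exact .pack c₁ hJ
  | _, _, _, _, _, _, _, _, _, .unpack h₁ hf h₂ => by
    intro hI hA hk ht hΦ
    obtain ⟨θ₁, θ₂, w₁, w₂, a₁, a₂, a₁₂, p₁, p₂⟩ := hΦ.exs_and_exs_inv hI.wf h₁.fresh hf.reals
    obtain ⟨p₂, p⟩ := p₂.and_inv
    obtain ⟨sA, sk, st⟩ := h₁.scoped hΥ hI.ctx
    have c₁ := h₁.sound hΥ hI a₁ w₁ p₁
    rw [sA.ofE_congr a₁₂, sk.ofE_congr a₁₂, st.ofE_congr a₁₂] at c₁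
    have I₂ := hI.extend w₂ a₂
    have c₂ := h₂.sound hΥ ((I₂.shift _).bind _ (UTy.Scoped.mono sA le_rfl
      (EEnv.dom_subset_append _ _ _)))
      ((hA.mono le_rfl (fun _ h => by simp [h])).subst (ISubst.maps_shift _ _))
      (Idx.scoped_evar (by simp)) (Idx.scoped_evar (by simp)) p₂.all_ofE_inv
    -- The result type and both costs of the body are exhibited as weakenings, so none of them
    -- depends on the unpacked index.
    rw [UTy.subst_shift_up, Idx.evar_subst_up, Idx.evar_subst_up, ← ISubst.ofE_lift] at c₂
    rw [hA.ofE_congr a₂, hk.ofE_congr a₂, ht.ofE_congr a₂]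
    exact (CoreU.unpack c₁ c₂).of_eq p.and_inv.1.eq_inv p.and_inv.2.eq_inv
  | _, _, _, _, _, _, _, _, _, .nil hB => by
    intro hI hA hk ht hΦ
    obtain ⟨p₁, p⟩ := hΦ.and_inv
    -- The core rule gives length exactly `0`; the length `n` of the checked type is reached by list
    -- subtyping along the equation in `Φ`.
    exact (CoreU.nil (hB.subst hI.wf.sorted)).sub (.list p₁.eq_inv.eq_symm .refl)
      p.and_inv.1.eq_inv.le_of_eq p.and_inv.2.eq_inv.le_of_eq
  | _, _, _, _, _, _, _, _, _, .cons (i := i) (k₂ := k₂) (t₂ := t₂) hf h₁ h₂ => by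
    intro hI hA hk ht hΦ
    -- The quantifiers over the costs of the tail and over its length `i` form one block. Its order
    -- differs from that in the premise's environment, which is harmless since only membership
    -- matters.
    have fr := Fresh.split (l := [_, _]) (ψ := reals [k₂, t₂] ++ [(i, .nat)]) hf (by simp)
    obtain ⟨θ₁, θ₂, w₁, w₂, a₁, a₂, a₁₂, p₁, p₂⟩ := Prov.exs_and_exs_inv
      (ψ' := reals [k₂, t₂] ++ [(i, .nat)]) hΦ hI.wf fr.1 fr.2
    obtain ⟨p₂, p⟩ := p₂.and_inv
    have c₁ := h₁.sound hΥ (hI.extend w₁ a₁) (hA.2.mono le_rfl (fun _ h => by simp [h]))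
      (Idx.scoped_evar (by simp)) (Idx.scoped_evar (by simp)) p₁
    have c₂ := h₂.sound hΥ (hI.extend (w₂.mono fun _ h => by grind) a₂)
      ⟨Idx.scoped_evar (by simp), hA.2.mono le_rfl (fun _ h => by simp [h])⟩
      (Idx.scoped_evar (by simp)) (Idx.scoped_evar (by simp)) p₂
    rw [Idx.Scoped.ofE_congr a₁₂ (d := 0) (Idx.scoped_evar (by simp)),
      Idx.Scoped.ofE_congr a₁₂ (d := 0) (Idx.scoped_evar (by simp)), ← hA.2.ofE_congr a₁,
      hA.2.ofE_congr a₂] at c₁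
    rw [hA.ofE_congr a₂, hk.ofE_congr a₂, ht.ofE_congr a₂]
    exact (CoreU.cons c₁ c₂).sub (.list p.and_inv.1.eq_inv.eq_symm .refl)
      p.and_inv.2.and_inv.1.eq_inv.le_of_eq p.and_inv.2.and_inv.2.eq_inv.le_of_eq
  | _, _, _, _, _, _, _, _, _, .caseL h₁ hf h₂ h₃ => by
    intro hI hA hk ht hΦ
    obtain ⟨θ₁, θ₂, w₁, w₂, a₁, a₂, a₁₂, p₁, p₂⟩ := hΦ.exs_and_exs_inv hI.wf h₁.fresh hf.reals
    obtain ⟨p₂, p⟩ := p₂.and_inv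
    obtain ⟨p₃, p⟩ := p.and_inv
    obtain ⟨sA, sk, st⟩ := h₁.scoped hΥ hI.ctx
    have c₁ := h₁.sound hΥ hI a₁ w₁ p₁
    rw [sA.ofE_congr a₁₂, sk.ofE_congr a₁₂, st.ofE_congr a₁₂] at c₁
    have sA' (ψ) := sA.mono le_rfl (EEnv.dom_subset_append ψ _ _)
    have I₂ := hI.extend w₂ a₂
    have c₂ := h₂.sound hΥ (I₂.assume (C := .eq _ .zero) ⟨(sA' _).1, trivial⟩)
      (hA.mono le_rfl (fun _ h => by simp [h])) (Idx.scoped_evar (by simp)) (Idx.scoped_evar (by simp)) p₂.imp_inv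
    have sA₁ (ψ) := (sA' ψ).2.subst (ISubst.maps_shift _ _)
    have c₃ := h₃.sound hΥ ((((I₂.shift .nat).assume (consEq_scoped (sA' _).1)).bind _
      (A := .list (.var 0) _) ⟨Nat.succ_pos _, sA₁ _⟩).bind _ (sA₁ _))
      ((hA.mono le_rfl (fun _ h => by simp [h])).subst (ISubst.maps_shift _ _))
      (Idx.scoped_evar (by simp)) (Idx.scoped_evar (by simp)) p₃.all_ofE_inv.imp_inv
    -- Recasts the premise for the cons branch as the core rule states it: every outer datum is
    -- instantiated first and weakened afterwards.
    simp only [UTy.subst, UTy.subst_shift_up, Idx.evar_subst_up, consEq_subst] at c₃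
    rw [hA.ofE_congr a₂, hk.ofE_congr a₂, ht.ofE_congr a₂]
    exact (CoreU.caseL c₁ c₂ c₃).of_eq p.and_inv.1.eq_inv p.and_inv.2.eq_inv
  | _, _, _, _, _, _, _, _, _, .letE h₁ hf h₂ => by
    intro hI hA hk ht hΦ
    obtain ⟨θ₁, θ₂, w₁, w₂, a₁, a₂, a₁₂, p₁, p₂⟩ := hΦ.exs_and_exs_inv hI.wf h₁.fresh hf.reals
    obtain ⟨p₂, p⟩ := p₂.and_inv
    obtain ⟨sA, sk, st⟩ := h₁.scoped hΥ hI.ctx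
    have c₁ := h₁.sound hΥ hI a₁ w₁ p₁
    rw [sA.ofE_congr a₁₂, sk.ofE_congr a₁₂, st.ofE_congr a₁₂] at c₁
    have c₂ := h₂.sound hΥ ((hI.extend w₂ a₂).bind _ (sA.mono le_rfl
      (EEnv.dom_subset_append _ _ _))) (hA.mono le_rfl (fun _ h => by simp [h]))
      (Idx.scoped_evar (by simp)) (Idx.scoped_evar (by simp)) p₂
    rw [hA.ofE_congr a₂, hk.ofE_congr a₂, ht.ofE_congr a₂]
    exact (CoreU.letE c₁ c₂).of_eq p.and_inv.1.eq_inv p.and_inv.2.eq_inv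
  | _, _, _, _, _, _, _, _, _, .candI h => by
    intro hI hA hk ht hΦ
    obtain ⟨p₁, p⟩ := hΦ.and_inv
    exact .candI p₁.atom_inv (h.sound hΥ (hI.assume hA.1) hA.2 hk ht p.imp_inv)
  | _, _, _, _, _, _, _, _, _, .candE h₁ hf h₂ => by
    intro hI hA hk ht hΦ
    obtain ⟨θ₁, θ₂, w₁, w₂, a₁, a₂, a₁₂, p₁, p₂⟩ := hΦ.exs_and_exs_inv hI.wf h₁.fresh hf.reals
    obtain ⟨p₂, p⟩ := p₂.and_inv
    obtain ⟨sA, sk, st⟩ := h₁.scoped hΥ hI.ctx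
    have c₁ := h₁.sound hΥ hI a₁ w₁ p₁
    rw [sA.ofE_congr a₁₂, sk.ofE_congr a₁₂, st.ofE_congr a₁₂] at c₁
    have sA' (ψ) := sA.mono le_rfl (EEnv.dom_subset_append ψ _ _)
    have c₂ := h₂.sound hΥ (((hI.extend w₂ a₂).assume (sA' _).1).bind _ (sA' _).2)
      (hA.mono le_rfl (fun _ h => by simp [h])) (Idx.scoped_evar (by simp)) (Idx.scoped_evar (by simp)) p₂.imp_inv
    rw [hA.ofE_congr a₂, hk.ofE_congr a₂, ht.ofE_congr a₂]
    exact (CoreU.candE c₁ c₂).of_eq p.and_inv.1.eq_inv p.and_inv.2.eq_inv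
  | _, _, _, _, _, _, _, _, _, .cimpI h => by
    intro hI hA hk ht hΦ
    exact .cimpI (h.sound hΥ (hI.assume hA.1) hA.2 hk ht hΦ.imp_inv)
  | _, _, _, _, _, _, _, _, _, .split h₁ h₂ hC => by
    intro hI hA hk ht hΦ
    have sC (E) := hC.scoped.mono le_rfl (List.nil_subset E)
    have c₁ := h₁.sound hΥ (hI.assume (sC _)) hA hk ht hΦ.and_inv.1.imp_inv
    have c₂ := h₂.sound hΥ (hI.assume (C := .neg _) (sC _)) hA hk ht hΦ.and_inv.2.imp_inv
    -- The constraint of a `split` is part of the expression and stays unchanged under erasure, so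
    -- it must be fixed by `θ`; it is well-sorted over `Δ` alone.
    simp only [Constr.subst, hC.scoped.subst_ofE_of_nil] at c₁ c₂
    exact .split c₁ c₂
  | _, _, _, _, _, _, _, _, _, .contra h hΩ => by
    intro hI hA hk ht hΦ
    exact .contra (hI.eq ▸ h.subst_ofE hI.wf) (hI.ctx_wf hΩ)
  | _, _, _, _, _, _, _, _, _, .updown h₁ h₂ => by
    intro hI hA hk ht hΦ
    obtain ⟨θ₁, w₁, a₁, p⟩ := hΦ.exs_inv hI.wf h₁.fresh
    obtain ⟨p₁, p⟩ := p.and_inv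
    have c₁ := h₁.sound hΥ hI a₁ w₁ p₁.and_inv.1
    rw [hA.ofE_congr a₁, hk.ofE_congr a₁, ht.ofE_congr a₁]
    exact c₁.sub (h₂.sound p₁.and_inv.2) p.and_inv.2.le_inv p.and_inv.1.le_inv

/-- No quantifiers are inverted here, because the generated variables are returned instead of bound:
`θ` already supplies values for all of `ψ` and agrees with the ambient substitution `θa` on `ψa`. -/
theorem InfU.sound {c : CostModel} {Υ : PrimEnv} (hΥ : Υ.Closed) :
    ∀ {Δ : UEnv} {ψa : EEnv} {Φa : CEnv} {Ω : UCtx} {e : Expr} {A : UTy} {ψ : EEnv} {k t : Idx}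
      {Φ : CForm}, InfU c Υ Δ ψa Φa Ω e A ψ k t Φ →
      ∀ {θa θ : ℕ → Idx} {Φb : CEnv} {Ω' : UCtx},
      UInst Δ ψa Φa Ω θa Φb Ω' → (∀ a ∈ ψa.dom, θa a = θ a) → SubstWf Δ θ (ψ ++ ψa) →
      Prov c Δ Φb (Φ.subst (.ofE θ)) →
      CoreU c Υ Δ Φb Ω' (k.subst (.ofE θ)) (t.subst (.ofE θ)) e.erase (A.subst (.ofE θ))
  | _, _, _, _, _, _, _, _, _, _, .num => fun _ _ _ _ => .num
  | _, _, _, _, _, _, _, _, _, _, .unit => fun _ _ _ _ => .unit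
  | _, _, _, _, _, _, _, _, _, _, .var hx => by
    intro hI ha w hΦ
    exact .var (by rw [hI.lookup, hx, Option.map_some, (hI.ctx _ _ hx).ofE_congr ha])
  | _, _, _, _, _, _, _, _, _, _, .fst h => fun hI ha w hΦ => .fst (h.sound hΥ hI ha w hΦ)
  | _, _, _, _, _, _, _, _, _, _, .snd h => fun hI ha w hΦ => .snd (h.sound hΥ hI ha w hΦ)
  | _, _, _, _, _, _, _, _, _, _, .app h₁ hf h₂ => by
    intro hI ha w hΦ
    have c₁ := h₁.sound hΥ hI ha (w.mono (by simp)) hΦ.and_inv.1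
    have sA (ψ) := (h₁.scoped hΥ hI.ctx).1.1.mono le_rfl (EEnv.dom_subset_append ψ _ _)
    have c₂ := h₂.sound hΥ (hI.extend w ha) (sA _) (Idx.scoped_evar (by simp))
      (Idx.scoped_evar (by simp)) hΦ.and_inv.2
    exact .app c₁ c₂
  | _, _, _, _, _, _, _, _, _, _, .prim hζ hf h => by
    intro hI ha w hΦ
    obtain ⟨sA, sk, st, sB⟩ := hΥ.1 _ _ _ _ _ hζ
    have c₁ := h.sound hΥ (hI.extend w ha) (sA.mono (Nat.zero_le _) (List.nil_subset _))
      (Idx.scoped_evar (by simp)) (Idx.scoped_evar (by simp)) hΦ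
    -- Types and latent costs of primitives are closed, so the core rule can use the entry of `Υ`
    -- unchanged.
    rw [sA.subst_ofE_of_nil] at c₁
    rw [sB.subst_ofE_of_nil]
    simp only [Idx.subst_add, sk.subst_ofE_of_nil, st.subst_ofE_of_nil]
    exact (CoreU.prim hζ c₁).of_eq
      ((Entails.eq_refl _).eq_trans_eval fun _ _ => Idx.eval_add_right_comm ..)
      ((Entails.eq_refl _).eq_trans_eval fun _ _ => Idx.eval_add_right_comm ..)
  | _, _, _, _, _, _, _, _, _, _, .iApp h hJ => by
    intro hI ha w hΦ
    simp only [Idx.subst_add, Idx.subst_inst_ofE hJ.scoped, UTy.subst_inst_ofE hJ.scoped]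
    exact .iApp (h.sound hΥ hI ha w hΦ) hJ
  | _, _, _, _, _, _, _, _, _, _, .cimpE h => fun hI ha w hΦ =>
    .cimpE (h.sound hΥ hI ha w hΦ.and_inv.2) hΦ.and_inv.1.atom_inv
  | _, _, _, _, _, _, _, _, _, _, .anno h _ sA sk st => fun hI ha w hΦ =>
    h.sound hΥ (hI.extend w ha) (sA.mono le_rfl (List.nil_subset _))
      (sk.mono le_rfl (List.nil_subset _)) (st.mono le_rfl (List.nil_subset _)) hΦ

end

/-! Instances of a relational judgment under an existential substitution. -/

/-- `Φb` and `Γ'` are the instances under `θ` of the well-scoped `Φa` and `Γ`; the instance of a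
context is determined only up to shadowed bindings. -/
structure RInst (Δ : UEnv) (ψa : EEnv) (Φa : CEnv) (Γ : RCtx) (θ : ℕ → Idx) (Φb : CEnv)
    (Γ' : RCtx) : Prop where
  wf : SubstWf Δ θ ψa
  cenv : Φa.Scoped Δ.length ψa.dom
  ctx : Γ.Scoped Δ.length ψa.dom
  eq : Φb = Φa.subst (.ofE θ)
  lookup : ∀ x, Γ'.lookup x = (Γ.lookup x).map fun τ => τ.subst (.ofE θ)

namespace RInst

variable {Δ : UEnv} {ψa : EEnv} {Φa : CEnv} {Γ : RCtx} {θ : ℕ → Idx} {Φb : CEnv} {Γ' : RCtx}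

theorem extend (h : RInst Δ ψa Φa Γ θ Φb Γ') {ψ : EEnv} {θ' : ℕ → Idx} (hθ' : SubstWf Δ θ' ψ)
    (ha : ∀ a ∈ ψa.dom, θ a = θ' a)
    (hψ : ψa.dom ⊆ ψ.dom := by intro _ h; simp [h]) :
    RInst Δ ψ Φa Γ θ' Φb Γ' where
  wf := hθ'
  cenv := h.cenv.mono hψ
  ctx := h.ctx.mono hψ
  eq := h.eq.trans (h.cenv.ofE_congr ha)
  lookup x := by
    rw [h.lookup]
    cases hx : Γ.lookup x with
    | none => rfl
    | some A => simp only [Option.map_some, (h.ctx x A hx).ofE_congr ha]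

theorem assume (h : RInst Δ ψa Φa Γ θ Φb Γ') {C : Constr} (hC : C.Scoped Δ.length ψa.dom) :
    RInst Δ ψa (C :: Φa) Γ θ (C.subst (.ofE θ) :: Φb) Γ' :=
  { h with
    cenv := h.cenv.cons hC
    eq := by rw [h.eq]; rfl }

theorem bind (h : RInst Δ ψa Φa Γ θ Φb Γ') (x : ℕ) {τ : RTy}
    (hτ : τ.Scoped Δ.length ψa.dom) :
    RInst Δ ψa Φa ((x, τ) :: Γ) θ Φb ((x, τ.subst (.ofE θ)) :: Γ') :=
  { h with
    ctx := h.ctx.cons hτ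
    lookup := fun y => by
      simp only [List.lookup_cons]
      cases y == x
      · exact h.lookup y
      · rfl }

theorem shift (h : RInst Δ ψa Φa Γ θ Φb Γ') (S : ISort) :
    RInst (S :: Δ) ψa (Φa.subst .shift) (Γ.subst .shift) (up θ) (Φb.subst .shift)
      (Γ'.subst .shift) where
  wf := h.wf.up S
  cenv := h.cenv.shift
  ctx := h.ctx.shift
  eq := by rw [h.eq, CEnv.subst_shift_up]
  lookup x := by
    simp only [RCtx.subst, lookup_map (fun τ : RTy => τ.subst .shift), h.lookup, Option.map_map]
    congr 1
    funext τ
    exact (RTy.subst_shift_up θ τ).symm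

theorem ctx_wf (h : RInst Δ ψa Φa Γ θ Φb Γ') (hΓ : Γ.Wf Δ ψa) : Γ'.Wf Δ [] := by
  intro x A hA
  rw [h.lookup] at hA
  obtain ⟨B, hB, rfl⟩ := Option.map_eq_some_iff.1 hA
  exact (hΓ x B hB).subst h.wf.sorted

/-- Passage to the unary premises of `switch` and of the asynchronous rules; it rests on projection
commuting with substitution. -/
theorem proj (h : RInst Δ ψa Φa Γ θ Φb Γ') (left : Bool) :
    UInst Δ ψa Φa (Γ.proj left) θ Φb (Γ'.proj left) where
  wf := h.wf
  cenv := h.cenv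
  ctx := h.ctx.proj left
  eq := h.eq
  lookup x := by
    simp only [RCtx.proj, lookup_map (fun τ : RTy => τ.proj left), h.lookup, Option.map_map]
    congr 1
    funext τ
    exact RTy.proj_subst τ left _

theorem box_lookup (Γ : RCtx) (θ : ℕ → Idx) (x : ℕ) :
    (Γ.subst (.ofE θ)).box.lookup x = (Γ.box.lookup x).map fun τ => τ.subst (.ofE θ) := by
  simp only [RCtx.box, RCtx.subst, lookup_map (fun τ : RTy => τ.box),
    lookup_map (fun τ : RTy => τ.subst (.ofE θ)), Option.map_map]
  rfl

/-- The judgment is given with the whole context `D`, while the premise of the rule lives in `□Γ`.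
Every visible binding of `□Γ` is one of `D`, hence in scope. The instance is boxed after
substitution, since the core rule asks for a context that is literally a box. -/
theorem box {D D' : RCtx} (h : RInst Δ ψa Φa D θ Φb D') (hD : D.Extends Γ.box) :
    RInst Δ ψa Φa Γ.box θ Φb (Γ.subst (.ofE θ)).box :=
  { h with
    ctx := fun x τ hx => h.ctx x τ (hD x τ hx)
    lookup := box_lookup Γ θ }

theorem extends_box {D D' : RCtx} (h : RInst Δ ψa Φa D θ Φb D') (hD : D.Extends Γ.box) :
    D'.Extends (Γ.subst (.ofE θ)).box := by
  intro x τ hx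
  rw [box_lookup] at hx
  obtain ⟨σ, hσ, rfl⟩ := Option.map_eq_some_iff.1 hx
  rw [h.lookup, hD x σ hσ, Option.map_some]

end RInst

-- Adjustment of relational costs, and further constraint shapes.

theorem CoreR.of_eq {c : CostModel} {Υ : PrimEnv} {Δ : UEnv} {Φa : CEnv} {Γ : RCtx}
    {t t' : Idx} {e e' : CExpr} {τ : RTy} (h : CoreR c Υ Δ Φa Γ e e' t τ)
    (ht : Entails c Δ [] Φa (.eq t t')) : CoreR c Υ Δ Φa Γ e e' t' τ :=
  h.sub (EqR.refl τ) ht.le_of_eq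

theorem EEnv.FreshFor.of_append {ψ ψ' ψa : EEnv} (h : EEnv.FreshFor (ψ ++ ψ') ψa) :
    ψ.FreshFor ψa ∧ ψ'.FreshFor (ψ ++ ψa) := by
  obtain ⟨hn, hm⟩ := h
  rw [EEnv.dom_append] at hn hm
  rw [List.nodup_append] at hn
  refine ⟨⟨hn.1, fun a ha => hm a (by simp [ha])⟩, hn.2.1, fun a ha => ?_⟩
  simp only [EEnv.dom_append, List.mem_append, not_or]
  exact ⟨fun h => hn.2.2 a h a ha rfl, hm a (by simp [ha])⟩

/-- The shape of the asynchronous application rules: the subtyping constraint lies inside `∃ψ` but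
outside the quantifier for the argument's cost, and so it is obtained under `θ₁`. -/
theorem Prov.exs_and_exs_and_inv {c : CostModel} {Δ : UEnv} {Φa : CEnv} {ψ ψ' ψa : EEnv}
    {θ : ℕ → Idx} {Φ Ψ Χ : CForm}
    (h : Prov c Δ Φa ((CForm.exs ψ (.and Φ (.and (.exs ψ' Ψ) Χ))).subst (.ofE θ)))
    (hθ : SubstWf Δ θ ψa) (hψ : ψ.FreshFor ψa) (hψ' : ψ'.FreshFor (ψ ++ ψa)) :
    ∃ θ₁ θ₂, SubstWf Δ θ₁ (ψ ++ ψa) ∧ SubstWf Δ θ₂ (ψ' ++ ψ ++ ψa) ∧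
      (∀ a ∈ ψa.dom, θ a = θ₁ a) ∧ (∀ a ∈ ψa.dom, θ a = θ₂ a) ∧
      (∀ a ∈ EEnv.dom (ψ ++ ψa), θ₁ a = θ₂ a) ∧ Prov c Δ Φa (Φ.subst (.ofE θ₁)) ∧
      Prov c Δ Φa (Ψ.subst (.ofE θ₂)) ∧ Prov c Δ Φa (Χ.subst (.ofE θ₁)) := by
  obtain ⟨θ₁, w₁, a₁, h⟩ := h.exs_inv hθ hψ
  obtain ⟨p₁, h⟩ := h.and_inv
  obtain ⟨θ₂, w₂, a₂, p₂⟩ := h.and_inv.1.exs_inv w₁ hψ'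
  rw [← List.append_assoc] at w₂
  exact ⟨θ₁, θ₂, w₁, w₂, a₁, fun a ha => (a₁ a ha).trans (a₂ a (by simp [ha])), a₂, p₁, p₂,
    h.and_inv.2⟩

theorem Idx.eval_add_comm (c : CostModel) (I J : Idx) (ρ η : ℕ → EReal) :
    (I + J).eval c ρ η = (J + I).eval c ρ η := by
  simp only [Idx.eval_add, add_comm (I.eval c ρ η)]

theorem EEnv.dom_subset_append_right (ψ ψa : EEnv) : ψa.dom ⊆ EEnv.dom (ψ ++ ψa) := by
  simp

/-- Cost constants are nonnegative, so `-c ≤ 0 ≤ c`; adding the same extended real preserves the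
inequality. It bridges the sign of `c_app` in the e/app rules of the two systems. -/
theorem Idx.eval_sub_cst_le_add_cst (c : CostModel) (I : Idx) (k : CostConst) (ρ η : ℕ → EReal) :
    (I - .cst k).eval c ρ η ≤ (I + .cst k).eval c ρ η := by
  simp only [Idx.eval_sub, Idx.eval_add, sub_eq_add_neg]
  gcongr
  simp only [Idx.eval]
  have h : (0 : ℝ) ≤ c k := (c k).2
  exact_mod_cast (neg_nonpos.2 h).trans h

/-! Soundness of relational typechecking. -/

mutual

/-- As in the unary case, with one cost instead of two. The asynchronous rules and `switch` call
unary soundness on a projected context. -/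
theorem ChkR.sound {c : CostModel} {Υ : PrimEnv} (hΥ : Υ.Closed) :
    ∀ {Δ : UEnv} {ψa : EEnv} {Φa : CEnv} {Γ : RCtx} {e e' : Expr} {τ : RTy} {t : Idx} {Φ : CForm},
      ChkR c Υ Δ ψa Φa Γ e e' τ t Φ → ∀ {θ : ℕ → Idx} {Φb : CEnv} {Γ' : RCtx},
      RInst Δ ψa Φa Γ θ Φb Γ' → τ.Scoped Δ.length ψa.dom → t.Scoped Δ.length ψa.dom →
      Prov c Δ Φb (Φ.subst (.ofE θ)) →
      CoreR c Υ Δ Φb Γ' e.erase e'.erase (t.subst (.ofE θ)) (τ.subst (.ofE θ))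
  | _, _, _, _, _, _, _, _, _, .switch hf h₁ h₂ => by
    intro hI hτ ht hΦ
    have fr := Fresh.split (l := [_, _]) hf (reals_dom _)
    obtain ⟨θ₁, θ₂, w₁, w₂, a₁, a₂, a₁₂, p₁, p₂⟩ := hΦ.exs_and_exs_inv hI.wf fr.1 fr.2
    have c₁ := h₁.sound hΥ ((hI.proj true).extend w₁ a₁) (hτ.1.mono le_rfl (fun _ h => by simp [h]))
      (Idx.scoped_evar (by simp)) (Idx.scoped_evar (by simp)) p₁
    have c₂ := h₂.sound hΥ ((hI.proj false).extend (w₂.mono (by simp)) a₂)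
      (hτ.2.mono le_rfl (fun _ h => by simp [h])) (Idx.scoped_evar (by simp))
      (Idx.scoped_evar (by simp)) p₂.and_inv.1
    rw [Idx.Scoped.ofE_congr a₁₂ (d := 0) (Idx.scoped_evar (by simp)),
      Idx.Scoped.ofE_congr a₁₂ (d := 0) (Idx.scoped_evar (by simp)), ← hτ.1.ofE_congr a₁,
      hτ.1.ofE_congr a₂] at c₁
    rw [hτ.ofE_congr a₂, ht.ofE_congr a₂]
    exact (CoreR.switch c₁ c₂).of_eq p₂.and_inv.2.eq_inv
  | _, _, _, _, _, _, _, _, _, .nc hf h hD => by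
    intro hI hτ ht hΦ
    obtain ⟨p₁, p⟩ := hΦ.and_inv
    obtain ⟨θ₁, w₁, a₁, p⟩ := p.exs_inv hI.wf hf.reals
    have c₁ := h.sound hΥ ((hI.box hD).extend w₁ a₁) (RTy.Scoped.mono hτ le_rfl (fun _ h => by simp [h]))
      (Idx.scoped_evar (by simp)) p
    -- The cost `t'` of the body is discarded; the equation `0 = t` lies outside its quantifier and
    -- is used under the original `θ`.
    have hc := (CoreR.nc c₁ (hI.extends_box hD)).of_eq p₁.eq_inv
    rw [hτ.ofE_congr a₁]
    exact hc
  | _, _, _, _, _, _, _, _, _, .pair hf h₁ h₂ => by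
    intro hI hτ ht hΦ
    have fr := Fresh.split (l := [_]) hf (reals_dom _)
    obtain ⟨θ₁, θ₂, w₁, w₂, a₁, a₂, a₁₂, p₁, p₂⟩ := hΦ.exs_and_exs_inv hI.wf fr.1 fr.2
    have c₁ := h₁.sound hΥ (hI.extend w₁ a₁) (hτ.1.mono le_rfl (fun _ h => by simp [h]))
      (Idx.scoped_evar (by simp)) p₁
    have c₂ := h₂.sound hΥ (hI.extend (w₂.mono (by simp)) a₂) (hτ.2.mono le_rfl (fun _ h => by simp [h]))
      (Idx.scoped_evar (by simp)) p₂.and_inv.1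
    rw [Idx.Scoped.ofE_congr a₁₂ (d := 0) (Idx.scoped_evar (by simp)), ← hτ.1.ofE_congr a₁,
      hτ.1.ofE_congr a₂] at c₁
    rw [hτ.ofE_congr a₂, ht.ofE_congr a₂]
    exact (CoreR.pair c₁ c₂).of_eq p₂.and_inv.2.eq_inv
  | _, _, _, _, _, _, _, _, _, .inl h hσ => by
    intro hI hτ ht hΦ
    exact .inl (h.sound hΥ hI hτ.1 ht hΦ) (hσ.subst hI.wf.sorted)
  | _, _, _, _, _, _, _, _, _, .inr h hσ => by
    intro hI hτ ht hΦ
    exact .inr (h.sound hΥ hI hτ.2 ht hΦ) (hσ.subst hI.wf.sorted)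
  | _, _, _, _, _, _, _, _, _, .case h₁ hf h₂ h₃ => by
    intro hI hτ ht hΦ
    obtain ⟨θ₁, θ₂, w₁, w₂, a₁, a₂, a₁₂, p₁, p₂⟩ := hΦ.exs_and_exs_inv hI.wf h₁.fresh hf.reals
    obtain ⟨p₂, p⟩ := p₂.and_inv
    obtain ⟨sA, st⟩ := h₁.scoped hΥ hI.ctx
    have c₁ := h₁.sound hΥ hI a₁ w₁ p₁
    rw [sA.ofE_congr a₁₂, st.ofE_congr a₁₂] at c₁
    have sA' (ψ) := sA.mono le_rfl (EEnv.dom_subset_append ψ _ _)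
    have I₂ := hI.extend w₂ a₂
    obtain ⟨p₃, p⟩ := p.and_inv
    have c₂ := h₂.sound hΥ (I₂.bind _ (sA' _).1) (hτ.mono le_rfl (fun _ h => by simp [h])) (Idx.scoped_evar (by simp)) p₂
    have c₃ := h₃.sound hΥ (I₂.bind _ (sA' _).2) (hτ.mono le_rfl (fun _ h => by simp [h])) (Idx.scoped_evar (by simp)) p₃
    rw [hτ.ofE_congr a₂, ht.ofE_congr a₂]
    -- Here too the algorithm lists the cost of the branches first.
    exact (CoreR.case c₁ c₂ c₃).of_eq
      (p.eq_inv.eq_symm.eq_trans_eval fun _ _ => Idx.eval_add_comm ..).eq_symm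
  | _, _, _, _, _, _, _, _, _, .fix h => by
    intro hI hτ ht hΦ
    obtain ⟨p₁, p⟩ := hΦ.and_inv
    exact (CoreR.fix (h.sound hΥ ((hI.bind _ hτ).bind _ hτ.1) hτ.2.2 hτ.2.1 p₁)).of_eq p.eq_inv
  | _, _, _, _, _, _, _, _, _, .fixNC h hD => by
    intro hI hτ ht hΦ
    obtain ⟨p₁, p⟩ := hΦ.and_inv
    have c₁ := h.sound hΥ (((hI.box hD).bind _ hτ).bind _ hτ.1) hτ.2.2 hτ.2.1 p₁
    exact (CoreR.fixNC c₁ (hI.extends_box hD)).of_eq p.eq_inv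
  | _, _, _, _, _, _, _, _, _, .iLam h => by
    intro hI hτ ht hΦ
    obtain ⟨p₁, p⟩ := hΦ.and_inv
    have c₁ := h.sound hΥ (hI.shift _) hτ.2 hτ.1 p₁.all_ofE_inv
    rw [← ISubst.ofE_lift] at c₁
    exact (CoreR.iLam c₁).of_eq p.eq_inv
  | _, _, _, _, _, _, _, _, _, .pack h hJ => by
    intro hI hτ ht hΦ
    have c₁ := h.sound hΥ hI (RTy.Scoped.subst hτ (ISubst.maps_inst hJ.scoped _)) ht hΦ
    rw [RTy.subst_inst_ofE hJ.scoped] at c₁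
    exact .pack c₁ hJ
  | _, _, _, _, _, _, _, _, _, .unpack h₁ hf h₂ => by
    intro hI hτ ht hΦ
    obtain ⟨θ₁, θ₂, w₁, w₂, a₁, a₂, a₁₂, p₁, p₂⟩ := hΦ.exs_and_exs_inv hI.wf h₁.fresh hf.reals
    obtain ⟨p₂, p⟩ := p₂.and_inv
    obtain ⟨sA, st⟩ := h₁.scoped hΥ hI.ctx
    have c₁ := h₁.sound hΥ hI a₁ w₁ p₁
    rw [sA.ofE_congr a₁₂, st.ofE_congr a₁₂] at c₁
    have sA' (ψ) := sA.mono le_rfl (EEnv.dom_subset_append ψ _ _)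
    have I₂ := hI.extend w₂ a₂
    have c₂ := h₂.sound hΥ ((I₂.shift _).bind _ (sA' _))
      ((hτ.mono le_rfl (fun _ h => by simp [h])).subst (ISubst.maps_shift _ _))
      (Idx.scoped_evar (by simp)) p₂.all_ofE_inv
    rw [RTy.subst_shift_up, Idx.evar_subst_up, ← ISubst.ofE_lift] at c₂
    rw [hτ.ofE_congr a₂, ht.ofE_congr a₂]
    exact (CoreR.unpack c₁ c₂).of_eq p.eq_inv
  | _, _, _, _, _, _, _, _, _, .nil hσ => by
    intro hI hτ ht hΦ
    obtain ⟨p₁, p⟩ := hΦ.and_inv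
    exact (CoreR.nil (hσ.subst hI.wf.sorted)).sub
      (.list (EqR.refl _) p₁.eq_inv.eq_symm (.eq_refl _)) p.eq_inv.le_of_eq
  | _, _, _, _, _, _, _, _, _, .consNC (i := i) (t₂ := t₂) hf h₁ h₂ => by
    intro hI hτ ht hΦ
    have fr := Fresh.split (l := [_]) (ψ := reals [t₂] ++ [(i, .nat)]) hf (by simp)
    obtain ⟨θ₁, θ₂, w₁, w₂, a₁, a₂, a₁₂, p₁, p₂⟩ := Prov.exs_and_exs_inv
      (ψ' := reals [t₂] ++ [(i, .nat)]) hΦ hI.wf fr.1 fr.2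
    obtain ⟨p₂, p⟩ := p₂.and_inv
    have c₁ := h₁.sound hΥ (hI.extend w₁ a₁) (hτ.2.2.mono le_rfl (fun _ h => by simp [h]))
      (Idx.scoped_evar (by simp)) p₁
    have c₂ := h₂.sound hΥ (hI.extend (w₂.mono fun _ h => by grind) a₂)
      ⟨(Idx.scoped_evar (by simp)), (hτ.2.1.mono le_rfl (fun _ h => by simp [h])),
        (hτ.2.2.mono le_rfl (fun _ h => by simp [h]))⟩ (Idx.scoped_evar (by simp)) p₂
    rw [Idx.Scoped.ofE_congr a₁₂ (d := 0) (Idx.scoped_evar (by simp)), ← RTy.Scoped.ofE_congr a₁ (τ := .box _) hτ.2.2,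
      RTy.Scoped.ofE_congr a₂ (τ := .box _) hτ.2.2] at c₁
    rw [hτ.ofE_congr a₂, ht.ofE_congr a₂]
    exact (CoreR.consNC c₁ c₂).sub
      (.list (EqR.refl _) p.and_inv.1.eq_inv.eq_symm (.eq_refl _)) p.and_inv.2.eq_inv.le_of_eq
  | _, _, _, _, _, _, _, _, _, .consC (ψa := ψa) (t₁ := t₁) (i := i) (β := β) (t₂ := t₂) hf h₁ h₂ => by
    intro hI hτ ht hΦ
    have fr := Fresh.split (l := [_]) (ψ := (reals [t₂] ++ [(i, .nat)]) ++ [(β, .nat)]) hf (by simp)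
    -- The equation for `n` separates the quantifier over `β` from those over `t₂` and `i`, so the
    -- second block is opened in two stages and a third substitution arises.
    have fi := fr.2.of_append
    obtain ⟨θ₁, θ₂, w₁, w₂, a₁, a₂, a₁₂, p₁, p₂⟩ := Prov.exs_and_exs_inv
      (ψ' := reals [t₂] ++ [(i, .nat)]) hΦ hI.wf fr.1 fi.1
    obtain ⟨pn, p₂⟩ := p₂.and_inv
    rw [List.append_assoc] at w₂
    obtain ⟨θ₃, w₃, a₂₃, p₃⟩ := Prov.exs_inv (ψ := [(β, .nat)]) p₂ w₂ fi.2
    obtain ⟨p₃, p⟩ := p₃.and_inv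
    have a₃ := fun a (h : a ∈ ψa.dom) => (a₂ a h).trans (a₂₃ a (by simp [h]))
    have a₁₃ : ∀ a ∈ (reals [t₁] ++ ψa).dom, θ₁ a = θ₃ a := fun a h =>
      (a₁₂ a h).trans (a₂₃ a (by rw [EEnv.dom_append]; exact List.mem_append_right _ h))
    have c₁ := h₁.sound hΥ (hI.extend w₁ a₁) (hτ.2.2.mono le_rfl (fun _ h => by simp [h]))
      (Idx.scoped_evar (by simp)) p₁
    have c₂ := h₂.sound hΥ (hI.extend (w₃.mono fun _ h => by grind) a₃)
      ⟨(Idx.scoped_evar (by simp)), (Idx.scoped_evar (by simp)),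
        (hτ.2.2.mono le_rfl (fun _ h => by simp [h]))⟩ (Idx.scoped_evar (by simp)) p₃
    have hn := pn.eq_inv
    -- The length equation was obtained before the witness for `β` and is carried from `θ₂` to `θ₃`.
    rw [hτ.1.ofE_congr a₃ |>.symm.trans (hτ.1.ofE_congr a₂) |>.symm,
      Idx.Scoped.ofE_congr a₂₃ (I := .succ (.evar i)) (d := 0) (Idx.scoped_evar (a := i) (d := 0) (by simp))] at hn
    rw [Idx.Scoped.ofE_congr a₁₃ (d := 0) (Idx.scoped_evar (by simp)),
      ← RTy.Scoped.ofE_congr a₁ hτ.2.2, RTy.Scoped.ofE_congr a₃ hτ.2.2] at c₁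
    rw [hτ.ofE_congr a₃, ht.ofE_congr a₃]
    exact (CoreR.consC c₁ c₂).sub
      (.list (EqR.refl _) hn.eq_symm p.and_inv.1.eq_inv.eq_symm) p.and_inv.2.eq_inv.le_of_eq
  | _, _, _, _, _, _, _, _, _, .caseL h₁ hf h₂ h₃ h₄ => by
    intro hI hτ ht hΦ
    obtain ⟨θ₁, θ₂, w₁, w₂, a₁, a₂, a₁₂, p₁, p₂⟩ := hΦ.exs_and_exs_inv hI.wf h₁.fresh hf.reals
    obtain ⟨p₂, p⟩ := p₂.and_inv
    obtain ⟨sA, st⟩ := h₁.scoped hΥ hI.ctx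
    have c₁ := h₁.sound hΥ hI a₁ w₁ p₁
    rw [sA.ofE_congr a₁₂, st.ofE_congr a₁₂] at c₁
    have sA' (ψ) := sA.mono le_rfl (EEnv.dom_subset_append ψ _ _)
    have I₂ := hI.extend w₂ a₂
    obtain ⟨p₂, p₃⟩ := p₂.and_inv
    obtain ⟨p₃, p₄⟩ := p₃.all_ofE_inv.imp_inv.and_inv
    have sA₁ (ψ) := (sA' ψ).2.2.subst (ISubst.maps_shift _ _)
    have sα (ψ) := (sA' ψ).2.1.subst (ISubst.maps_shift _ _)
    have c₂ := h₂.sound hΥ (I₂.assume (C := .eq _ .zero) ⟨(sA' _).1, trivial⟩)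
      (hτ.mono le_rfl (fun _ h => by simp [h])) (Idx.scoped_evar (by simp)) p₂.imp_inv
    have I₃ := (I₂.shift .nat).assume (consEq_scoped (sA' _).1)
    have c₃ := h₃.sound hΥ ((I₃.bind _ (τ := .list (.var 0) _ _)
      ⟨Nat.succ_pos _, sα _, sA₁ _⟩).bind _ (τ := .box _) (sA₁ _))
      ((hτ.mono le_rfl (fun _ h => by simp [h])).subst (ISubst.maps_shift _ _)) (Idx.scoped_evar (by simp)) p₃
    have sA₂ (ψ) := (sA₁ ψ).subst (ISubst.maps_shift _ _)
    -- Two index binders are crossed in turn, each with its own equation: the first for `n`, the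
    -- second for `α`, which is weakened once because `i` is already bound. The tail therefore has
    -- length `.var 1` and difference count `.var 0`.
    have c₄ := h₄.sound hΥ ((((I₂.shift .nat).assume (consEq_scoped (sA' _).1)).shift .nat).assume
      (consEq_scoped (sα _)) |>.bind _ (τ := .list (.var 1) (.var 0) _)
      ⟨Nat.succ_lt_succ (Nat.succ_pos _), Nat.succ_pos _, sA₂ _⟩ |>.bind _ (sA₂ _))
      (((hτ.mono le_rfl (fun _ h => by simp [h])).subst (ISubst.maps_shift _ _)).subst
        (ISubst.maps_shift _ _))
      (Idx.scoped_evar (by simp)) p₄.all_ofE_inv.imp_inv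
    simp only [RTy.subst, RTy.subst_shift_up, Idx.subst_shift_up, Idx.evar_subst_up,
      consEq_subst] at c₃ c₄
    rw [hτ.ofE_congr a₂, ht.ofE_congr a₂]
    exact (CoreR.caseL c₁ c₂ c₃ c₄).of_eq p.eq_inv
  | _, _, _, _, _, _, _, _, _, .letE h₁ hf h₂ => by
    intro hI hτ ht hΦ
    obtain ⟨θ₁, θ₂, w₁, w₂, a₁, a₂, a₁₂, p₁, p₂⟩ := hΦ.exs_and_exs_inv hI.wf h₁.fresh hf.reals
    obtain ⟨p₂, p⟩ := p₂.and_inv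
    obtain ⟨sA, st⟩ := h₁.scoped hΥ hI.ctx
    have c₁ := h₁.sound hΥ hI a₁ w₁ p₁
    rw [sA.ofE_congr a₁₂, st.ofE_congr a₁₂] at c₁
    have sA' (ψ) := sA.mono le_rfl (EEnv.dom_subset_append ψ _ _)
    have I₂ := hI.extend w₂ a₂
    have c₂ := h₂.sound hΥ (I₂.bind _ (sA' _)) (hτ.mono le_rfl (fun _ h => by simp [h])) (Idx.scoped_evar (by simp)) p₂
    rw [hτ.ofE_congr a₂, ht.ofE_congr a₂]
    exact (CoreR.letE c₁ c₂).of_eq p.eq_inv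
  | _, _, _, _, _, _, _, _, _, .candI h => by
    intro hI hτ ht hΦ
    obtain ⟨p₁, p⟩ := hΦ.and_inv
    exact .candI p₁.atom_inv (h.sound hΥ (hI.assume hτ.1) hτ.2 ht p.imp_inv)
  | _, _, _, _, _, _, _, _, _, .candE h₁ hf h₂ => by
    intro hI hτ ht hΦ
    obtain ⟨θ₁, θ₂, w₁, w₂, a₁, a₂, a₁₂, p₁, p₂⟩ := hΦ.exs_and_exs_inv hI.wf h₁.fresh hf.reals
    obtain ⟨p₂, p⟩ := p₂.and_inv
    obtain ⟨sA, st⟩ := h₁.scoped hΥ hI.ctx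
    have c₁ := h₁.sound hΥ hI a₁ w₁ p₁
    rw [sA.ofE_congr a₁₂, st.ofE_congr a₁₂] at c₁
    have sA' (ψ) := sA.mono le_rfl (EEnv.dom_subset_append ψ _ _)
    have I₂ := hI.extend w₂ a₂
    have c₂ := h₂.sound hΥ ((I₂.assume (sA' _).1).bind _ (sA' _).2)
      (hτ.mono le_rfl (fun _ h => by simp [h])) (Idx.scoped_evar (by simp)) p₂.imp_inv
    rw [hτ.ofE_congr a₂, ht.ofE_congr a₂]
    exact (CoreR.candE c₁ c₂).of_eq p.eq_inv
  | _, _, _, _, _, _, _, _, _, .cimpI h => by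
    intro hI hτ ht hΦ
    exact .cimpI (h.sound hΥ (hI.assume hτ.1) hτ.2 ht hΦ.imp_inv)
  | _, _, _, _, _, _, _, _, _, .split h₁ h₂ hC => by
    intro hI hτ ht hΦ
    have sC (E) := hC.scoped.mono le_rfl (List.nil_subset E)
    have c₁ := h₁.sound hΥ (hI.assume (sC _)) hτ ht hΦ.and_inv.1.imp_inv
    have c₂ := h₂.sound hΥ (hI.assume (C := .neg _) (sC _)) hτ ht hΦ.and_inv.2.imp_inv
    simp only [Constr.subst, hC.scoped.subst_ofE_of_nil] at c₁ c₂
    exact .split c₁ c₂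
  | _, _, _, _, _, _, _, _, _, .contra h hΓ => by
    intro hI hτ ht hΦ
    exact .contra (hI.eq ▸ h.subst_ofE hI.wf) (hI.ctx_wf hΓ)
  | _, _, _, _, _, _, _, _, _, .updown h₁ h₂ => by
    intro hI hτ ht hΦ
    obtain ⟨θ₁, w₁, a₁, p⟩ := hΦ.exs_inv hI.wf h₁.fresh
    obtain ⟨p₁, p⟩ := p.and_inv
    have c₁ := h₁.sound hΥ hI a₁ w₁ p₁.and_inv.1
    rw [hτ.ofE_congr a₁, ht.ofE_congr a₁]
    exact c₁.sub (h₂.sound p₁.and_inv.2) p.le_inv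
  | _, _, _, _, _, _, _, _, _, .let_e h₁ hf h₂ => by
    intro hI hτ ht hΦ
    obtain ⟨θ₁, θ₂, w₁, w₂, a₁, a₂, a₁₂, p₁, p₂⟩ := hΦ.exs_and_exs_inv hI.wf h₁.fresh hf.reals
    obtain ⟨p₂, p⟩ := p₂.and_inv
    obtain ⟨sA, sk, st⟩ := h₁.scoped hΥ (hI.ctx.proj true)
    have c₁ := h₁.sound hΥ (hI.proj true) a₁ w₁ p₁
    rw [sA.ofE_congr a₁₂, sk.ofE_congr a₁₂, st.ofE_congr a₁₂] at c₁
    have sA' (ψ) := sA.mono le_rfl (EEnv.dom_subset_append ψ _ _)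
    have I₂ := hI.extend w₂ a₂
    have c₂ := h₂.sound hΥ (I₂.bind _ (τ := .U _ _) ⟨sA' _, sA' _⟩)
      (hτ.mono le_rfl (fun _ h => by simp [h])) (Idx.scoped_evar (by simp)) p₂
    rw [hτ.ofE_congr a₂, ht.ofE_congr a₂]
    exact (CoreR.let_e c₁ c₂).of_eq p.eq_inv
  | _, _, _, _, _, _, _, _, _, .e_let h₁ hf h₂ => by
    intro hI hτ ht hΦ
    obtain ⟨θ₁, θ₂, w₁, w₂, a₁, a₂, a₁₂, p₁, p₂⟩ := hΦ.exs_and_exs_inv hI.wf h₁.fresh hf.reals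
    obtain ⟨p₂, p⟩ := p₂.and_inv
    obtain ⟨sA, sk, st⟩ := h₁.scoped hΥ (hI.ctx.proj false)
    have c₁ := h₁.sound hΥ (hI.proj false) a₁ w₁ p₁
    rw [sA.ofE_congr a₁₂, sk.ofE_congr a₁₂, st.ofE_congr a₁₂] at c₁
    have sA' (ψ) := sA.mono le_rfl (EEnv.dom_subset_append ψ _ _)
    have I₂ := hI.extend w₂ a₂
    have c₂ := h₂.sound hΥ (I₂.bind _ (τ := .U _ _) ⟨sA' _, sA' _⟩)
      (hτ.mono le_rfl (fun _ h => by simp [h])) (Idx.scoped_evar (by simp)) p₂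
    rw [hτ.ofE_congr a₂, ht.ofE_congr a₂]
    exact (CoreR.e_let c₁ c₂).of_eq p.eq_inv
  | _, _, _, _, _, _, _, _, _, .app_e h₁ hf h₂ h₃ => by
    intro hI hτ ht hΦ
    obtain ⟨θ₁, θ₂, w₁, w₂, a₁, a₂, a₁₂, p₁, p₂, p₃⟩ :=
      hΦ.exs_and_exs_and_inv hI.wf h₁.fresh hf.reals
    obtain ⟨p₂, p⟩ := p₂.and_inv
    obtain ⟨sA, sk, st⟩ := h₁.scoped hΥ (hI.ctx.proj true)
    -- Relational subsumption goes through `≡`, which on `U` would demand subtyping in both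
    -- directions. The one-sided subtyping of the result is therefore performed on the unary type of
    -- the function, covariantly in its codomain.
    have c₁ := (h₁.sound hΥ (hI.proj true) a₁ w₁ p₁).sub
      (.arr .refl (h₃.sound p₃) (.le_refl _) (.le_refl _)) (.le_refl _) (.le_refl _)
    have sB (ψ) := hτ.1.mono le_rfl (EEnv.dom_subset_append_right ψ _)
    rw [sA.1.ofE_congr a₁₂, sA.2.1.ofE_congr a₁₂, sA.2.2.1.ofE_congr a₁₂, (sB _).ofE_congr a₁₂,
      sk.ofE_congr a₁₂, st.ofE_congr a₁₂] at c₁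
    have sA' (ψ) := sA.mono le_rfl (EEnv.dom_subset_append ψ _ _)
    have c₂ := h₂.sound hΥ (hI.extend w₂ a₂) ⟨(sA' _).1, (hτ.2.mono le_rfl (fun _ h => by simp [h]))⟩
      (Idx.scoped_evar (by simp)) p₂
    rw [hτ.ofE_congr a₂, ht.ofE_congr a₂]
    exact (CoreR.app_e c₁ c₂).of_eq p.eq_inv
  | _, _, _, _, _, _, _, _, _, .e_app h₁ hf h₂ h₃ => by
    intro hI hτ ht hΦ
    obtain ⟨θ₁, θ₂, w₁, w₂, a₁, a₂, a₁₂, p₁, p₂, p₃⟩ :=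
      hΦ.exs_and_exs_and_inv hI.wf h₁.fresh hf.reals
    obtain ⟨p₂, p⟩ := p₂.and_inv
    obtain ⟨sA, sk, st⟩ := h₁.scoped hΥ (hI.ctx.proj false)
    have c₁ := (h₁.sound hΥ (hI.proj false) a₁ w₁ p₁).sub
      (.arr .refl (h₃.sound p₃) (.le_refl _) (.le_refl _)) (.le_refl _) (.le_refl _)
    have sB (ψ) := hτ.2.mono le_rfl (EEnv.dom_subset_append_right ψ _)
    rw [sA.1.ofE_congr a₁₂, sA.2.1.ofE_congr a₁₂, sA.2.2.1.ofE_congr a₁₂, (sB _).ofE_congr a₁₂,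
      sk.ofE_congr a₁₂, st.ofE_congr a₁₂] at c₁
    have sA' (ψ) := sA.mono le_rfl (EEnv.dom_subset_append ψ _ _)
    have c₂ := h₂.sound hΥ (hI.extend w₂ a₂) ⟨(hτ.1.mono le_rfl (fun _ h => by simp [h])), (sA' _).1⟩
      (Idx.scoped_evar (by simp)) p₂
    rw [hτ.ofE_congr a₂, ht.ofE_congr a₂]
    -- The algorithm adds `c_app` where the core rule subtracts it; the core cost is smaller, so
    -- subsumption still applies.
    exact (CoreR.e_app c₁ c₂).sub (EqR.refl _)
      (p.eq_inv.le_of_eq_of_le fun _ _ => Idx.eval_sub_cst_le_add_cst ..)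
  | _, _, _, _, _, _, _, _, _, .case_e h₁ hf h₂ h₃ => by
    intro hI hτ ht hΦ
    obtain ⟨θ₁, θ₂, w₁, w₂, a₁, a₂, a₁₂, p₁, p₂⟩ := hΦ.exs_and_exs_inv hI.wf h₁.fresh hf.reals
    obtain ⟨p₂, p⟩ := p₂.and_inv
    obtain ⟨sA, sk, st⟩ := h₁.scoped hΥ (hI.ctx.proj true)
    have c₁ := h₁.sound hΥ (hI.proj true) a₁ w₁ p₁
    rw [sA.ofE_congr a₁₂, sk.ofE_congr a₁₂, st.ofE_congr a₁₂] at c₁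
    have sA' (ψ) := sA.mono le_rfl (EEnv.dom_subset_append ψ _ _)
    have I₂ := hI.extend w₂ a₂
    obtain ⟨p₃, p⟩ := p.and_inv
    have c₂ := h₂.sound hΥ (I₂.bind _ (τ := .U _ _) ⟨(sA' _).1, (sA' _).1⟩)
      (hτ.mono le_rfl (fun _ h => by simp [h])) (Idx.scoped_evar (by simp)) p₂
    have c₃ := h₃.sound hΥ (I₂.bind _ (τ := .U _ _) ⟨(sA' _).2, (sA' _).2⟩)
      (hτ.mono le_rfl (fun _ h => by simp [h])) (Idx.scoped_evar (by simp)) p₃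
    rw [hτ.ofE_congr a₂, ht.ofE_congr a₂]
    exact (CoreR.case_e c₁ c₂ c₃).of_eq
      (p.eq_inv.eq_symm.eq_trans_eval fun _ _ => Idx.eval_add_right_comm ..).eq_symm
  | _, _, _, _, _, _, _, _, _, .e_case h₁ hf h₂ h₃ => by
    intro hI hτ ht hΦ
    obtain ⟨θ₁, θ₂, w₁, w₂, a₁, a₂, a₁₂, p₁, p₂⟩ := hΦ.exs_and_exs_inv hI.wf h₁.fresh hf.reals
    obtain ⟨p₂, p⟩ := p₂.and_inv
    obtain ⟨sA, sk, st⟩ := h₁.scoped hΥ (hI.ctx.proj false)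
    have c₁ := h₁.sound hΥ (hI.proj false) a₁ w₁ p₁
    rw [sA.ofE_congr a₁₂, sk.ofE_congr a₁₂, st.ofE_congr a₁₂] at c₁
    have sA' (ψ) := sA.mono le_rfl (EEnv.dom_subset_append ψ _ _)
    have I₂ := hI.extend w₂ a₂
    obtain ⟨p₃, p⟩ := p.and_inv
    have c₂ := h₂.sound hΥ (I₂.bind _ (τ := .U _ _) ⟨(sA' _).1, (sA' _).1⟩)
      (hτ.mono le_rfl (fun _ h => by simp [h])) (Idx.scoped_evar (by simp)) p₂
    have c₃ := h₃.sound hΥ (I₂.bind _ (τ := .U _ _) ⟨(sA' _).2, (sA' _).2⟩)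
      (hτ.mono le_rfl (fun _ h => by simp [h])) (Idx.scoped_evar (by simp)) p₃
    rw [hτ.ofE_congr a₂, ht.ofE_congr a₂]
    exact (CoreR.e_case c₁ c₂ c₃).of_eq p.eq_inv

/-- As for unary inference, the values of all generated variables are given in advance, so only
conjunctions have to be inverted. -/
theorem InfR.sound {c : CostModel} {Υ : PrimEnv} (hΥ : Υ.Closed) :
    ∀ {Δ : UEnv} {ψa : EEnv} {Φa : CEnv} {Γ : RCtx} {e e' : Expr} {τ : RTy} {ψ : EEnv} {t : Idx}
      {Φ : CForm}, InfR c Υ Δ ψa Φa Γ e e' τ ψ t Φ →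
      ∀ {θa θ : ℕ → Idx} {Φb : CEnv} {Γ' : RCtx},
      RInst Δ ψa Φa Γ θa Φb Γ' → (∀ a ∈ ψa.dom, θa a = θ a) → SubstWf Δ θ (ψ ++ ψa) →
      Prov c Δ Φb (Φ.subst (.ofE θ)) →
      CoreR c Υ Δ Φb Γ' e.erase e'.erase (t.subst (.ofE θ)) (τ.subst (.ofE θ))
  | _, _, _, _, _, _, _, _, _, _, .switch h₁ h₂ _ => by
    intro hI ha w hΦ
    -- One substitution covers `ψ₁ ++ ψ₂`; each unary inference uses its restriction to its own
    -- variables.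
    exact .switch
      (h₁.sound hΥ (hI.proj true) ha (w.mono fun _ h => by grind) hΦ.and_inv.1)
      (h₂.sound hΥ (hI.proj false) ha (w.mono fun _ h => by grind) hΦ.and_inv.2)
  | _, _, _, _, _, _, _, _, _, _, .der h => fun hI ha w hΦ =>
    .der (h.sound hΥ hI ha w hΦ)
  | _, _, _, _, _, _, _, _, _, _, .num => fun _ _ _ _ => .num
  | _, _, _, _, _, _, _, _, _, _, .unit => fun _ _ _ _ => .unit
  | _, _, _, _, _, _, _, _, _, _, .var hx => by
    intro hI ha w hΦ
    exact .var (by rw [hI.lookup, hx, Option.map_some, (hI.ctx _ _ hx).ofE_congr ha])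
  | _, _, _, _, _, _, _, _, _, _, .fst h => fun hI ha w hΦ =>
    .fst (h.sound hΥ hI ha w hΦ)
  | _, _, _, _, _, _, _, _, _, _, .snd h => fun hI ha w hΦ =>
    .snd (h.sound hΥ hI ha w hΦ)
  | _, _, _, _, _, _, _, _, _, _, .app h₁ hf h₂ => by
    intro hI ha w hΦ
    have c₁ := h₁.sound hΥ hI ha (w.mono (by simp)) hΦ.and_inv.1
    have sA (ψ) := (h₁.scoped hΥ hI.ctx).1.1.mono le_rfl (EEnv.dom_subset_append ψ _ _)
    exact .app c₁ (h₂.sound hΥ (hI.extend w ha) (sA _) (Idx.scoped_evar (by simp)) hΦ.and_inv.2)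
  | _, _, _, _, _, _, _, _, _, _, .prim hζ hf h => by
    intro hI ha w hΦ
    obtain ⟨sτ, st, sσ⟩ := hΥ.2 _ _ _ _ hζ
    have c₁ := h.sound hΥ (hI.extend w ha) (sτ.mono (Nat.zero_le _) (List.nil_subset _))
      (Idx.scoped_evar (by simp)) hΦ
    rw [sτ.subst_ofE_of_nil] at c₁
    rw [sσ.subst_ofE_of_nil, Idx.subst_add, st.subst_ofE_of_nil]
    exact (CoreR.prim hζ c₁).of_eq
      ((Entails.eq_refl _).eq_trans_eval fun _ _ => Idx.eval_add_comm ..)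
  | _, _, _, _, _, _, _, _, _, _, .iApp h hJ => by
    intro hI ha w hΦ
    simp only [Idx.subst_add, Idx.subst_inst_ofE hJ.scoped, RTy.subst_inst_ofE hJ.scoped]
    exact .iApp (h.sound hΥ hI ha w hΦ) hJ
  | _, _, _, _, _, _, _, _, _, _, .cimpE h => fun hI ha w hΦ =>
    .cimpE (h.sound hΥ hI ha w hΦ.and_inv.2) hΦ.and_inv.1.atom_inv
  | _, _, _, _, _, _, _, _, _, _, .anno h _ sτ st => fun hI ha w hΦ =>
    h.sound hΥ (hI.extend w ha) (sτ.mono le_rfl (List.nil_subset _))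
      (st.mono le_rfl (List.nil_subset _)) hΦ

end

/-- The composition of well-sorted substitutions with disjoint domains. -/
theorem SubstOk.comp {Δ : UEnv} {θ θa : ℕ → Idx} {ψ ψa : EEnv} (hθ : SubstOk Δ θ ψ)
    (hθa : SubstOk Δ θa ψa) (hf : ψ.FreshFor ψa) :
    (∀ a ∈ ψa.dom, θa a = (θa a).subst (.ofE θ)) ∧
      SubstWf Δ (fun a => (θa a).subst (.ofE θ)) (ψ ++ ψa) := by
  have ha : ∀ a ∈ ψa.dom, θa a = (θa a).subst (.ofE θ) := fun a ha => by
    obtain ⟨⟨_, S⟩, hS, rfl⟩ := List.mem_map.1 ha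
    exact ((hθa.1 _ S hS).scoped.subst_ofE_of_nil θ).symm
  have hn : ∀ a, a ∉ ψa.dom → (θa a).subst (.ofE θ) = θ a := fun a ha => by
    rw [hθa.2 a ha]; rfl
  refine ⟨ha, fun a S hS => ?_, fun a => ?_⟩
  · rcases List.mem_append.1 hS with h | h
    · simp only [hn a (hf.2 a (List.mem_map.2 ⟨_, h, rfl⟩))]
      exact hθ.1 a S h
    · simp only [← ha a (List.mem_map.2 ⟨_, h, rfl⟩)]
      exact hθa.1 a S h
  · by_cases h : a ∈ ψa.dom
    · simp only [← ha a h]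
      exact hθa.substWf.2 a
    · simp only [hn a h]
      exact hθ.substWf.2 a

end BiRelCost

theorem mainTheorem1 (c : BiRelCost.CostModel) (Υ : BiRelCost.PrimEnv) (hΥ : Υ.Closed) :
    (∀ (Δ : BiRelCost.UEnv) (ψa : BiRelCost.EEnv) (Φa : BiRelCost.CEnv) (Ω : BiRelCost.UCtx)
        (e : BiRelCost.Expr) (A : BiRelCost.UTy) (k t : BiRelCost.Idx) (Φ : BiRelCost.CForm),
      BiRelCost.ChkU c Υ Δ ψa Φa Ω e A k t Φ →
      Φa.Scoped Δ.length ψa.dom → Ω.Scoped Δ.length ψa.dom → A.Scoped Δ.length ψa.dom →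
      k.Scoped Δ.length ψa.dom → t.Scoped Δ.length ψa.dom →
      ∀ θa : ℕ → BiRelCost.Idx, BiRelCost.SubstOk Δ θa ψa →
        BiRelCost.Prov c Δ (Φa.subst (.ofE θa)) (Φ.subst (.ofE θa)) →
        BiRelCost.CoreU c Υ Δ (Φa.subst (.ofE θa)) (Ω.subst (.ofE θa))
          (k.subst (.ofE θa)) (t.subst (.ofE θa)) e.erase (A.subst (.ofE θa))) ∧
    (∀ (Δ : BiRelCost.UEnv) (ψa : BiRelCost.EEnv) (Φa : BiRelCost.CEnv) (Ω : BiRelCost.UCtx)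
        (e : BiRelCost.Expr) (A : BiRelCost.UTy) (ψ : BiRelCost.EEnv) (k t : BiRelCost.Idx)
        (Φ : BiRelCost.CForm),
      BiRelCost.InfU c Υ Δ ψa Φa Ω e A ψ k t Φ →
      Φa.Scoped Δ.length ψa.dom → Ω.Scoped Δ.length ψa.dom →
      ∀ θ θa : ℕ → BiRelCost.Idx, BiRelCost.SubstOk Δ θ ψ → BiRelCost.SubstOk Δ θa ψa →
        BiRelCost.Prov c Δ (Φa.subst (.ofE θa)) ((Φ.subst (.ofE θa)).subst (.ofE θ)) →
        BiRelCost.CoreU c Υ Δ (Φa.subst (.ofE θa)) (Ω.subst (.ofE θa))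
          ((k.subst (.ofE θa)).subst (.ofE θ)) ((t.subst (.ofE θa)).subst (.ofE θ)) e.erase
          ((A.subst (.ofE θa)).subst (.ofE θ))) ∧
    (∀ (Δ : BiRelCost.UEnv) (ψa : BiRelCost.EEnv) (Φa : BiRelCost.CEnv) (Γ : BiRelCost.RCtx)
        (e e' : BiRelCost.Expr) (τ : BiRelCost.RTy) (t : BiRelCost.Idx) (Φ : BiRelCost.CForm),
      BiRelCost.ChkR c Υ Δ ψa Φa Γ e e' τ t Φ →
      Φa.Scoped Δ.length ψa.dom → Γ.Scoped Δ.length ψa.dom → τ.Scoped Δ.length ψa.dom →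
      t.Scoped Δ.length ψa.dom →
      ∀ θa : ℕ → BiRelCost.Idx, BiRelCost.SubstOk Δ θa ψa →
        BiRelCost.Prov c Δ (Φa.subst (.ofE θa)) (Φ.subst (.ofE θa)) →
        BiRelCost.CoreR c Υ Δ (Φa.subst (.ofE θa)) (Γ.subst (.ofE θa)) e.erase e'.erase
          (t.subst (.ofE θa)) (τ.subst (.ofE θa))) ∧
    (∀ (Δ : BiRelCost.UEnv) (ψa : BiRelCost.EEnv) (Φa : BiRelCost.CEnv) (Γ : BiRelCost.RCtx)
        (e e' : BiRelCost.Expr) (τ : BiRelCost.RTy) (ψ : BiRelCost.EEnv) (t : BiRelCost.Idx)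
        (Φ : BiRelCost.CForm),
      BiRelCost.InfR c Υ Δ ψa Φa Γ e e' τ ψ t Φ →
      Φa.Scoped Δ.length ψa.dom → Γ.Scoped Δ.length ψa.dom →
      ∀ θ θa : ℕ → BiRelCost.Idx, BiRelCost.SubstOk Δ θ ψ → BiRelCost.SubstOk Δ θa ψa →
        BiRelCost.Prov c Δ (Φa.subst (.ofE θa)) ((Φ.subst (.ofE θa)).subst (.ofE θ)) →
        BiRelCost.CoreR c Υ Δ (Φa.subst (.ofE θa)) (Γ.subst (.ofE θa)) e.erase e'.erase
          ((t.subst (.ofE θa)).subst (.ofE θ)) ((τ.subst (.ofE θa)).subst (.ofE θ))) := by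
  open BiRelCost in
  refine ⟨fun Δ ψa Φa Ω e A k t Φ h hΦa hΩ hA hk ht θa hθa hΦ => ?_,
    fun Δ ψa Φa Ω e A ψ k t Φ h hΦa hΩ θ θa hθ hθa hΦ => ?_,
    fun Δ ψa Φa Γ e e' τ t Φ h hΦa hΓ hτ ht θa hθa hΦ => ?_,
    fun Δ ψa Φa Γ e e' τ ψ t Φ h hΦa hΓ θ θa hθ hθa hΦ => ?_⟩
  -- The literal instances of `Φa` and `Ω` are instances in the sense of `UInst`, since lookup
  -- commutes with mapping over a context.
  · exact h.sound hΥ ⟨hθa.substWf, hΦa, hΩ, rfl, lookup_map (fun A : UTy => A.subst (.ofE θa)) Ω⟩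
      hA hk ht hΦ
  · obtain ⟨ha, w⟩ := hθ.comp hθa h.fresh
    -- The two successive substitutions of the statement are merged into the single one that
    -- inference soundness expects; for the constraint this uses that `θa` is clean.
    rw [CForm.subst_subst _ hθa.substWf.2] at hΦ
    simp only [Idx.subst_subst, UTy.subst_subst, ISubst.comp_ofE]
    exact h.sound hΥ ⟨hθa.substWf, hΦa, hΩ, rfl, lookup_map (fun A : UTy => A.subst (.ofE θa)) Ω⟩
      ha w hΦ
  · exact h.sound hΥ ⟨hθa.substWf, hΦa, hΓ, rfl, lookup_map (fun τ : RTy => τ.subst (.ofE θa)) Γ⟩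
      hτ ht hΦ
  · obtain ⟨ha, w⟩ := hθ.comp hθa h.fresh
    rw [CForm.subst_subst _ hθa.substWf.2] at hΦ
    simp only [Idx.subst_subst, RTy.subst_subst, ISubst.comp_ofE]
    exact h.sound hΥ ⟨hθa.substWf, hΦa, hΓ, rfl, lookup_map (fun τ : RTy => τ.subst (.ofE θa)) Γ⟩
      ha w hΦ
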